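/- **Setting.** For $i=1,2,\dots$ let $(T_i,\mathbf Z_i,Y_i(0),Y_i(1))$ be i.i.d. copies of $(T,\mathbf Z,Y(0),Y(1))$ with $T\in\{0,1\}$ and $\mathbf Z\in\mathbb R^p$. The observed outcome is $Y_i=(1-T_i)Y_i(0)+T_iY_i(1)$. The covariates are observed with error as $\mathbf Z_i^*=\mathbf Z_i+\boldsymbol\epsilon_i$, where the $\boldsymbol\epsilon_i$ are i.i.d. with mean zero and independent of $\{(T_i,\mathbf Z_i,Y_i)\}_{i\ge1}$ (components of $\boldsymbol\epsilon_i$ belonging to exactly measured covariates may be identically $0$). The distribution of the errors is known, and $M(\boldsymbol\theta)=E\exp(\boldsymbol\theta^\top\boldsymbol\epsilon)$. Let $n_1=\sum_{i\le n}T_i$, let $\bar{\mathbf Z}^{*,trt}$ and $\bar Y^{trt}$ be the sample means over the treated subjects among the first $n$, and $$L(\boldsymbol\theta;\mathcal O_1^*)=\log\Big\{\sum_{i\le n:\,T_i=0}\exp(\boldsymbol\theta^\top\mathbf Z_i^*)\Big\}-\boldsymbol\theta^\top\bar{\mathbf Z}^{*,trt}.$$ For a parameter space $\Theta\subseteq\mathbb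 R^p$, a corrected entropy balancing (CEB) estimator is a sequence of random vectors $\hat{\boldsymbol\theta}_c$ with $$\hat{\boldsymbol\theta}_c\in\operatorname*{argmin}_{\boldsymbol\theta\in\Theta}\{L(\boldsymbol\theta;\mathcal O_1^*)-\log M(\boldsymbol\theta)\}$$ with probability tending to one, and the CEB estimator of the ATT $\tau_0=E\{Y(1)-Y(0)\mid T=1\}$ is $$\hat\tau_c=\bar Y^{trt}-\sum_{i\le n:\,T_i=0}\hat w_{c,i}Y_i,\qquad \hat w_{c,i}=\frac{\exp(\hat{\boldsymbol\theta}_c^\top\mathbf Z_i^*)}{\sum_{j\le n:\,T_j=0}\exp(\hat{\boldsymbol\theta}_c^\top\mathbf Z_j^*)}.$$ **Assumptions.** 1. Strong ignorability: $\{Y(0),Y(1)\}\perp T\mid\mathbf Z$. 2. Logistic propensity score: $\Pr(T=1\mid\mathbf Z)=\operatorname{logit}^{-1}(\alpha_0+\boldsymbol\theta_0^\top\mathbf Z)$ for some $\alpha_0\in\mathbb R$ (possibly $0$) and $\boldsymbol\theta_0\in\mathbb R^p$. 3. Identifiability: $\mathbf a^\top\mathbf Z$ is not almost surely constant for any $\mathbf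 a\ne\mathbf 0$. 4. $\boldsymbol\theta_0$ is an interior point of $\Theta$, and either $\Theta$ is compact, or $\Theta$ is closed (for instance $\Theta=\mathbb R^p$) and $\boldsymbol\epsilon$ is almost surely bounded. 5. Moments: every point of $\Theta\cup\{\mathbf 0,2\boldsymbol\theta_0\}$ is an interior point of $\{\boldsymbol\theta: E[\exp(\boldsymbol\theta^\top\mathbf Z^*)\mid T=0]<\infty\}$, and $E[Y^2\mid T=1]<\infty$, $E[Y^2\exp(2\boldsymbol\theta_0^\top\mathbf Z)\mid T=0]<\infty$. **Asymptotic covariances.** Let $E_0$, $E_1$ denote expectation given $T=0$, $T=1$. Put $$A(\boldsymbol\theta)=\frac{E_0[Ye^{\boldsymbol\theta^\top\mathbf Z}]}{E_0[e^{\boldsymbol\theta^\top\mathbf Z}]},\qquad \mathbf B(\boldsymbol\theta)=\frac{E_0[\mathbf Ze^{\boldsymbol\theta^\top\mathbf Z}]}{E_0[e^{\boldsymbol\theta^\top\mathbf Z}]},$$ $$\mathbf H=\nabla\mathbf B(\boldsymbol\theta_0)=\frac{E_0[\mathbf Z\mathbf Z^\top e^{\boldsymbol\theta_0^\top\mathbf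 Z}]}{E_0[e^{\boldsymbol\theta_0^\top\mathbf Z}]}-\mathbf B(\boldsymbol\theta_0)\mathbf B(\boldsymbol\theta_0)^\top,\qquad \nabla A(\boldsymbol\theta_0)=\frac{E_0[Y\mathbf Z e^{\boldsymbol\theta_0^\top\mathbf Z}]}{E_0[e^{\boldsymbol\theta_0^\top\mathbf Z}]}-A(\boldsymbol\theta_0)\mathbf B(\boldsymbol\theta_0),$$ $$r_0=\frac{(1-T)e^{\boldsymbol\theta_0^\top\mathbf Z^*}}{\Pr(T=0)\,E_0[e^{\boldsymbol\theta_0^\top\mathbf Z^*}]},\qquad r_1=\frac{T}{\Pr(T=1)},$$ $$\boldsymbol\psi=r_0\Big(\mathbf Z^*-\frac{E_0[\mathbf Z^*e^{\boldsymbol\theta_0^\top\mathbf Z^*}]}{E_0[e^{\boldsymbol\theta_0^\top\mathbf Z^*}]}\Big)-r_1(\mathbf Z^*-E_1[\mathbf Z^*]),\qquad \eta=r_1(Y-E_1[Y])-r_0(Y-A(\boldsymbol\theta_0)),$$ $$\mathbf\Sigma_{\boldsymbol\theta_0}=\mathbf H^{-1}E[\boldsymbol\psi\boldsymbol\psi^\top](\mathbf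 H^{-1})^\top,\qquad \Sigma_{\tau_0}=E[\phi^2],\quad \phi=\eta+\nabla A(\boldsymbol\theta_0)^\top\mathbf H^{-1}\boldsymbol\psi .$$ **Theorem.** Under these assumptions, $\mathbf H$ is positive definite, $\boldsymbol\psi$ and $\phi$ are square integrable, and with probability tending to one as $n\to\infty$ a minimizer of $L(\boldsymbol\theta;\mathcal O_1^*)-\log M(\boldsymbol\theta)$ over $\Theta$ exists. Every CEB estimator satisfies, as $n\to\infty$, $$\hat{\boldsymbol\theta}_c\xrightarrow{p}\boldsymbol\theta_0,\qquad \hat\tau_c\xrightarrow{p}\tau_0,$$ $$\sqrt n(\hat{\boldsymbol\theta}_c-\boldsymbol\theta_0)\xrightarrow{d}MVN(\mathbf 0_p,\mathbf\Sigma_{\boldsymbol\theta_0}),\qquad \sqrt n(\hat\tau_c-\tau_0)\xrightarrow{d}N(0,\Sigma_{\tau_0}).$$ -/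

import Mathlib

open MeasureTheory ProbabilityTheory Filter Topology Set
open scoped RealInnerProductSpace

noncomputable section

namespace CEB

/-- The random quantities attached to subjects `0, 1, 2, …`: treatment indicator (`true` means
treated), true `p`-dimensional covariates, the two potential outcomes, and the `p`-dimensional
covariate measurement error. Only random functions are recorded here, no assumptions.
Components of the covariates that are measured exactly are those whose error is zero. -/
structure Sample (Ω : Type*) (p : ℕ) where
  /-- treatment indicator -/
  T : ℕ → Ω → Bool
  /-- true covariates -/
  Z : ℕ → Ω → EuclideanSpace ℝ (Fin p)
  /-- potential outcome under control -/
  Y0 : ℕ → Ω → ℝ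
  /-- potential outcome under treatment -/
  Y1 : ℕ → Ω → ℝ
  /-- measurement error -/
  err : ℕ → Ω → EuclideanSpace ℝ (Fin p)

/-- Conditional independence of `f` and `g` given the `σ`-algebra `m`, expressed through
conditional probabilities. (`ProbabilityTheory.CondIndepFun` is characterised by the same
identity, but is only available on standard Borel spaces.) -/
def CondIndepGiven {Ω β γ : Type*} (m : MeasurableSpace Ω) [mΩ : MeasurableSpace Ω]
    [MeasurableSpace β] [MeasurableSpace γ] (f : Ω → β) (g : Ω → γ) (μ : Measure[mΩ] Ω) : Prop :=
  ∀ (s : Set β) (t : Set γ), MeasurableSet s → MeasurableSet t →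
    μ[(f ⁻¹' s ∩ g ⁻¹' t).indicator (fun _ => (1 : ℝ)) | m] =ᵐ[μ]
      μ[(f ⁻¹' s).indicator (fun _ => (1 : ℝ)) | m] *
        μ[(g ⁻¹' t).indicator (fun _ => (1 : ℝ)) | m]

/-- The exponentially tilted mean `E[f exp(θᵀW)] / E[exp(θᵀW)]` under `ν`. -/
def tiltedMean {Ω F : Type*} {p : ℕ} [MeasurableSpace Ω] [NormedAddCommGroup F] [NormedSpace ℝ F]
    (ν : Measure Ω) (W : Ω → EuclideanSpace ℝ (Fin p)) (θ : EuclideanSpace ℝ (Fin p))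
    (f : Ω → F) : F :=
  (∫ ω, Real.exp ⟪θ, W ω⟫ ∂ν)⁻¹ • ∫ ω, Real.exp ⟪θ, W ω⟫ • f ω ∂ν

namespace Sample

variable {Ω : Type*} {p : ℕ}

/-- Observed outcome `Y = (1 - T) Y(0) + T Y(1)`. -/
def Y (S : Sample Ω p) (i : ℕ) (ω : Ω) : ℝ := if S.T i ω then S.Y1 i ω else S.Y0 i ω

/-- Mismeasured covariates `Z* = Z + ε`. -/
def Zstar (S : Sample Ω p) (i : ℕ) (ω : Ω) : EuclideanSpace ℝ (Fin p) := S.Z i ω + S.err i ω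

/-- The treated subjects among the first `n`. -/
def treatedIdx (S : Sample Ω p) (n : ℕ) (ω : Ω) : Finset ℕ :=
  (Finset.range n).filter (fun i => S.T i ω = true)

/-- The control subjects among the first `n`. -/
def controlIdx (S : Sample Ω p) (n : ℕ) (ω : Ω) : Finset ℕ :=
  (Finset.range n).filter (fun i => S.T i ω = false)

/-- Sample mean of a vector- or real-valued quantity over the treated group. -/
def treatedMean {F : Type*} [AddCommGroup F] [Module ℝ F] (S : Sample Ω p) (n : ℕ) (ω : Ω)
    (f : ℕ → Ω → F) : F :=
  ((S.treatedIdx n ω).card : ℝ)⁻¹ • ∑ i ∈ S.treatedIdx n ω, f i ω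

/-- The naive entropy balancing loss
`L(θ; O₁*) = log (∑_{T_i = 0} exp(θᵀ Z_i*)) - θᵀ Z̄*ᵗʳᵗ`. -/
def loss (S : Sample Ω p) (n : ℕ) (ω : Ω) (θ : EuclideanSpace ℝ (Fin p)) : ℝ :=
  Real.log (∑ i ∈ S.controlIdx n ω, Real.exp ⟪θ, S.Zstar i ω⟫)
    - ⟪θ, S.treatedMean n ω S.Zstar⟫

/-- The corrected entropy balancing weight of subject `i` at the parameter `θ`. -/
def weight (S : Sample Ω p) (n : ℕ) (ω : Ω) (θ : EuclideanSpace ℝ (Fin p)) (i : ℕ) : ℝ :=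
  Real.exp ⟪θ, S.Zstar i ω⟫ / ∑ j ∈ S.controlIdx n ω, Real.exp ⟪θ, S.Zstar j ω⟫

/-- The weighting estimator of the ATT at the parameter `θ`. -/
def attEst (S : Sample Ω p) (n : ℕ) (ω : Ω) (θ : EuclideanSpace ℝ (Fin p)) : ℝ :=
  S.treatedMean n ω S.Y - ∑ i ∈ S.controlIdx n ω, S.weight n ω θ i * S.Y i ω

variable [MeasurableSpace Ω]

/-- Moment generating function of the measurement error, `M(θ) = E exp(θᵀ ε)`. -/
def M (S : Sample Ω p) (μ : Measure Ω) (θ : EuclideanSpace ℝ (Fin p)) : ℝ :=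
  ∫ ω, Real.exp ⟪θ, S.err 0 ω⟫ ∂μ

/-- `θ` is a corrected entropy balancing estimate over the parameter space `Θ` for the sample
`ω` of size `n`: it minimises `L(θ; O₁*) - log M(θ)` over `Θ`. -/
def IsCEB (S : Sample Ω p) (μ : Measure Ω) (Θ : Set (EuclideanSpace ℝ (Fin p))) (n : ℕ) (ω : Ω)
    (θ : EuclideanSpace ℝ (Fin p)) : Prop :=
  θ ∈ Θ ∧ IsMinOn (fun t => S.loss n ω t - Real.log (S.M μ t)) Θ θ

/-- Conditional distribution given `T = 1` (for the first subject). -/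
def trt (S : Sample Ω p) (μ : Measure Ω) : Measure Ω := μ[|S.T 0 ⁻¹' {true}]

/-- Conditional distribution given `T = 0` (for the first subject). -/
def ctl (S : Sample Ω p) (μ : Measure Ω) : Measure Ω := μ[|S.T 0 ⁻¹' {false}]

/-- The average treatment effect on the treated, `τ₀ = E[Y(1) - Y(0) | T = 1]`. -/
def att (S : Sample Ω p) (μ : Measure Ω) : ℝ := ∫ ω, (S.Y1 0 ω - S.Y0 0 ω) ∂(S.trt μ)

/-- The parameters `θ` for which `E[exp(θᵀ Z*) | T = 0]` is finite. -/
def expDomain (S : Sample Ω p) (μ : Measure Ω) : Set (EuclideanSpace ℝ (Fin p)) :=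
  {θ | Integrable (fun ω => Real.exp ⟪θ, S.Zstar 0 ω⟫) (S.ctl μ)}

/-- `A(θ) = E[Y exp(θᵀZ) | T = 0] / E[exp(θᵀZ) | T = 0]`. -/
def A (S : Sample Ω p) (μ : Measure Ω) (θ : EuclideanSpace ℝ (Fin p)) : ℝ :=
  tiltedMean (S.ctl μ) (S.Z 0) θ (S.Y 0)

/-- `B(θ) = E[Z exp(θᵀZ) | T = 0] / E[exp(θᵀZ) | T = 0]`. -/
def B (S : Sample Ω p) (μ : Measure Ω) (θ : EuclideanSpace ℝ (Fin p)) :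
    EuclideanSpace ℝ (Fin p) :=
  tiltedMean (S.ctl μ) (S.Z 0) θ (S.Z 0)

/-- `∇A(θ) = E[Y Z exp(θᵀZ) | T = 0] / E[exp(θᵀZ) | T = 0] - A(θ) B(θ)`. -/
def gradA (S : Sample Ω p) (μ : Measure Ω) (θ : EuclideanSpace ℝ (Fin p)) :
    EuclideanSpace ℝ (Fin p) :=
  tiltedMean (S.ctl μ) (S.Z 0) θ (fun ω => S.Y 0 ω • S.Z 0 ω) - S.A μ θ • S.B μ θ

/-- `H(θ) = ∇B(θ) = E[Z Zᵀ exp(θᵀZ) | T = 0] / E[exp(θᵀZ) | T = 0] - B(θ) B(θ)ᵀ`, the limiting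
Hessian of the loss function. -/
def H (S : Sample Ω p) (μ : Measure Ω) (θ : EuclideanSpace ℝ (Fin p)) :
    Matrix (Fin p) (Fin p) ℝ :=
  Matrix.of fun i j =>
    tiltedMean (S.ctl μ) (S.Z 0) θ (fun ω => S.Z 0 ω i * S.Z 0 ω j) - S.B μ θ i * S.B μ θ j

/-- The factor `I(T = 0) exp(θᵀZ*) / (P(T = 0) E[exp(θᵀZ*) | T = 0])`. -/
def ctlFactor (S : Sample Ω p) (μ : Measure Ω) (θ : EuclideanSpace ℝ (Fin p)) (ω : Ω) : ℝ :=
  if S.T 0 ω then 0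
  else Real.exp ⟪θ, S.Zstar 0 ω⟫ /
    (μ.real (S.T 0 ⁻¹' {false}) * ∫ ω', Real.exp ⟪θ, S.Zstar 0 ω'⟫ ∂(S.ctl μ))

/-- The factor `I(T = 1) / P(T = 1)`. -/
def trtFactor (S : Sample Ω p) (μ : Measure Ω) (ω : Ω) : ℝ :=
  if S.T 0 ω then 1 / μ.real (S.T 0 ⁻¹' {true}) else 0

/-- Linearised estimating function of `θ`, i.e. the contribution of one subject to the gradient of
`L(θ; O₁*) - log M(θ)`. -/
def psi (S : Sample Ω p) (μ : Measure Ω) (θ : EuclideanSpace ℝ (Fin p)) (ω : Ω) :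
    EuclideanSpace ℝ (Fin p) :=
  S.ctlFactor μ θ ω • (S.Zstar 0 ω - tiltedMean (S.ctl μ) (S.Zstar 0) θ (S.Zstar 0))
    - S.trtFactor μ ω • (S.Zstar 0 ω - ∫ ω', S.Zstar 0 ω' ∂(S.trt μ))

/-- Contribution of one subject to the linearised ATT estimator with `θ` held fixed. -/
def eta (S : Sample Ω p) (μ : Measure Ω) (θ : EuclideanSpace ℝ (Fin p)) (ω : Ω) : ℝ :=
  S.trtFactor μ ω * (S.Y 0 ω - ∫ ω', S.Y 0 ω' ∂(S.trt μ))
    - S.ctlFactor μ θ ω * (S.Y 0 ω - S.A μ θ)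

/-- Full contribution of one subject to the linearised ATT estimator, including the effect of
estimating `θ`: `η + ∇A(θ)ᵀ H(θ)⁻¹ ψ`. -/
def phi (S : Sample Ω p) (μ : Measure Ω) (θ : EuclideanSpace ℝ (Fin p)) (ω : Ω) : ℝ :=
  S.eta μ θ ω + dotProduct (S.gradA μ θ).ofLp ((S.H μ θ)⁻¹.mulVec (S.psi μ θ ω).ofLp)

/-- The middle matrix `V = E[ψ ψᵀ]`. -/
def V (S : Sample Ω p) (μ : Measure Ω) (θ : EuclideanSpace ℝ (Fin p)) :
    Matrix (Fin p) (Fin p) ℝ :=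
  Matrix.of fun i j => ∫ ω, S.psi μ θ ω i * S.psi μ θ ω j ∂μ

/-- Asymptotic covariance matrix of the parameter estimator, `H⁻¹ V (H⁻¹)ᵀ`. -/
def sigmaTheta (S : Sample Ω p) (μ : Measure Ω) (θ : EuclideanSpace ℝ (Fin p)) :
    Matrix (Fin p) (Fin p) ℝ :=
  (S.H μ θ)⁻¹ * S.V μ θ * (S.H μ θ)⁻¹.transpose

/-- Asymptotic variance of the ATT estimator, `E[(η + ∇Aᵀ H⁻¹ ψ)²]`. -/
def sigmaTau (S : Sample Ω p) (μ : Measure Ω) (θ : EuclideanSpace ℝ (Fin p)) : ℝ :=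
  ∫ ω, (S.phi μ θ ω) ^ 2 ∂μ

end Sample

end CEB

end

/-!
The corrected entropy balancing estimator is a minimiser, and its gradient an estimating function,
so the theorem is an instance of the theory of M- and Z-estimators. What is special to the model are
two cancellations.

* *Errors.* Since the error is independent of the data, `E₀ exp(θᵀZ*) = E₀ exp(θᵀZ) · M(θ)`. Hence
  the limit of the corrected loss is, up to a constant, the error-free population loss
  `log E₀ exp(θᵀZ) - θᵀ E₁ Z`, and likewise for gradients (`Model.tiltedMean_Zstar`), for outcomes
  (`Model.tiltedMean_Zstar_Y`) and for Hessians (`Model.fderiv_tiltedMean_Zstar`).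
* *Tilting.* Under ignorability and the logistic model, the law of `(Z, Y(0))` among the treated is
  the law among the controls tilted by `exp(θ₀ᵀZ)` (`map_cond_treated`). So `E₁ Z = B(θ₀)`
  (`Model.integral_Zstar_trt`): the population loss is stationary at `θ₀`, and
  `τ₀ = E₁ Y - A(θ₀)` (`Model.att_eq`). Strict convexity of the exponential and identifiability make
  `θ₀` the only minimiser (`Model.log_integral_exp_lt`) and the Hessian `H`, a tilted covariance
  matrix, positive definite (`Model.posDef_H`).

Consistency follows from separation: outside any ball around `θ₀` the corrected loss exceeds its
value at `θ₀`, with probability tending to one (`Model.eventuallyInProb_correctedLoss_lt`). On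
compact sets this is Wald's argument. When `Θ` is unbounded and the errors are bounded, one has
to rule out minimisers far away, where `-log M` may compete with the loss: in the direction `u` the
correction grows at most like the essential supremum `a` of `uᵀε`, whereas a positive proportion
of controls has `uᵀε` close to `a` and, independently, `uᵀZ` beyond `uᵀB(θ₀)`; these controls make
the loss grow linearly (`Model.exists_nhds_correctedLoss_lt_smul`).

For asymptotic normality, sample averages `Pₙ[exp(θᵀX) V]` are, almost surely, differentiable at
`θ₀` uniformly in large `n` (`AsympDiff`, `IsRandomSample.ae_asympDiff`). This notion is stable
under smooth maps, so it passes to the score and to the weighted outcome mean, and it is all that is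
needed to linearise a root (`tendstoInMeasure_sqrt_of_root`). At `θ₀` itself the score and the
treatment effect estimator are ratios of sample means, hence asymptotically linear
(`IsRandomSample.tendstoInMeasure_sqrt_ratio`) with influence functions `ψ` and `η`, and the central
limit theorem applies. Moments come from one principle: a point interior to the domain of a moment
generating function carries an integrable envelope `exp(θᵀX + ρ‖X‖)`
(`exists_integrable_exp_add_norm`), which dominates all polynomial factors; at `2 θ₀` it yields
square integrability of `ψ`, and at `0`, by the Cauchy–Schwarz inequality, the derivative of `A`.
-/

set_option linter.unusedSectionVars false

namespace CEB

variable {Ω : Type*} [MeasurableSpace Ω] {μ : Measure Ω}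

/-! ### Events of probability tending to one -/

/-- `P n` holds with (outer) probability tending to one. No measurability of the events is
required, so that events such as "every minimiser lies in `U`" are covered. -/
def EventuallyInProb (μ : Measure Ω) (P : ℕ → Ω → Prop) : Prop :=
  Tendsto (fun n => μ {ω | ¬ P n ω}) atTop (𝓝 0)

namespace EventuallyInProb

variable {P Q : ℕ → Ω → Prop}

lemma mono (h : EventuallyInProb μ P) (hPQ : ∀ᶠ n in atTop, ∀ ω, P n ω → Q n ω) :
    EventuallyInProb μ Q := by
  refine tendsto_of_tendsto_of_tendsto_of_le_of_le' tendsto_const_nhds h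
    (Eventually.of_forall fun _ => zero_le) ?_
  filter_upwards [hPQ] with n hn
  exact measure_mono fun ω hω hP => hω (hn ω hP)

lemma and (hP : EventuallyInProb μ P) (hQ : EventuallyInProb μ Q) :
    EventuallyInProb μ (fun n ω => P n ω ∧ Q n ω) := by
  have h := hP.add hQ
  rw [add_zero] at h
  refine tendsto_of_tendsto_of_tendsto_of_le_of_le tendsto_const_nhds h (fun _ => zero_le) ?_
  intro n
  refine (measure_mono ?_).trans (measure_union_le _ _)
  intro ω hω
  by_cases h1 : P n ω
  · exact Or.inr fun h2 => hω ⟨h1, h2⟩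
  · exact Or.inl h1

lemma of_forall (h : ∀ᶠ n in atTop, ∀ ω, P n ω) : EventuallyInProb μ P := by
  refine tendsto_const_nhds.congr' ?_
  filter_upwards [h] with n hn
  simp [hn]

/-- An almost sure asymptotic property transfers to probability tending to one, provided that the
events are measurable. The parameter is allowed to be estimated: it is enough that the
property holds eventually along `n → ∞`, `θ → θ₀`, and that the estimator is consistent. -/
lemma of_ae_prod {E : Type*} [PseudoMetricSpace E] [IsFiniteMeasure μ]
    {R : ℕ → Ω → E → Prop} {θhat : ℕ → Ω → E} {θ₀ : E}
    (hθ : TendstoInMeasure μ θhat atTop fun _ => θ₀)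
    (hR : ∀ᵐ ω ∂μ, ∀ᶠ x : ℕ × E in atTop ×ˢ 𝓝 θ₀, R x.1 ω x.2)
    (hm : ∀ n, NullMeasurableSet {ω | R n ω (θhat n ω)} μ) :
    EventuallyInProb μ (fun n ω => R n ω (θhat n ω)) := by
  refine tendsto_of_subseq_tendsto fun ns hns => ?_
  obtain ⟨ms, hms_mono, hms⟩ := (hθ.comp hns).exists_seq_tendsto_ae
  refine ⟨ms, ?_⟩
  set A : ℕ → Set Ω := fun k => {ω | ¬ R (ns (ms k)) ω (θhat (ns (ms k)) ω)} with hA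
  have hAm : ∀ k, NullMeasurableSet (A k) μ := fun k => (hm _).compl
  have hlim : Tendsto (fun k => ∫⁻ ω, (A k).indicator 1 ω ∂μ) atTop (𝓝 (∫⁻ _, 0 ∂μ)) := by
    refine tendsto_lintegral_of_dominated_convergence' (fun _ => 1)
      (fun k => (aemeasurable_one.indicator₀ (hAm k))) (fun k => ?_) (by simp) ?_
    · exact Eventually.of_forall fun ω => indicator_le_self' (fun _ _ => zero_le) ω
    · filter_upwards [hms, hR] with ω h1 h2
      have h3 : Tendsto (fun k => (ns (ms k), θhat (ns (ms k)) ω)) atTop (atTop ×ˢ 𝓝 θ₀) :=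
        (hns.comp hms_mono.tendsto_atTop).prodMk h1
      refine tendsto_const_nhds.congr' ?_
      filter_upwards [h3.eventually h2] with k hk
      rw [indicator_of_notMem]
      simpa [hA] using hk
  simpa [lintegral_indicator_one₀ (hAm _)] using hlim

lemma of_ae [IsFiniteMeasure μ] (hP : ∀ᵐ ω ∂μ, ∀ᶠ n in atTop, P n ω)
    (hm : ∀ n, NullMeasurableSet {ω | P n ω} μ) : EventuallyInProb μ P := by
  refine of_ae_prod (R := fun n ω (_ : ℝ) => P n ω) (θhat := fun _ _ => 0) (θ₀ := 0) ?_ ?_ hm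
  · intro ε hε
    simp [hε.ne']
  · filter_upwards [hP] with ω hω
    exact hω.prod_inl _

end EventuallyInProb

lemma tendstoInMeasure_iff_eventuallyInProb {E : Type*} [SeminormedAddCommGroup E]
    {X : ℕ → Ω → E} {Z : Ω → E} :
    TendstoInMeasure μ X atTop Z ↔
      ∀ ε : ℝ, 0 < ε → EventuallyInProb μ (fun n ω => ‖X n ω - Z ω‖ < ε) := by
  simp [tendstoInMeasure_iff_norm, EventuallyInProb]

/-- A consistent estimator may be plugged into a random function that converges almost surely
along `n → ∞`, `θ → θ₀`. -/
lemma tendstoInMeasure_of_ae_prod {E F : Type*} [PseudoMetricSpace E] [NormedAddCommGroup F]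
    [MeasurableSpace F] [BorelSpace F] [IsFiniteMeasure μ] {K : ℕ → Ω → E → F}
    {θhat : ℕ → Ω → E} {θ₀ : E} {c : F} (hθ : TendstoInMeasure μ θhat atTop fun _ => θ₀)
    (hK : ∀ᵐ ω ∂μ, Tendsto (fun x : ℕ × E => K x.1 ω x.2) (atTop ×ˢ 𝓝 θ₀) (𝓝 c))
    (hm : ∀ n, AEMeasurable (fun ω => K n ω (θhat n ω)) μ) :
    TendstoInMeasure μ (fun n ω => K n ω (θhat n ω)) atTop fun _ => c := by
  rw [tendstoInMeasure_iff_eventuallyInProb]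
  intro ε hε
  refine EventuallyInProb.of_ae_prod (R := fun n ω θ => ‖K n ω θ - c‖ < ε) hθ ?_ ?_
  · filter_upwards [hK] with ω hω
    filter_upwards [hω (Metric.ball_mem_nhds c hε)] with x hx
    simpa [dist_eq_norm] using hx
  · intro n
    have hs : MeasurableSet {y : F | ‖y - c‖ < ε} :=
      (isOpen_lt (by fun_prop) continuous_const).measurableSet
    exact (hm n).nullMeasurable hs

/-! ### Stochastic boundedness -/

/-- The sequence `X` is bounded in probability, `X = O_p(1)`. -/
def BddInProb {E : Type*} [Norm E] (μ : Measure Ω) (X : ℕ → Ω → E) : Prop :=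
  ∀ ε : ENNReal, 0 < ε → ∃ K : ℝ, 0 < K ∧ ∀ᶠ n in atTop, μ {ω | K ≤ ‖X n ω‖} ≤ ε

lemma BddInProb.of_le {E F : Type*} [SeminormedAddCommGroup E] [SeminormedAddCommGroup F]
    {X : ℕ → Ω → E} {Y : ℕ → Ω → F} (hX : BddInProb μ X) {c : ℝ} (hc : 0 < c)
    (h : EventuallyInProb μ fun n ω => ‖Y n ω‖ ≤ c * ‖X n ω‖) : BddInProb μ Y := by
  intro ε hε
  have hε2 : 0 < ε / 2 := by simpa using hε.ne'
  obtain ⟨K, hK, hK'⟩ := hX (ε / 2) hε2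
  refine ⟨c * K, by positivity, ?_⟩
  filter_upwards [hK', h.eventually (gt_mem_nhds hε2)] with n h1 h2
  calc μ {ω | c * K ≤ ‖Y n ω‖}
      ≤ μ ({ω | K ≤ ‖X n ω‖} ∪ {ω | ¬ ‖Y n ω‖ ≤ c * ‖X n ω‖}) := by
        refine measure_mono fun ω hω => ?_
        by_cases h3 : ‖Y n ω‖ ≤ c * ‖X n ω‖
        · exact Or.inl (le_of_mul_le_mul_left (le_trans hω h3) hc)
        · exact Or.inr h3
    _ ≤ ε / 2 + ε / 2 := (measure_union_le _ _).trans (add_le_add h1 h2.le)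
    _ = ε := ENNReal.add_halves ε

/-- `o_p(1) · O_p(1) = o_p(1)`. -/
lemma BddInProb.tendstoInMeasure_zero {E F : Type*} [SeminormedAddCommGroup E]
    [SeminormedAddCommGroup F] {X : ℕ → Ω → E} {Y : ℕ → Ω → F} (hX : BddInProb μ X)
    (h : ∀ c : ℝ, 0 < c → EventuallyInProb μ fun n ω => ‖Y n ω‖ ≤ c * ‖X n ω‖) :
    TendstoInMeasure μ Y atTop 0 := by
  rw [tendstoInMeasure_iff_eventuallyInProb]
  intro δ hδ
  rw [EventuallyInProb, ENNReal.tendsto_nhds_zero]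
  intro ε hε
  have hε2 : 0 < ε / 2 := by simpa using hε.ne'
  obtain ⟨K, hK, hK'⟩ := hX (ε / 2) hε2
  have hc : 0 < δ / K := by positivity
  filter_upwards [hK', (h _ hc).eventually (gt_mem_nhds hε2)] with n h1 h2
  calc μ {ω | ¬ ‖Y n ω - (0 : Ω → F) ω‖ < δ}
      ≤ μ ({ω | K ≤ ‖X n ω‖} ∪ {ω | ¬ ‖Y n ω‖ ≤ δ / K * ‖X n ω‖}) := by
        refine measure_mono fun ω hω => ?_
        by_cases h3 : ‖Y n ω‖ ≤ δ / K * ‖X n ω‖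
        · left
          simp only [Pi.zero_apply, sub_zero, not_lt, mem_ofPred_eq] at hω ⊢
          have h4 := hω.trans h3
          rw [div_mul_eq_mul_div, le_div_iff₀ hK] at h4
          exact le_of_mul_le_mul_left h4 hδ
        · exact Or.inr h3
    _ ≤ ε / 2 + ε / 2 := (measure_union_le _ _).trans (add_le_add h1 h2.le)
    _ = ε := ENNReal.add_halves ε

lemma BddInProb.add_of_tendstoInMeasure {E : Type*} [SeminormedAddCommGroup E]
    {X Y : ℕ → Ω → E} (hX : BddInProb μ X) (hY : TendstoInMeasure μ (Y - X) atTop 0) :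
    BddInProb μ Y := by
  rw [tendstoInMeasure_iff_eventuallyInProb] at hY
  intro ε hε
  have hε2 : 0 < ε / 2 := by simpa using hε.ne'
  obtain ⟨K, hK, hK'⟩ := hX (ε / 2) hε2
  refine ⟨K + 1, by positivity, ?_⟩
  filter_upwards [hK', (hY 1 one_pos).eventually (gt_mem_nhds hε2)] with n h1 h2
  calc μ {ω | K + 1 ≤ ‖Y n ω‖}
      ≤ μ ({ω | K ≤ ‖X n ω‖} ∪ {ω | ¬ ‖(Y - X) n ω - (0 : Ω → E) ω‖ < 1}) := by
        refine measure_mono fun ω hω => ?_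
        by_cases h3 : ‖(Y - X) n ω - (0 : Ω → E) ω‖ < 1
        · left
          simp only [Pi.zero_apply, sub_zero, mem_ofPred_eq, Pi.sub_apply] at hω h3 ⊢
          have := norm_sub_norm_le (Y n ω) (X n ω)
          linarith
        · exact Or.inr h3
    _ ≤ ε / 2 + ε / 2 := (measure_union_le _ _).trans (add_le_add h1 h2.le)
    _ = ε := ENNReal.add_halves ε

/-- Sequences converging in distribution are bounded in probability (portmanteau). -/
lemma BddInProb.of_tendstoInDistribution {Ω' E : Type*} [MeasurableSpace Ω'] {μ' : Measure Ω'}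
    [IsProbabilityMeasure μ] [IsProbabilityMeasure μ'] [NormedAddCommGroup E] [MeasurableSpace E]
    [BorelSpace E] {X : ℕ → Ω → E} {Z : Ω' → E}
    (h : TendstoInDistribution X atTop Z (fun _ => μ) μ') : BddInProb μ X := by
  intro ε hε
  have hlim : Tendsto (fun k : ℕ => μ'.map Z {x | (k : ℝ) ≤ ‖x‖}) atTop (𝓝 0) := by
    have := Measure.isProbabilityMeasure_map h.aemeasurable_limit
    have h0 : (⋂ k : ℕ, {x : E | (k : ℝ) ≤ ‖x‖}) = ∅ := by
      ext x
      simp only [mem_iInter, mem_ofPred_eq, mem_empty_iff_false, iff_false, not_forall, not_le]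
      exact exists_nat_gt _
    rw [← measure_empty (μ := μ'.map Z), ← h0]
    refine tendsto_measure_iInter_atTop (fun k => ?_) ?_ ⟨0, measure_ne_top _ _⟩
    · exact (measurableSet_le measurable_const (by fun_prop)).nullMeasurableSet
    · intro a b hab x hx
      exact le_trans (Nat.cast_le.mpr hab) (show (b : ℝ) ≤ ‖x‖ from hx)
  obtain ⟨k, hk, hk1⟩ := ((hlim.eventually (gt_mem_nhds hε)).and (eventually_ge_atTop 1)).exists
  have hF : IsClosed {x : E | (k : ℝ) ≤ ‖x‖} := isClosed_le continuous_const continuous_norm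
  have h1 := (ProbabilityMeasure.limsup_measure_closed_le_of_tendsto h.tendsto hF).trans_lt hk
  refine ⟨k, by exact_mod_cast hk1, ?_⟩
  filter_upwards [eventually_lt_of_limsup_lt h1] with n hn
  refine le_of_eq_of_le ?_ hn.le
  simp only [ProbabilityMeasure.coe_mk]
  rw [Measure.map_apply_of_aemeasurable (h.forall_aemeasurable n) hF.measurableSet]
  rfl

end CEB

namespace CEB

/-! ### Differentiability of a sequence of functions along `n → ∞`, `θ → θ₀` -/

section AsympDiff

variable {E F G : Type*} [NormedAddCommGroup E] [NormedSpace ℝ E] [NormedAddCommGroup F]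
  [NormedSpace ℝ F] [NormedAddCommGroup G] [NormedSpace ℝ G]

/-- The functions `Q n` converge at `θ₀` to `q`, and are differentiable at `θ₀` with the common
derivative `Q'` up to an error `o(‖θ - θ₀‖)` that is uniform in large `n`. The individual `Q n`
may have other derivatives at `θ₀`, as long as these converge to `Q'`. -/
structure AsympDiff (Q : ℕ → E → F) (q : F) (Q' : E →L[ℝ] F) (θ₀ : E) : Prop where
  tendsto_at : Tendsto (fun n => Q n θ₀) atTop (𝓝 q)
  isLittleO : (fun x : ℕ × E => Q x.1 x.2 - Q x.1 θ₀ - Q' (x.2 - θ₀)) =o[atTop ×ˢ 𝓝 θ₀]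
    fun x => x.2 - θ₀

namespace AsympDiff

variable {Q : ℕ → E → F} {q : F} {Q' : E →L[ℝ] F} {θ₀ : E}

lemma isBigO (h : AsympDiff Q q Q' θ₀) :
    (fun x : ℕ × E => Q x.1 x.2 - Q x.1 θ₀) =O[atTop ×ˢ 𝓝 θ₀] fun x => x.2 - θ₀ := by
  have h1 := h.isLittleO.isBigO.add (Q'.isBigO_comp (fun x : ℕ × E => x.2 - θ₀) (atTop ×ˢ 𝓝 θ₀))
  simpa using h1

lemma _root_.CEB.tendsto_snd_sub {E : Type*} [NormedAddCommGroup E] (θ₀ : E) :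
    Tendsto (fun x : ℕ × E => x.2 - θ₀) (atTop ×ˢ 𝓝 θ₀) (𝓝 0) := by
  have : Tendsto (fun x : ℕ × E => x.2 - θ₀) (atTop ×ˢ 𝓝 θ₀) (𝓝 (θ₀ - θ₀)) :=
    tendsto_snd.sub tendsto_const_nhds
  simpa using this

lemma tendsto (h : AsympDiff Q q Q' θ₀) :
    Tendsto (fun x : ℕ × E => Q x.1 x.2) (atTop ×ˢ 𝓝 θ₀) (𝓝 q) := by
  have h1 := (h.isBigO.trans_tendsto (tendsto_snd_sub θ₀)).add (h.tendsto_at.comp tendsto_fst)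
  simpa using h1

/-- Chain rule. -/
lemma comp {f : F → G} {f' : F →L[ℝ] G} (hf : HasStrictFDerivAt f f' q)
    (h : AsympDiff Q q Q' θ₀) : AsympDiff (fun n θ => f (Q n θ)) (f q) (f'.comp Q') θ₀ where
  tendsto_at := hf.continuousAt.tendsto.comp h.tendsto_at
  isLittleO := by
    have h0 : Tendsto (fun x : ℕ × E => (Q x.1 x.2, Q x.1 θ₀)) (atTop ×ˢ 𝓝 θ₀) (𝓝 (q, q)) :=
      h.tendsto.prodMk_nhds (h.tendsto_at.comp tendsto_fst)
    have h1 := (hf.isLittleO.comp_tendsto h0).trans_isBigO h.isBigO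
    have h2 := (f'.isBigO_comp (fun x : ℕ × E => Q x.1 x.2 - Q x.1 θ₀ - Q' (x.2 - θ₀))
      (atTop ×ˢ 𝓝 θ₀)).trans_isLittleO h.isLittleO
    refine (h1.add h2).congr_left fun x => ?_
    simp

lemma prodMk {P : ℕ → E → G} {p : G} {P' : E →L[ℝ] G} (h : AsympDiff Q q Q' θ₀)
    (hP : AsympDiff P p P' θ₀) :
    AsympDiff (fun n θ => (Q n θ, P n θ)) (q, p) (Q'.prod P') θ₀ where
  tendsto_at := h.tendsto_at.prodMk_nhds hP.tendsto_at
  isLittleO := by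
    simpa using h.isLittleO.prod_left hP.isLittleO

lemma sub {P : ℕ → E → F} {p : F} {P' : E →L[ℝ] F} (h : AsympDiff Q q Q' θ₀)
    (hP : AsympDiff P p P' θ₀) :
    AsympDiff (fun n θ => Q n θ - P n θ) (q - p) (Q' - P') θ₀ where
  tendsto_at := h.tendsto_at.sub hP.tendsto_at
  isLittleO := by
    refine (h.isLittleO.sub hP.isLittleO).congr_left fun x => ?_
    simp only [_root_.sub_apply]
    abel

lemma const {a : ℕ → F} (θ₀ : E) (ha : Tendsto a atTop (𝓝 q)) :
    AsympDiff (fun n (_ : E) => a n) q 0 θ₀ where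
  tendsto_at := ha
  isLittleO := by simp

lemma of_hasFDerivAt {f : E → F} {f' : E →L[ℝ] F} (hf : HasFDerivAt f f' θ₀) :
    AsympDiff (fun _ => f) (f θ₀) f' θ₀ where
  tendsto_at := tendsto_const_nhds
  isLittleO := hf.isLittleO.comp_tendsto tendsto_snd

end AsympDiff

end AsympDiff

/-! ### Estimators defined by an estimating equation -/

section ZEstimator

variable {Ω : Type*} [MeasurableSpace Ω] {μ : Measure Ω} [IsFiniteMeasure μ]
  {E F : Type*} [NormedAddCommGroup E] [NormedSpace ℝ E] [MeasurableSpace E] [BorelSpace E]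
  [SecondCountableTopology E]
  [NormedAddCommGroup F] [NormedSpace ℝ F] [MeasurableSpace F] [BorelSpace F]
  [SecondCountableTopology F] {θhat : ℕ → Ω → E} {θ₀ : E}

/-- The linearisation error at a consistent estimator is `o_p(‖θhat - θ₀‖)`. -/
lemma eventuallyInProb_linearization {K : ℕ → Ω → E → F} {q : F} {K' : E →L[ℝ] F}
    (hK : ∀ᵐ ω ∂μ, AsympDiff (fun n => K n ω) q K' θ₀)
    (hθ : TendstoInMeasure μ θhat atTop fun _ => θ₀)
    (hθm : ∀ n, AEMeasurable (θhat n) μ) (hKm : ∀ n, AEMeasurable (fun ω => K n ω (θhat n ω)) μ)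
    (hK0 : ∀ n, AEMeasurable (fun ω => K n ω θ₀) μ) {c : ℝ} (hc : 0 < c) :
    EventuallyInProb μ fun n ω =>
      ‖K n ω (θhat n ω) - K n ω θ₀ - K' (θhat n ω - θ₀)‖ ≤ c * ‖θhat n ω - θ₀‖ := by
  refine EventuallyInProb.of_ae_prod
    (R := fun n ω θ => ‖K n ω θ - K n ω θ₀ - K' (θ - θ₀)‖ ≤ c * ‖θ - θ₀‖) hθ ?_ ?_
  · filter_upwards [hK] with ω hω
    exact hω.isLittleO.bound hc
  · intro n
    have h1 := hKm n
    have h2 := hK0 n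
    have h3 := hθm n
    exact nullMeasurableSet_le
      ((h1.sub h2).sub (K'.measurable.comp_aemeasurable (h3.sub_const _))).norm
      ((h3.sub_const _).norm.const_mul _)

/-- If an estimator is `√n`-consistent, then `√n (K n θhat - K n θ₀) = √n K' (θhat - θ₀) + o_p(1)`. -/
lemma tendstoInMeasure_sqrt_linearization {K : ℕ → Ω → E → F} {q : F} {K' : E →L[ℝ] F}
    (hK : ∀ᵐ ω ∂μ, AsympDiff (fun n => K n ω) q K' θ₀)
    (hθ : TendstoInMeasure μ θhat atTop fun _ => θ₀)
    (hθm : ∀ n, AEMeasurable (θhat n) μ) (hKm : ∀ n, AEMeasurable (fun ω => K n ω (θhat n ω)) μ)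
    (hK0 : ∀ n, AEMeasurable (fun ω => K n ω θ₀) μ)
    (hbdd : BddInProb μ fun (n : ℕ) ω => √(n : ℝ) • (θhat n ω - θ₀)) :
    TendstoInMeasure μ (fun (n : ℕ) ω => √(n : ℝ) •
      (K n ω (θhat n ω) - K n ω θ₀ - K' (θhat n ω - θ₀))) atTop 0 := by
  refine hbdd.tendstoInMeasure_zero fun c hc => ?_
  refine (eventuallyInProb_linearization hK hθ hθm hKm hK0 hc).mono
    (Eventually.of_forall fun n ω h => ?_)
  rw [norm_smul, norm_smul, mul_left_comm]
  exact mul_le_mul_of_nonneg_left h (norm_nonneg _)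

/-- A consistent root of an estimating equation whose value at `θ₀` is `O_p(n^{-1/2})` is
`√n`-consistent. -/
lemma bddInProb_sqrt_of_root {G : ℕ → Ω → E → E} {q : E} {L : E ≃L[ℝ] E}
    (hG : ∀ᵐ ω ∂μ, AsympDiff (fun n => G n ω) q L θ₀)
    (hθ : TendstoInMeasure μ θhat atTop fun _ => θ₀)
    (hθm : ∀ n, AEMeasurable (θhat n) μ) (hGm : ∀ n, AEMeasurable (fun ω => G n ω (θhat n ω)) μ)
    (hG0 : ∀ n, AEMeasurable (fun ω => G n ω θ₀) μ)
    (hroot : EventuallyInProb μ fun n ω => G n ω (θhat n ω) = 0)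
    (hbdd : BddInProb μ fun (n : ℕ) ω => √(n : ℝ) • G n ω θ₀) :
    BddInProb μ fun (n : ℕ) ω => √(n : ℝ) • (θhat n ω - θ₀) := by
  obtain ⟨C, hC, hLC⟩ : ∃ C : ℝ, 0 < C ∧ ∀ h : E, ‖h‖ ≤ C * ‖L h‖ := by
    refine ⟨‖(L.symm : E →L[ℝ] E)‖ + 1, by positivity, fun h => ?_⟩
    have h1 := (L.symm : E →L[ℝ] E).le_opNorm (L h)
    simp only [ContinuousLinearEquiv.coe_coe, ContinuousLinearEquiv.symm_apply_apply] at h1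
    nlinarith [norm_nonneg (L h)]
  have hc : 0 < 1 / (2 * C) := by positivity
  refine hbdd.of_le (c := 2 * C) (by positivity) ?_
  refine ((eventuallyInProb_linearization hG hθ hθm hGm hG0 hc).and hroot).mono
    (Eventually.of_forall fun n ω h => ?_)
  obtain ⟨h1, h2⟩ := h
  rw [norm_smul, norm_smul, mul_left_comm]
  refine mul_le_mul_of_nonneg_left ?_ (norm_nonneg _)
  set Δ := θhat n ω - θ₀
  have h3 : ‖L Δ‖ ≤ ‖G n ω θ₀‖ + 1 / (2 * C) * ‖Δ‖ := by
    have h4 : L Δ = -(G n ω θ₀) - (G n ω (θhat n ω) - G n ω θ₀ - L Δ) := by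
      rw [h2]; abel
    calc ‖L Δ‖ = ‖-(G n ω θ₀) - (G n ω (θhat n ω) - G n ω θ₀ - L Δ)‖ := by rw [← h4]
      _ ≤ ‖-(G n ω θ₀)‖ + ‖G n ω (θhat n ω) - G n ω θ₀ - L Δ‖ := norm_sub_le _ _
      _ ≤ _ := by rw [norm_neg]; gcongr; exact h1
  have h5 := (hLC Δ).trans (mul_le_mul_of_nonneg_left h3 hC.le)
  have h6 : C * (1 / (2 * C) * ‖Δ‖) = ‖Δ‖ / 2 := by field_simp
  rw [mul_add, h6] at h5
  linarith

/-- Asymptotic linearity of a consistent root of an estimating equation. -/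
lemma tendstoInMeasure_sqrt_of_root {G : ℕ → Ω → E → E} {q : E} {L : E ≃L[ℝ] E}
    (hG : ∀ᵐ ω ∂μ, AsympDiff (fun n => G n ω) q L θ₀)
    (hθ : TendstoInMeasure μ θhat atTop fun _ => θ₀)
    (hθm : ∀ n, AEMeasurable (θhat n) μ) (hGm : ∀ n, AEMeasurable (fun ω => G n ω (θhat n ω)) μ)
    (hG0 : ∀ n, AEMeasurable (fun ω => G n ω θ₀) μ)
    (hroot : EventuallyInProb μ fun n ω => G n ω (θhat n ω) = 0)
    (hbdd : BddInProb μ fun (n : ℕ) ω => √(n : ℝ) • G n ω θ₀) :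
    TendstoInMeasure μ (fun (n : ℕ) ω => √(n : ℝ) • (θhat n ω - θ₀) +
      L.symm (√(n : ℝ) • G n ω θ₀)) atTop 0 := by
  have h0 := tendstoInMeasure_sqrt_linearization hG hθ hθm hGm hG0
    (bddInProb_sqrt_of_root hG hθ hθm hGm hG0 hroot hbdd)
  rw [tendstoInMeasure_iff_eventuallyInProb] at h0 ⊢
  intro ε hε
  set C := ‖(L.symm : E →L[ℝ] E)‖ + 1
  have hC : 0 < C := by positivity
  refine ((h0 (ε / C) (by positivity)).and hroot).mono (Eventually.of_forall fun n ω h => ?_)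
  obtain ⟨h1, h2⟩ := h
  simp only [Pi.zero_apply, sub_zero] at h1 ⊢
  have h3 : √(n : ℝ) • (θhat n ω - θ₀) + L.symm (√(n : ℝ) • G n ω θ₀) =
      - L.symm (√(n : ℝ) • (G n ω (θhat n ω) - G n ω θ₀ - L (θhat n ω - θ₀))) := by
    rw [h2]
    simp only [map_smul, map_sub, map_zero, ContinuousLinearEquiv.symm_apply_apply]
    module
  rw [h3, norm_neg]
  calc ‖L.symm (√(n : ℝ) • (G n ω (θhat n ω) - G n ω θ₀ - L (θhat n ω - θ₀)))‖
      ≤ ‖(L.symm : E →L[ℝ] E)‖ * ‖√(n : ℝ) • (G n ω (θhat n ω) - G n ω θ₀ - L (θhat n ω - θ₀))‖ :=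
        (L.symm : E →L[ℝ] E).le_opNorm _
    _ ≤ C * ‖√(n : ℝ) • (G n ω (θhat n ω) - G n ω θ₀ - L (θhat n ω - θ₀))‖ := by
        gcongr; simp [C]
    _ < C * (ε / C) := by gcongr; exact h1
    _ = ε := by field_simp

end ZEstimator

end CEB

namespace CEB

/-! ### Exponentially weighted averages -/

section ExpWeights

variable {E F : Type*} [NormedAddCommGroup E] [InnerProductSpace ℝ E]
  [NormedAddCommGroup F] [NormedSpace ℝ F]

lemma abs_exp_sub_one_sub_le (u : ℝ) : |Real.exp u - 1 - u| ≤ u ^ 2 * Real.exp |u| := by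
  have h := Complex.norm_exp_sub_sum_le_norm_mul_exp (u : ℂ) 2
  simp only [Finset.sum_range_succ, Finset.sum_range_zero, pow_zero, pow_one, Nat.factorial,
    Complex.norm_real, Real.norm_eq_abs, sq_abs] at h
  rw [← Real.norm_eq_abs, ← Complex.norm_real]
  convert h using 2
  push_cast
  ring

lemma sq_mul_exp_le {ρ x : ℝ} (hρ : 0 < ρ) (hx : 0 ≤ x) :
    x ^ 2 * Real.exp (ρ / 2 * x) ≤ 8 / ρ ^ 2 * Real.exp (ρ * x) := by
  have h := Real.quadratic_le_exp_of_nonneg (x := ρ / 2 * x) (by positivity)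
  have h1 : x ^ 2 ≤ 8 / ρ ^ 2 * Real.exp (ρ / 2 * x) := by
    have h2 : x ^ 2 = 8 / ρ ^ 2 * ((ρ / 2 * x) ^ 2 / 2) := by field_simp; ring
    rw [h2]
    gcongr
    nlinarith [show 0 ≤ ρ / 2 * x by positivity]
  calc x ^ 2 * Real.exp (ρ / 2 * x)
      ≤ 8 / ρ ^ 2 * Real.exp (ρ / 2 * x) * Real.exp (ρ / 2 * x) := by gcongr
    _ = 8 / ρ ^ 2 * Real.exp (ρ * x) := by
      rw [mul_assoc, ← Real.exp_add]; congr 2; ring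

lemma le_mul_exp {ρ x : ℝ} (hρ : 0 < ρ) : x ≤ 1 / ρ * Real.exp (ρ * x) := by
  have h := Real.add_one_le_exp (ρ * x)
  have h2 : x = 1 / ρ * (ρ * x) := by field_simp
  calc x = 1 / ρ * (ρ * x) := h2
    _ ≤ _ := by gcongr; linarith

/-- The derivative of `θ ↦ exp ⟪θ, x⟫ • v`. -/
noncomputable def expDeriv (θ x : E) (v : F) : E →L[ℝ] F := (innerSL ℝ x).smulRight (Real.exp ⟪θ, x⟫ • v)

lemma expDeriv_apply (θ x h : E) (v : F) :
    expDeriv θ x v h = Real.exp ⟪θ, x⟫ • ⟪h, x⟫ • v := by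
  simp [expDeriv, real_inner_comm, smul_smul, mul_comm]

lemma exp_inner_le (θ θ₀ x : E) {ρ : ℝ} (h : ‖θ - θ₀‖ ≤ ρ) :
    Real.exp ⟪θ, x⟫ ≤ Real.exp (⟪θ₀, x⟫ + ρ * ‖x‖) := by
  refine Real.exp_le_exp.mpr ?_
  have h1 : ⟪θ, x⟫ = ⟪θ₀, x⟫ + ⟪θ - θ₀, x⟫ := by rw [inner_sub_left]; ring
  have h2 := real_inner_le_norm (θ - θ₀) x
  nlinarith [norm_nonneg x]

lemma norm_expDeriv_le (θ₀ x : E) (v : F) {ρ : ℝ} (hρ : 0 < ρ) :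
    ‖expDeriv θ₀ x v‖ ≤ 1 / ρ * ‖Real.exp (⟪θ₀, x⟫ + ρ * ‖x‖) • v‖ := by
  rw [expDeriv, ContinuousLinearMap.norm_smulRight_apply, innerSL_apply_norm, norm_smul, norm_smul,
    Real.norm_of_nonneg (Real.exp_pos _).le, Real.norm_of_nonneg (Real.exp_pos _).le, Real.exp_add]
  have := le_mul_exp (x := ‖x‖) hρ
  calc ‖x‖ * (Real.exp ⟪θ₀, x⟫ * ‖v‖) ≤ (1 / ρ * Real.exp (ρ * ‖x‖)) * (Real.exp ⟪θ₀, x⟫ * ‖v‖) := by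
        gcongr
    _ = _ := by ring

/-- Second order Taylor bound for `θ ↦ exp ⟪θ, x⟫ • v` with an explicit envelope. -/
lemma norm_exp_smul_sub_le (θ θ₀ x : E) (v : F) {ρ : ℝ} (hρ : 0 < ρ) (h : ‖θ - θ₀‖ ≤ ρ / 2) :
    ‖Real.exp ⟪θ, x⟫ • v - Real.exp ⟪θ₀, x⟫ • v - expDeriv θ₀ x v (θ - θ₀)‖ ≤
      8 / ρ ^ 2 * ‖Real.exp (⟪θ₀, x⟫ + ρ * ‖x‖) • v‖ * ‖θ - θ₀‖ ^ 2 := by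
  set u := ⟪θ - θ₀, x⟫ with hu
  have h1 : ⟪θ, x⟫ = ⟪θ₀, x⟫ + u := by rw [hu, inner_sub_left]; ring
  have h2 : Real.exp ⟪θ, x⟫ • v - Real.exp ⟪θ₀, x⟫ • v - expDeriv θ₀ x v (θ - θ₀) =
      (Real.exp ⟪θ₀, x⟫ * (Real.exp u - 1 - u)) • v := by
    rw [expDeriv_apply, h1, Real.exp_add, ← hu]
    module
  have h3 : |u| ≤ ‖θ - θ₀‖ * ‖x‖ := abs_real_inner_le_norm _ _
  have h4 : |u| ≤ ρ / 2 * ‖x‖ := h3.trans (by gcongr)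
  rw [h2, norm_smul, norm_smul, norm_mul, Real.norm_of_nonneg (Real.exp_pos _).le,
    Real.norm_of_nonneg (Real.exp_pos _).le, Real.exp_add, Real.norm_eq_abs]
  have h5 : |Real.exp u - 1 - u| ≤ ‖θ - θ₀‖ ^ 2 * (8 / ρ ^ 2 * Real.exp (ρ * ‖x‖)) := by
    calc |Real.exp u - 1 - u| ≤ u ^ 2 * Real.exp |u| := abs_exp_sub_one_sub_le u
      _ ≤ (‖θ - θ₀‖ * ‖x‖) ^ 2 * Real.exp (ρ / 2 * ‖x‖) := by
        rw [← sq_abs u]; gcongr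
      _ = ‖θ - θ₀‖ ^ 2 * (‖x‖ ^ 2 * Real.exp (ρ / 2 * ‖x‖)) := by ring
      _ ≤ _ := mul_le_mul_of_nonneg_left (sq_mul_exp_le hρ (norm_nonneg x)) (sq_nonneg _)
  calc Real.exp ⟪θ₀, x⟫ * |Real.exp u - 1 - u| * ‖v‖
      ≤ Real.exp ⟪θ₀, x⟫ * (‖θ - θ₀‖ ^ 2 * (8 / ρ ^ 2 * Real.exp (ρ * ‖x‖))) * ‖v‖ := by gcongr
    _ = _ := by ring

variable {Ω : Type*} [MeasurableSpace Ω] {μ : Measure Ω}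
  [MeasurableSpace E] [BorelSpace E] [SecondCountableTopology E]
  {X : Ω → E} {V : Ω → F} {θ₀ : E} {ρ : ℝ}

lemma integrable_exp_smul (hX : AEMeasurable X μ) (hV : AEStronglyMeasurable V μ)
    (hint : Integrable (fun ω => Real.exp (⟪θ₀, X ω⟫ + ρ * ‖X ω‖) • V ω) μ) {θ : E}
    (hθ : ‖θ - θ₀‖ ≤ ρ) : Integrable (fun ω => Real.exp ⟪θ, X ω⟫ • V ω) μ := by
  refine hint.mono ?_ (Eventually.of_forall fun ω => ?_)
  · have : AEMeasurable (fun ω => Real.exp ⟪θ, X ω⟫) μ := by fun_prop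
    exact this.aestronglyMeasurable.smul hV
  · rw [norm_smul, norm_smul, Real.norm_of_nonneg (Real.exp_pos _).le,
      Real.norm_of_nonneg (Real.exp_pos _).le]
    exact mul_le_mul_of_nonneg_right (exp_inner_le θ θ₀ (X ω) hθ) (norm_nonneg _)

lemma integrable_expDeriv (hX : AEMeasurable X μ) (hV : AEStronglyMeasurable V μ) (hρ : 0 < ρ)
    (hint : Integrable (fun ω => Real.exp (⟪θ₀, X ω⟫ + ρ * ‖X ω‖) • V ω) μ) :
    Integrable (fun ω => expDeriv θ₀ (X ω) (V ω)) μ := by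
  refine Integrable.mono' (hint.norm.const_mul (1 / ρ)) ?_
    (Eventually.of_forall fun ω => norm_expDeriv_le θ₀ (X ω) (V ω) hρ)
  have h1 : AEStronglyMeasurable (fun ω => Real.exp ⟪θ₀, X ω⟫ • V ω) μ :=
    (show AEMeasurable (fun ω => Real.exp ⟪θ₀, X ω⟫) μ by fun_prop).aestronglyMeasurable.smul hV
  have h2 : Continuous fun q : E × F => (innerSL ℝ q.1).smulRight q.2 := by fun_prop
  exact h2.comp_aestronglyMeasurable (hX.aestronglyMeasurable.prodMk h1)

/-- Differentiation of an exponentially weighted integral under the integral sign. -/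
lemma hasFDerivAt_integral_exp_smul [CompleteSpace F] (hX : AEMeasurable X μ)
    (hV : AEStronglyMeasurable V μ) (hρ : 0 < ρ)
    (hint : Integrable (fun ω => Real.exp (⟪θ₀, X ω⟫ + ρ * ‖X ω‖) • V ω) μ) :
    HasFDerivAt (fun θ => ∫ ω, Real.exp ⟪θ, X ω⟫ • V ω ∂μ)
      (∫ ω, expDeriv θ₀ (X ω) (V ω) ∂μ) θ₀ := by
  set W := ∫ ω, ‖Real.exp (⟪θ₀, X ω⟫ + ρ * ‖X ω‖) • V ω‖ ∂μ with hW
  have hbig : (fun θ => (∫ ω, Real.exp ⟪θ, X ω⟫ • V ω ∂μ) - (∫ ω, Real.exp ⟪θ₀, X ω⟫ • V ω ∂μ) -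
      (∫ ω, expDeriv θ₀ (X ω) (V ω) ∂μ) (θ - θ₀)) =O[𝓝 θ₀] fun θ => ‖θ - θ₀‖ ^ 2 := by
    refine Asymptotics.IsBigO.of_bound (8 / ρ ^ 2 * W) ?_
    filter_upwards [Metric.closedBall_mem_nhds θ₀ (half_pos hρ)] with θ hθ
    rw [mem_closedBall_iff_norm] at hθ
    have i1 := integrable_exp_smul hX hV hint (hθ.trans (by linarith))
    have i2 := integrable_exp_smul (θ := θ₀) hX hV hint (by simpa using hρ.le)
    have i3 := integrable_expDeriv hX hV hρ hint
    have i4 : Integrable (fun ω => Real.exp ⟪θ, X ω⟫ • V ω - Real.exp ⟪θ₀, X ω⟫ • V ω) μ :=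
      i1.sub i2
    rw [ContinuousLinearMap.integral_apply i3, ← integral_sub i1 i2,
      ← integral_sub i4 (i3.apply_continuousLinearMap _)]
    calc _ ≤ ∫ ω, 8 / ρ ^ 2 * ‖Real.exp (⟪θ₀, X ω⟫ + ρ * ‖X ω‖) • V ω‖ * ‖θ - θ₀‖ ^ 2 ∂μ :=
          norm_integral_le_of_norm_le ((hint.norm.const_mul _).mul_const _)
            (Eventually.of_forall fun ω => norm_exp_smul_sub_le θ θ₀ (X ω) (V ω) hρ hθ)
      _ = _ := by
        rw [integral_mul_const, integral_const_mul, norm_pow, norm_norm]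
  rw [hasFDerivAt_iff_isLittleO]
  refine hbig.trans_isLittleO ?_
  exact Asymptotics.isLittleO_norm_right.mp (Asymptotics.isLittleO_pow_id one_lt_two
    |>.comp_tendsto (tendsto_norm_sub_self θ₀))

end ExpWeights

/-! ### Exponential envelopes -/

section Envelope

variable {p : ℕ} {Ω : Type*} [MeasurableSpace Ω] {μ : Measure Ω}
  {X : Ω → EuclideanSpace ℝ (Fin p)} {θ₀ : EuclideanSpace ℝ (Fin p)}

lemma norm_le_sum_abs (x : EuclideanSpace ℝ (Fin p)) : ‖x‖ ≤ ∑ i, |x i| := by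
  conv_lhs => rw [← (EuclideanSpace.basisFun (Fin p) ℝ).sum_repr x]
  refine (norm_sum_le _ _).trans (Finset.sum_le_sum fun i _ => ?_)
  simp [norm_smul]

lemma exp_norm_le {c : ℝ} (hc : 0 < c) (x : EuclideanSpace ℝ (Fin p)) :
    Real.exp (c / (p + 1) * ‖x‖) ≤
      1 + ∑ i, (Real.exp (c * x i) + Real.exp (-c * x i)) := by
  have hnn : ∀ i, 0 ≤ Real.exp (c * x i) + Real.exp (-c * x i) := fun i => by positivity
  by_cases h : ∃ j, c / (p + 1) * ‖x‖ ≤ c * |x j|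
  · obtain ⟨j, hj⟩ := h
    have h1 : Real.exp (c * |x j|) ≤ Real.exp (c * x j) + Real.exp (-c * x j) := by
      rcases abs_choice (x j) with h | h <;> rw [h]
      · linarith [Real.exp_pos (-c * x j)]
      · rw [mul_neg, ← neg_mul]; linarith [Real.exp_pos (c * x j)]
    have h2 := Finset.single_le_sum (fun i _ => hnn i) (Finset.mem_univ j)
    linarith [Real.exp_le_exp.mpr hj]
  · push Not at h
    -- the largest coordinate dominates unless `x = 0`
    have h1 : c * ‖x‖ ≤ p * (c / (p + 1) * ‖x‖) := by
      calc c * ‖x‖ ≤ c * ∑ i, |x i| := by gcongr; exact norm_le_sum_abs x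
        _ = ∑ i, c * |x i| := by rw [Finset.mul_sum]
        _ ≤ ∑ _i : Fin p, c / (p + 1) * ‖x‖ := Finset.sum_le_sum fun i _ => (h i).le
        _ = p * (c / (p + 1) * ‖x‖) := by simp
    have h2 : c * ‖x‖ = (p + 1) * (c / (p + 1) * ‖x‖) := by field_simp
    have h3 : c / (p + 1) * ‖x‖ ≤ 0 := by linarith
    have h4 : Real.exp (c / (p + 1) * ‖x‖) ≤ 1 := by simpa using h3
    linarith [Finset.sum_nonneg fun i (_ : i ∈ Finset.univ) => hnn i]

/-- At an interior point of its domain, the moment generating function admits an integrable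
envelope with some extra exponential decay. -/
lemma exists_integrable_exp_add_norm (hX : AEMeasurable X μ)
    (h : θ₀ ∈ interior {θ | Integrable (fun ω => Real.exp ⟪θ, X ω⟫) μ}) :
    ∃ ρ : ℝ, 0 < ρ ∧ Integrable (fun ω => Real.exp (⟪θ₀, X ω⟫ + ρ * ‖X ω‖)) μ := by
  obtain ⟨δ, hδ, hball⟩ := Metric.isOpen_iff.mp isOpen_interior θ₀ h
  replace hball := hball.trans interior_subset
  have hc : 0 < δ / 2 := by positivity
  refine ⟨δ / 2 / (p + 1), by positivity, ?_⟩
  have hmem : ∀ (i : Fin p) (s : ℝ), |s| = δ / 2 →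
      Integrable (fun ω => Real.exp ⟪θ₀, X ω⟫ * Real.exp (s * X ω i)) μ := by
    intro i s hs
    have h1 : θ₀ + s • EuclideanSpace.basisFun (Fin p) ℝ i ∈ Metric.ball θ₀ δ := by
      rw [mem_ball_iff_norm, add_sub_cancel_left, norm_smul, Real.norm_eq_abs, hs]
      simpa using hδ
    have h2 : Integrable (fun ω => _) μ := hball h1
    refine h2.congr (Eventually.of_forall fun ω => ?_)
    simp [inner_add_left, Real.exp_add, inner_smul_left, EuclideanSpace.basisFun_apply,
      EuclideanSpace.inner_single_left]
  have h0 : Integrable (fun ω => Real.exp ⟪θ₀, X ω⟫) μ := hball (Metric.mem_ball_self hδ)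
  have hdom : Integrable (fun ω => Real.exp ⟪θ₀, X ω⟫ + ∑ i, (Real.exp ⟪θ₀, X ω⟫ *
      Real.exp (δ / 2 * X ω i) + Real.exp ⟪θ₀, X ω⟫ * Real.exp (-(δ / 2) * X ω i))) μ := by
    refine h0.add (integrable_finsetSum _ fun i _ => (hmem i _ ?_).add (hmem i _ ?_))
    · exact abs_of_pos hc
    · rw [abs_neg]; exact abs_of_pos hc
  refine hdom.mono' ?_ (Eventually.of_forall fun ω => ?_)
  · exact (show AEMeasurable _ μ by fun_prop).aestronglyMeasurable
  · rw [Real.norm_of_nonneg (Real.exp_pos _).le, Real.exp_add]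
    refine (mul_le_mul_of_nonneg_left (exp_norm_le hc (X ω)) (Real.exp_pos _).le).trans_eq ?_
    rw [mul_add, mul_one, Finset.mul_sum]
    simp only [mul_add]

/-- The envelope absorbs a factor `‖X‖`. -/
lemma integrable_exp_add_norm_smul {F : Type*} [NormedAddCommGroup F] [NormedSpace ℝ F] {ρ : ℝ}
    (hρ : 0 < ρ) (hX : AEMeasurable X μ) {V : Ω → F} (hV : AEStronglyMeasurable V μ)
    (hVX : ∀ ω, ‖V ω‖ ≤ ‖X ω‖)
    (h : Integrable (fun ω => Real.exp (⟪θ₀, X ω⟫ + ρ * ‖X ω‖)) μ) :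
    Integrable (fun ω => Real.exp (⟪θ₀, X ω⟫ + ρ / 2 * ‖X ω‖) • V ω) μ := by
  refine (h.const_mul (1 / (ρ / 2))).mono' ?_ (Eventually.of_forall fun ω => ?_)
  · exact (show AEMeasurable (fun ω => Real.exp (⟪θ₀, X ω⟫ + ρ / 2 * ‖X ω‖)) μ by
      fun_prop).aestronglyMeasurable.smul hV
  · rw [norm_smul, Real.norm_of_nonneg (Real.exp_pos _).le]
    have h1 := (hVX ω).trans (le_mul_exp (x := ‖X ω‖) (half_pos hρ))
    calc Real.exp (⟪θ₀, X ω⟫ + ρ / 2 * ‖X ω‖) * ‖V ω‖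
        ≤ Real.exp (⟪θ₀, X ω⟫ + ρ / 2 * ‖X ω‖) * (1 / (ρ / 2) * Real.exp (ρ / 2 * ‖X ω‖)) := by
          gcongr
      _ = 1 / (ρ / 2) * Real.exp (⟪θ₀, X ω⟫ + ρ * ‖X ω‖) := by
          rw [mul_left_comm, ← Real.exp_add]; congr 2; ring

end Envelope

end CEB

namespace CEB

/-! ### Limit theorems for random samples -/

section IID

variable {Ω : Type*} [MeasurableSpace Ω] {μ : Measure Ω}

/-- If two independent sequences consist of independent variables each, so does the sequence of
pairs. -/
lemma iIndepFun_prodMk_of_indepFun {ι α β : Type*} [MeasurableSpace α] [MeasurableSpace β]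
    {D : ι → Ω → α} {e : ι → Ω → β} (hDm : ∀ i, Measurable (D i)) (hem : ∀ i, Measurable (e i))
    (hD : iIndepFun D μ) (he : iIndepFun e μ)
    (hDe : IndepFun (fun ω i => D i ω) (fun ω i => e i ω) μ) :
    iIndepFun (fun i ω => (D i ω, e i ω)) μ := by
  let π : ι → Set (Set Ω) := fun i =>
    preimage (fun ω => (D i ω, e i ω)) '' image2 (· ×ˢ ·) {s | MeasurableSet s} {t | MeasurableSet t}
  refine iIndepSets.iIndep (fun i => ((hDm i).prodMk (hem i)).comap_le) π (fun i => ?_)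
    (fun i => ?_) ?_
  · exact isPiSystem_prod.comap _
  · rw [← generateFrom_prod, MeasurableSpace.comap_generateFrom]
  · rw [iIndepSets_iff]
    intro s f hf
    have hf' : ∀ i : ι, ∃ u : Set α, ∃ v : Set β, MeasurableSet u ∧ MeasurableSet v ∧
        (i ∈ s → f i = D i ⁻¹' u ∩ e i ⁻¹' v) := by
      intro i
      by_cases hi : i ∈ s
      · obtain ⟨-, ⟨u, hu, v, hv, rfl⟩, hfi⟩ := hf i hi
        exact ⟨u, v, hu, hv, fun _ => hfi.symm.trans (mk_preimage_prod _ _)⟩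
      · exact ⟨∅, ∅, .empty, .empty, fun h => absurd h hi⟩
    choose u v hu hv huv using hf'
    have hA : MeasurableSet {x : ι → α | ∀ i ∈ s, x i ∈ u i} := by
      have : {x : ι → α | ∀ i ∈ s, x i ∈ u i} = ⋂ i ∈ s, (fun x => x i) ⁻¹' u i := by
        ext; simp
      rw [this]
      exact s.measurableSet_biInter fun i _ => measurable_pi_apply i (hu i)
    have hB : MeasurableSet {x : ι → β | ∀ i ∈ s, x i ∈ v i} := by
      have : {x : ι → β | ∀ i ∈ s, x i ∈ v i} = ⋂ i ∈ s, (fun x => x i) ⁻¹' v i := by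
        ext; simp
      rw [this]
      exact s.measurableSet_biInter fun i _ => measurable_pi_apply i (hv i)
    have h1 := (indepFun_iff_measure_inter_preimage_eq_mul.mp hDe) _ _ hA hB
    have h2 := hD.measure_inter_preimage_eq_mul s (sets := u) fun i _ => hu i
    have h3 := he.measure_inter_preimage_eq_mul s (sets := v) fun i _ => hv i
    have e1 : (⋂ i ∈ s, f i) = (fun ω i => D i ω) ⁻¹' {x | ∀ i ∈ s, x i ∈ u i} ∩
        (fun ω i => e i ω) ⁻¹' {x | ∀ i ∈ s, x i ∈ v i} := by
      ext ω
      simp only [mem_iInter, mem_inter_iff, mem_preimage, mem_ofPred_eq, ← forall₂_and]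
      refine forall₂_congr fun i hi => ?_
      rw [huv i hi]
      rfl
    have e2 : (fun ω i => D i ω) ⁻¹' {x | ∀ i ∈ s, x i ∈ u i} = ⋂ i ∈ s, D i ⁻¹' u i := by
      ext; simp
    have e3 : (fun ω i => e i ω) ⁻¹' {x | ∀ i ∈ s, x i ∈ v i} = ⋂ i ∈ s, e i ⁻¹' v i := by
      ext; simp
    rw [e1, h1, e2, e3, h2, h3, ← Finset.prod_mul_distrib]
    refine Finset.prod_congr rfl fun i hi => ?_
    have h4 := (indepFun_iff_measure_inter_preimage_eq_mul.mp
      (hDe.comp (measurable_pi_apply i) (measurable_pi_apply i))) _ _ (hu i) (hv i)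
    rw [huv i hi]
    exact h4.symm

variable {O F : Type*} [MeasurableSpace O]

/-- The measurable random elements `o 0, o 1, …` are independent and identically distributed. -/
structure IsRandomSample (o : ℕ → Ω → O) (μ : Measure Ω) : Prop where
  measurable : ∀ i, Measurable (o i)
  indep : iIndepFun o μ
  ident : ∀ i, IdentDistrib (o i) (o 0) μ μ

/-- The average of `f` over the first `n` observations. -/
noncomputable def sampleMean [AddCommGroup F] [Module ℝ F] (o : ℕ → Ω → O) (f : O → F) (n : ℕ)
    (ω : Ω) : F :=
  (n : ℝ)⁻¹ • ∑ i ∈ Finset.range n, f (o i ω)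

lemma sqrt_smul_sampleMean {Ω O : Type*} [AddCommGroup F] [Module ℝ F] (o : ℕ → Ω → O) (f : O → F) (n : ℕ) (ω : Ω) :
    √(n : ℝ) • sampleMean o f n ω = (√(n : ℝ))⁻¹ • ∑ i ∈ Finset.range n, f (o i ω) := by
  rw [sampleMean, smul_smul]
  congr 1
  rcases n.eq_zero_or_pos with rfl | hn
  · simp
  · have : (0 : ℝ) < n := by exact_mod_cast hn
    have h := Real.mul_self_sqrt this.le
    have h2 := Real.sqrt_pos.mpr this
    field_simp
    nlinarith

namespace IsRandomSample

variable {o : ℕ → Ω → O}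

lemma measurable_sampleMean [NormedAddCommGroup F] [NormedSpace ℝ F] [MeasurableSpace F]
    [BorelSpace F] [SecondCountableTopology F] (ho : IsRandomSample o μ) {f : O → F}
    (hf : Measurable f) (n : ℕ) : Measurable (sampleMean o f n) :=
  (Finset.measurable_sum _ fun i _ => hf.comp (ho.measurable i)).const_smul _

/-- Strong law of large numbers. -/
lemma ae_tendsto_sampleMean [NormedAddCommGroup F] [NormedSpace ℝ F] [CompleteSpace F]
    [MeasurableSpace F] [BorelSpace F] (ho : IsRandomSample o μ) {f : O → F} (hf : Measurable f)
    (hint : Integrable (fun ω => f (o 0 ω)) μ) :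
    ∀ᵐ ω ∂μ, Tendsto (fun n => sampleMean o f n ω) atTop (𝓝 (∫ ω, f (o 0 ω) ∂μ)) :=
  strong_law_ae (fun i ω => f (o i ω)) hint
    (fun _ _ hij => (ho.indep.indepFun hij).comp hf hf) fun i => (ho.ident i).comp hf

variable [IsProbabilityMeasure μ]

/-- Weak law of large numbers. -/
lemma tendstoInMeasure_sampleMean [NormedAddCommGroup F] [NormedSpace ℝ F] [CompleteSpace F]
    [MeasurableSpace F] [BorelSpace F] [SecondCountableTopology F] (ho : IsRandomSample o μ)
    {f : O → F} (hf : Measurable f) (hint : Integrable (fun ω => f (o 0 ω)) μ) :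
    TendstoInMeasure μ (fun n => sampleMean o f n) atTop fun _ => ∫ ω, f (o 0 ω) ∂μ :=
  tendstoInMeasure_of_tendsto_ae
    (fun n => (ho.measurable_sampleMean hf n).aestronglyMeasurable)
    (ho.ae_tendsto_sampleMean hf hint)

lemma eventuallyInProb_sampleMean [NormedAddCommGroup F] [NormedSpace ℝ F] [CompleteSpace F]
    [MeasurableSpace F] [BorelSpace F] [SecondCountableTopology F] (ho : IsRandomSample o μ)
    {f : O → F} (hf : Measurable f) (hint : Integrable (fun ω => f (o 0 ω)) μ) {ε : ℝ}
    (hε : 0 < ε) :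
    EventuallyInProb μ fun n ω => ‖sampleMean o f n ω - ∫ ω', f (o 0 ω') ∂μ‖ < ε := by
  have h := ho.tendstoInMeasure_sampleMean hf hint
  rw [tendstoInMeasure_iff_eventuallyInProb] at h
  exact h ε hε

/-- Central limit theorem on the real line. -/
lemma tendstoInDistribution_real (ho : IsRandomSample o μ) {f : O → ℝ} (hf : Measurable f)
    (h2 : MemLp (fun ω => f (o 0 ω)) 2 μ) (h0 : ∫ ω, f (o 0 ω) ∂μ = 0) :
    TendstoInDistribution (fun (n : ℕ) ω => √(n : ℝ) * sampleMean o f n ω) atTop id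
      (fun _ => μ) (gaussianReal 0 (∫ ω, f (o 0 ω) ^ 2 ∂μ).toNNReal) := by
  have hvar : Var[fun ω => f (o 0 ω); μ] = ∫ ω, f (o 0 ω) ^ 2 ∂μ :=
    variance_of_integral_eq_zero h2.aemeasurable h0
  have hlaw : HasLaw (id : ℝ → ℝ) (gaussianReal 0 Var[fun ω => f (o 0 ω); μ].toNNReal)
      (gaussianReal 0 (∫ ω, f (o 0 ω) ^ 2 ∂μ).toNNReal) := by
    rw [hvar]
    exact HasLaw.id
  have h := tendstoInDistribution_inv_sqrt_mul_sum_sub (X := fun i ω => f (o i ω)) hlaw h2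
    (ho.indep.comp (fun _ => f) fun _ => hf) fun i => (ho.ident i).comp hf
  refine h.congr (fun n => Eventually.of_forall fun ω => ?_) (ae_eq_refl _)
  have := sqrt_smul_sampleMean o f n ω
  simp only [smul_eq_mul] at this
  simp [this, h0]

/-- Multivariate central limit theorem, by reduction to one-dimensional projections. -/
lemma tendstoInDistribution_euclidean {p : ℕ} (ho : IsRandomSample o μ)
    {f : O → EuclideanSpace ℝ (Fin p)} (hf : Measurable f)
    (h2 : MemLp (fun ω => f (o 0 ω)) 2 μ) (h0 : ∫ ω, f (o 0 ω) ∂μ = 0)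
    {C : Matrix (Fin p) (Fin p) ℝ} (hC : ∀ i j, C i j = ∫ ω, f (o 0 ω) i * f (o 0 ω) j ∂μ) :
    TendstoInDistribution (fun (n : ℕ) ω => √(n : ℝ) • sampleMean o f n ω) atTop id
      (fun _ => μ) (multivariateGaussian 0 C) := by
  have hL2 : ∀ i, MemLp (fun ω => f (o 0 ω) i) 2 μ := fun i =>
    (EuclideanSpace.proj (𝕜 := ℝ) i).comp_memLp' h2
  have hquad : ∀ t : EuclideanSpace ℝ (Fin p),
      t.ofLp ⬝ᵥ C.mulVec t.ofLp = ∫ ω, ⟪t, f (o 0 ω)⟫ ^ 2 ∂μ := by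
    intro t
    have h1 : ∀ ω, ⟪t, f (o 0 ω)⟫ ^ 2 =
        ∑ i, ∑ j, t i * t j * (f (o 0 ω) i * f (o 0 ω) j) := by
      intro ω
      rw [sq, PiLp.inner_apply, Finset.sum_mul_sum]
      refine Finset.sum_congr rfl fun i _ => Finset.sum_congr rfl fun j _ => ?_
      simp
      ring
    have hij : ∀ i j, Integrable (fun ω => t i * t j * (f (o 0 ω) i * f (o 0 ω) j)) μ :=
      fun i j => ((hL2 i).integrable_mul (hL2 j)).const_mul _
    simp_rw [h1]
    rw [integral_finsetSum _ fun i _ => integrable_finsetSum _ fun j _ => hij i j]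
    simp_rw [integral_finsetSum _ fun j _ => hij _ j, integral_const_mul, ← hC]
    simp only [dotProduct, Matrix.mulVec, Finset.mul_sum]
    refine Finset.sum_congr rfl fun i _ => Finset.sum_congr rfl fun j _ => ?_
    ring
  have hpsd : C.PosSemidef := by
    refine Matrix.PosSemidef.of_dotProduct_mulVec_nonneg ?_ fun x => ?_
    · ext i j
      simp [hC, mul_comm]
    · have := hquad (WithLp.toLp 2 x)
      simp only [star_trivial] at this ⊢
      rw [this]
      exact integral_nonneg fun ω => sq_nonneg _
  have hm : ∀ n : ℕ, Measurable fun ω => √(n : ℝ) • sampleMean o f n ω := fun n =>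
    by have := ho.measurable_sampleMean hf n; fun_prop
  refine ⟨fun n => (hm n).aemeasurable, aemeasurable_id, ?_⟩
  refine ProbabilityMeasure.tendsto_iff_tendsto_charFun.2 fun t => ?_
  have hclt := ho.tendstoInDistribution_real (f := fun x => ⟪t, f x⟫) (by fun_prop)
    (h2.const_inner t) (by rw [integral_inner (h2.integrable one_le_two), h0, inner_zero_right])
  have h3 := ProbabilityMeasure.tendsto_iff_tendsto_charFun.1 hclt.tendsto 1
  simp only [ProbabilityMeasure.coe_mk, Measure.map_id] at h3 ⊢
  rw [charFun_multivariateGaussian hpsd, hquad]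
  rw [charFun_gaussianReal] at h3
  have hnn : 0 ≤ ∫ ω, ⟪t, f (o 0 ω)⟫ ^ 2 ∂μ := integral_nonneg fun ω => sq_nonneg _
  convert h3 using 2
  · rename_i n
    rw [charFun_apply, charFun_apply, integral_map (hm n).aemeasurable (by fun_prop),
      integral_map (hclt.forall_aemeasurable n) (by fun_prop)]
    refine integral_congr_ae (Eventually.of_forall fun ω => ?_)
    have h4 : ⟪√(n : ℝ) • sampleMean o f n ω, t⟫ =
        √(n : ℝ) * sampleMean o (fun x => ⟪t, f x⟫) n ω := by
      rw [real_inner_comm]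
      simp only [sampleMean, inner_smul_right, inner_sum, smul_eq_mul]
    simp [h4]
  · rw [Real.coe_toNNReal _ hnn]
    simp

end IsRandomSample

end IID

end CEB

namespace CEB

/-! ### Uniform linearisation of exponentially weighted averages -/

section

variable {Ω : Type*} [MeasurableSpace Ω] {μ : Measure Ω} {O E F : Type*} [MeasurableSpace O]
  [NormedAddCommGroup E] [InnerProductSpace ℝ E] [MeasurableSpace E] [BorelSpace E]
  [SecondCountableTopology E] [NormedAddCommGroup F] [NormedSpace ℝ F] [CompleteSpace F]
  [MeasurableSpace F] [BorelSpace F] [SecondCountableTopology F] {o : ℕ → Ω → O}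

/-- Almost surely, the weighted averages `n⁻¹ ∑ exp ⟪θ, X⟫ • V` are differentiable at `θ₀`
uniformly in large `n`, with limiting value and derivative given by the corresponding
expectations. -/
lemma IsRandomSample.ae_asympDiff (ho : IsRandomSample o μ) {X : O → E} {V : O → F}
    (hX : Measurable X) (hV : Measurable V) {θ₀ : E} {ρ : ℝ} (hρ : 0 < ρ)
    (hint : Integrable (fun ω => Real.exp (⟪θ₀, X (o 0 ω)⟫ + ρ * ‖X (o 0 ω)‖) • V (o 0 ω)) μ) :
    ∀ᵐ ω ∂μ, AsympDiff (fun n θ => sampleMean o (fun x => Real.exp ⟪θ, X x⟫ • V x) n ω)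
      (∫ ω, Real.exp ⟪θ₀, X (o 0 ω)⟫ • V (o 0 ω) ∂μ)
      (∫ ω, expDeriv θ₀ (X (o 0 ω)) (V (o 0 ω)) ∂μ) θ₀ := by
  have hX0 : AEMeasurable (fun ω => X (o 0 ω)) μ := (hX.comp (ho.measurable 0)).aemeasurable
  have hV0 : AEStronglyMeasurable (fun ω => V (o 0 ω)) μ :=
    (hV.comp (ho.measurable 0)).aestronglyMeasurable
  have i1 : Integrable (fun ω => Real.exp ⟪θ₀, X (o 0 ω)⟫ • V (o 0 ω)) μ :=
    integrable_exp_smul hX0 hV0 hint (by simpa using hρ.le)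
  have i2 := integrable_expDeriv hX0 hV0 hρ hint
  have m2 : Measurable fun x => expDeriv θ₀ (X x) (V x) := by
    have h2 : Continuous fun q : E × F => (innerSL ℝ q.1).smulRight q.2 := by fun_prop
    have h3 : Measurable fun x => Real.exp ⟪θ₀, X x⟫ • V x := by fun_prop
    exact h2.measurable.comp (hX.prodMk h3)
  have m3 : Measurable fun x => ‖Real.exp (⟪θ₀, X x⟫ + ρ * ‖X x‖) • V x‖ := by fun_prop
  filter_upwards [ho.ae_tendsto_sampleMean (f := fun x => Real.exp ⟪θ₀, X x⟫ • V x)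
    (by fun_prop) i1, ho.ae_tendsto_sampleMean m2 i2, ho.ae_tendsto_sampleMean m3 hint.norm]
    with ω h1 h2 h3
  refine ⟨h1, ?_⟩
  set W := fun n => sampleMean o (fun x => ‖Real.exp (⟪θ₀, X x⟫ + ρ * ‖X x‖) • V x‖) n ω with hW
  set D := fun n => sampleMean o (fun x => expDeriv θ₀ (X x) (V x)) n ω with hD
  set L := ∫ ω, expDeriv θ₀ (X (o 0 ω)) (V (o 0 ω)) ∂μ with hL
  set Q : ℕ → E → F := fun n θ => sampleMean o (fun x => Real.exp ⟪θ, X x⟫ • V x) n ω with hQ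
  have hWbdd : ∀ᶠ n in atTop, W n < (∫ ω, ‖Real.exp (⟪θ₀, X (o 0 ω)⟫ + ρ * ‖X (o 0 ω)‖) •
      V (o 0 ω)‖ ∂μ) + 1 := h3.eventually (gt_mem_nhds (lt_add_one _))
  set w := (∫ ω, ‖Real.exp (⟪θ₀, X (o 0 ω)⟫ + ρ * ‖X (o 0 ω)‖) • V (o 0 ω)‖ ∂μ) + 1
  have hquad : ∀ n θ, ‖θ - θ₀‖ ≤ ρ / 2 →
      ‖Q n θ - Q n θ₀ - D n (θ - θ₀)‖ ≤ 8 / ρ ^ 2 * W n * ‖θ - θ₀‖ ^ 2 := by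
    intro n θ hθ
    have e1 : Q n θ - Q n θ₀ - D n (θ - θ₀) = (n : ℝ)⁻¹ • ∑ i ∈ Finset.range n,
        (Real.exp ⟪θ, X (o i ω)⟫ • V (o i ω) - Real.exp ⟪θ₀, X (o i ω)⟫ • V (o i ω) -
          expDeriv θ₀ (X (o i ω)) (V (o i ω)) (θ - θ₀)) := by
      simp [hQ, hD, sampleMean, Finset.sum_sub_distrib, smul_sub, sum_apply]
    have e2 : 8 / ρ ^ 2 * W n * ‖θ - θ₀‖ ^ 2 = (n : ℝ)⁻¹ * ∑ i ∈ Finset.range n,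
        8 / ρ ^ 2 * ‖Real.exp (⟪θ₀, X (o i ω)⟫ + ρ * ‖X (o i ω)‖) • V (o i ω)‖ *
          ‖θ - θ₀‖ ^ 2 := by
      simp only [hW, sampleMean, smul_eq_mul, ← Finset.sum_mul, ← Finset.mul_sum]
      ring
    rw [e1, e2, norm_smul, norm_inv, Real.norm_natCast]
    gcongr
    exact norm_sum_le_of_le _ fun i _ => norm_exp_smul_sub_le θ θ₀ _ _ hρ hθ
  have hsmall : Tendsto (fun x : ℕ × E => x.2 - θ₀) (atTop ×ˢ 𝓝 θ₀) (𝓝 0) := tendsto_snd_sub θ₀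
  have p1 : (fun x : ℕ × E => Q x.1 x.2 - Q x.1 θ₀ - D x.1 (x.2 - θ₀)) =o[atTop ×ˢ 𝓝 θ₀]
      fun x => x.2 - θ₀ := by
    have b1 : (fun x : ℕ × E => Q x.1 x.2 - Q x.1 θ₀ - D x.1 (x.2 - θ₀)) =O[atTop ×ˢ 𝓝 θ₀]
        fun x => ‖x.2 - θ₀‖ ^ 2 := by
      refine Asymptotics.IsBigO.of_bound (8 / ρ ^ 2 * w) ?_
      filter_upwards [hWbdd.prod_mk (Metric.closedBall_mem_nhds θ₀ (half_pos hρ))] with x hx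
      obtain ⟨hx1, hx2⟩ := hx
      rw [dist_eq_norm] at hx2
      refine (hquad x.1 x.2 hx2).trans ?_
      rw [norm_pow, norm_norm]
      gcongr
    refine b1.trans_isLittleO ?_
    exact Asymptotics.isLittleO_norm_right.mp
      ((Asymptotics.isLittleO_pow_id one_lt_two).comp_tendsto
        (tendsto_norm_zero.comp hsmall))
  have p2 : (fun x : ℕ × E => (D x.1 - L) (x.2 - θ₀)) =o[atTop ×ˢ 𝓝 θ₀] fun x => x.2 - θ₀ := by
    refine Asymptotics.IsLittleO.of_bound fun c hc => ?_
    have h4 : ∀ᶠ n in atTop, ‖D n - L‖ < c := by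
      filter_upwards [h2 (Metric.ball_mem_nhds L hc)] with n hn
      simpa [dist_eq_norm] using hn
    filter_upwards [h4.prod_inl (𝓝 θ₀)] with x hx
    exact (ContinuousLinearMap.le_opNorm _ _).trans (by gcongr)
  refine (p1.add p2).congr_left fun x => ?_
  simp only [_root_.sub_apply]
  abel

end

end CEB

namespace CEB

/-! ### Selection on covariates through a logistic propensity score -/

section Selection

variable {Ω : Type*} [MeasurableSpace Ω] {μ : Measure Ω} [IsProbabilityMeasure μ] {p : ℕ}
  {T : Ω → Bool} {Z : Ω → EuclideanSpace ℝ (Fin p)} {U : Ω → ℝ}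
  {α₀ : ℝ} {θ₀ : EuclideanSpace ℝ (Fin p)}

/-- Probability of the treatment status `b` at the covariate value `z`. -/
noncomputable def logisticProb (α₀ : ℝ) (θ₀ : EuclideanSpace ℝ (Fin p)) (b : Bool)
    (z : EuclideanSpace ℝ (Fin p)) : ℝ :=
  if b then Real.sigmoid (α₀ + ⟪θ₀, z⟫) else 1 - Real.sigmoid (α₀ + ⟪θ₀, z⟫)

lemma logisticProb_pos (b : Bool) (z : EuclideanSpace ℝ (Fin p)) :
    0 < logisticProb α₀ θ₀ b z := by
  cases b
  · simpa [logisticProb] using Real.sigmoid_lt_one _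
  · simpa [logisticProb] using Real.sigmoid_pos _

lemma logisticProb_le_one (b : Bool) (z : EuclideanSpace ℝ (Fin p)) :
    logisticProb α₀ θ₀ b z ≤ 1 := by
  cases b
  · simpa [logisticProb] using (Real.sigmoid_pos _).le
  · simpa [logisticProb] using (Real.sigmoid_lt_one _).le

lemma logisticProb_true_eq (z : EuclideanSpace ℝ (Fin p)) :
    logisticProb α₀ θ₀ true z = logisticProb α₀ θ₀ false z * Real.exp (α₀ + ⟪θ₀, z⟫) := by
  simp only [logisticProb, if_true, Bool.false_eq_true, if_false, Real.sigmoid_def, Real.exp_neg]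
  have := Real.exp_pos (α₀ + ⟪θ₀, z⟫)
  field_simp
  ring

lemma measurable_logisticProb (b : Bool) : Measurable (logisticProb α₀ θ₀ b) := by
  have : Measurable fun z : EuclideanSpace ℝ (Fin p) => Real.sigmoid (α₀ + ⟪θ₀, z⟫) := by
    simp only [Real.sigmoid_def]
    fun_prop
  cases b
  · have h : logisticProb α₀ θ₀ false = fun z => 1 - Real.sigmoid (α₀ + ⟪θ₀, z⟫) := by
      ext; simp [logisticProb]
    rw [h]
    exact measurable_const.sub this
  · have h : logisticProb α₀ θ₀ true = fun z => Real.sigmoid (α₀ + ⟪θ₀, z⟫) := by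
      ext; simp [logisticProb]
    rw [h]
    exact this

lemma condExp_treatment (hT : Measurable T) (hZ : Measurable Z)
    (hlogit : μ[(T ⁻¹' {true}).indicator (fun _ => (1 : ℝ)) |
        MeasurableSpace.comap Z inferInstance] =ᵐ[μ]
      fun ω => Real.sigmoid (α₀ + ⟪θ₀, Z ω⟫)) (b : Bool) :
    μ[(T ⁻¹' {b}).indicator (fun _ => (1 : ℝ)) | MeasurableSpace.comap Z inferInstance] =ᵐ[μ]
      fun ω => logisticProb α₀ θ₀ b (Z ω) := by
  cases b
  · have h1 : (T ⁻¹' {false}).indicator (fun _ => (1 : ℝ)) =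
        (fun _ => (1 : ℝ)) - (T ⁻¹' {true}).indicator (fun _ => (1 : ℝ)) := by
      ext ω
      cases h : T ω <;> simp [indicator, h]
    rw [h1]
    have hint : Integrable ((T ⁻¹' {true}).indicator (fun _ => (1 : ℝ))) μ :=
      (integrable_const 1).indicator (hT (measurableSet_singleton _))
    refine (condExp_sub (integrable_const 1) hint _).trans ?_
    rw [condExp_const hZ.comap_le]
    filter_upwards [hlogit] with ω hω
    simp [logisticProb, hω]
  · simpa [logisticProb] using hlogit

/-- Under strong ignorability, the law of `(Z, U)` on `{T = b}` has the propensity score as its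
density with respect to the overall law. -/
lemma map_restrict_treatment (hT : Measurable T) (hZ : Measurable Z) (hU : Measurable U)
    (hign : CondIndepGiven (MeasurableSpace.comap Z inferInstance) U T μ)
    (hlogit : μ[(T ⁻¹' {true}).indicator (fun _ => (1 : ℝ)) |
        MeasurableSpace.comap Z inferInstance] =ᵐ[μ]
      fun ω => Real.sigmoid (α₀ + ⟪θ₀, Z ω⟫)) (b : Bool) :
    (μ.restrict (T ⁻¹' {b})).map (fun ω => (Z ω, U ω)) =
      (μ.map (fun ω => (Z ω, U ω))).withDensity
        (fun x => ENNReal.ofReal (logisticProb α₀ θ₀ b x.1)) := by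
  have hZU : Measurable fun ω => (Z ω, U ω) := hZ.prodMk hU
  have hq := measurable_logisticProb (α₀ := α₀) (θ₀ := θ₀) b
  have : IsFiniteMeasure ((μ.restrict (T ⁻¹' {b})).map (fun ω => (Z ω, U ω))) := inferInstance
  refine Measure.ext_prod fun {s t} hs ht => ?_
  have hm := hZ.comap_le
  have hTb : MeasurableSet (T ⁻¹' {b}) := hT (measurableSet_singleton _)
  have hst : MeasurableSet (Z ⁻¹' s ∩ U ⁻¹' t) := (hZ hs).inter (hU ht)
  rw [Measure.map_apply hZU (hs.prod ht), Measure.restrict_apply (hZU (hs.prod ht)),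
    withDensity_apply _ (hs.prod ht), setLIntegral_map (hs.prod ht) (by fun_prop) hZU,
    mk_preimage_prod]
  -- both sides are integrals over `{Z ∈ s}` of conditional expectations given `Z`
  have hint : Integrable ((U ⁻¹' t).indicator (fun _ => (1 : ℝ))) μ :=
    (integrable_const 1).indicator (hU ht)
  have hqZ : StronglyMeasurable[MeasurableSpace.comap Z inferInstance]
      fun ω => logisticProb α₀ θ₀ b (Z ω) :=
    (hq.comp (comap_measurable Z)).stronglyMeasurable
  have hprod : Integrable ((U ⁻¹' t).indicator (fun _ => (1 : ℝ)) *
      fun ω => logisticProb α₀ θ₀ b (Z ω)) μ := by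
    refine (hint.mul_bdd (c := 1) (hq.comp hZ).aestronglyMeasurable
      (Eventually.of_forall fun ω => ?_))
    rw [Real.norm_of_nonneg (logisticProb_pos b _).le]
    exact logisticProb_le_one b _
  have key : μ[(U ⁻¹' t ∩ T ⁻¹' {b}).indicator (fun _ => (1 : ℝ)) |
      MeasurableSpace.comap Z inferInstance] =ᵐ[μ]
      μ[(U ⁻¹' t).indicator (fun _ => (1 : ℝ)) * (fun ω => logisticProb α₀ θ₀ b (Z ω)) |
        MeasurableSpace.comap Z inferInstance] := by
    refine (hign t {b} ht (measurableSet_singleton _)).trans ?_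
    refine EventuallyEq.trans ?_ (condExp_mul_of_stronglyMeasurable_right hqZ hprod hint).symm
    exact EventuallyEq.rfl.mul (condExp_treatment hT hZ hlogit b)
  have hs' : MeasurableSet[MeasurableSpace.comap Z inferInstance] (Z ⁻¹' s) := ⟨s, hs, rfl⟩
  have h1 : ∫ ω in Z ⁻¹' s, (U ⁻¹' t ∩ T ⁻¹' {b}).indicator (fun _ => (1 : ℝ)) ω ∂μ =
      ∫ ω in Z ⁻¹' s, ((U ⁻¹' t).indicator (fun _ => (1 : ℝ)) *
        fun ω => logisticProb α₀ θ₀ b (Z ω)) ω ∂μ := by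
    rw [← setIntegral_condExp hm ((integrable_const 1).indicator ((hU ht).inter hTb)) hs',
      ← setIntegral_condExp hm hprod hs']
    exact setIntegral_congr_ae (hZ hs) (key.mono fun ω hω _ => hω)
  have h2 : ∫ ω in Z ⁻¹' s, (U ⁻¹' t ∩ T ⁻¹' {b}).indicator (fun _ => (1 : ℝ)) ω ∂μ =
      μ.real (Z ⁻¹' s ∩ U ⁻¹' t ∩ T ⁻¹' {b}) := by
    rw [setIntegral_indicator ((hU ht).inter hTb), ← inter_assoc]
    simp
  have h3 : ∫ ω in Z ⁻¹' s, ((U ⁻¹' t).indicator (fun _ => (1 : ℝ)) *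
        fun ω => logisticProb α₀ θ₀ b (Z ω)) ω ∂μ =
      ∫ ω in Z ⁻¹' s ∩ U ⁻¹' t, logisticProb α₀ θ₀ b (Z ω) ∂μ := by
    rw [← setIntegral_indicator (hU ht)]
    refine setIntegral_congr_fun (hZ hs) fun ω _ => ?_
    by_cases h : ω ∈ U ⁻¹' t <;> simp [indicator, h]
  rw [h2, h3] at h1
  rw [← ofReal_measureReal (measure_ne_top _ _), h1, ofReal_integral_eq_lintegral_ofReal]
  · refine Integrable.of_bound (hq.comp hZ).aestronglyMeasurable 1
      (Eventually.of_forall fun ω => ?_)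
    rw [Real.norm_of_nonneg (logisticProb_pos b _).le]
    exact logisticProb_le_one b _
  · exact Eventually.of_forall fun ω => (logisticProb_pos b _).le

/-- No event on the covariates is invisible within a treatment group. -/
lemma ae_of_ae_restrict_treatment (hT : Measurable T) (hZ : Measurable Z) (hU : Measurable U)
    (hign : CondIndepGiven (MeasurableSpace.comap Z inferInstance) U T μ)
    (hlogit : μ[(T ⁻¹' {true}).indicator (fun _ => (1 : ℝ)) |
        MeasurableSpace.comap Z inferInstance] =ᵐ[μ]
      fun ω => Real.sigmoid (α₀ + ⟪θ₀, Z ω⟫)) (b : Bool) {s : Set (EuclideanSpace ℝ (Fin p))}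
    (hs : MeasurableSet s) (h : ∀ᵐ ω ∂μ.restrict (T ⁻¹' {b}), Z ω ∈ s) : ∀ᵐ ω ∂μ, Z ω ∈ s := by
  have hZU : Measurable fun ω => (Z ω, U ω) := hZ.prodMk hU
  have hac : μ.map (fun ω => (Z ω, U ω)) ≪
      (μ.restrict (T ⁻¹' {b})).map (fun ω => (Z ω, U ω)) := by
    rw [map_restrict_treatment hT hZ hU hign hlogit b]
    refine withDensity_absolutelyContinuous' ?_ ?_
    · have := measurable_logisticProb (α₀ := α₀) (θ₀ := θ₀) b
      exact Measurable.aemeasurable (by fun_prop)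
    · exact Eventually.of_forall fun x => by simpa using logisticProb_pos b x.1
  have hs' : MeasurableSet {x : EuclideanSpace ℝ (Fin p) × ℝ | x.1 ∈ s} := measurable_fst hs
  have h1 := (ae_map_iff hZU.aemeasurable hs').mpr h
  exact (ae_map_iff hZU.aemeasurable hs').mp (hac.ae_le h1)

lemma measure_treatment_ne_zero (hT : Measurable T) (hZ : Measurable Z) (hU : Measurable U)
    (hign : CondIndepGiven (MeasurableSpace.comap Z inferInstance) U T μ)
    (hlogit : μ[(T ⁻¹' {true}).indicator (fun _ => (1 : ℝ)) |
        MeasurableSpace.comap Z inferInstance] =ᵐ[μ]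
      fun ω => Real.sigmoid (α₀ + ⟪θ₀, Z ω⟫)) (b : Bool) : μ (T ⁻¹' {b}) ≠ 0 := by
  intro h
  have h1 : ∀ᵐ ω ∂μ, Z ω ∈ (∅ : Set (EuclideanSpace ℝ (Fin p))) := by
    refine ae_of_ae_restrict_treatment hT hZ hU hign hlogit b .empty ?_
    rw [Measure.restrict_eq_zero.mpr h]
    simp
  simp at h1
  exact IsProbabilityMeasure.ne_zero μ h1

/-- The law of `(Z, U)` among the treated is an exponential tilt of its law among the controls. -/
lemma map_cond_treated (hT : Measurable T) (hZ : Measurable Z) (hU : Measurable U)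
    (hign : CondIndepGiven (MeasurableSpace.comap Z inferInstance) U T μ)
    (hlogit : μ[(T ⁻¹' {true}).indicator (fun _ => (1 : ℝ)) |
        MeasurableSpace.comap Z inferInstance] =ᵐ[μ]
      fun ω => Real.sigmoid (α₀ + ⟪θ₀, Z ω⟫)) :
    ∃ c : ℝ, 0 < c ∧ (μ[|T ⁻¹' {true}]).map (fun ω => (Z ω, U ω)) =
      ((μ[|T ⁻¹' {false}]).map (fun ω => (Z ω, U ω))).withDensity
        (fun x => ENNReal.ofReal (c * Real.exp ⟪θ₀, x.1⟫)) := by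
  have h0 := measure_treatment_ne_zero hT hZ hU hign hlogit
  have hpos : ∀ b, 0 < μ.real (T ⁻¹' {b}) := fun b =>
    ENNReal.toReal_pos (h0 b) (measure_ne_top _ _)
  set c := μ.real (T ⁻¹' {false}) / μ.real (T ⁻¹' {true}) * Real.exp α₀ with hc
  have hcpos : 0 < c := mul_pos (div_pos (hpos _) (hpos _)) (Real.exp_pos _)
  refine ⟨c, hcpos, ?_⟩
  have hm : ∀ b, Measurable fun x : EuclideanSpace ℝ (Fin p) × ℝ =>
      ENNReal.ofReal (logisticProb α₀ θ₀ b x.1) := fun b => by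
    have := measurable_logisticProb (α₀ := α₀) (θ₀ := θ₀) b
    fun_prop
  simp only [ProbabilityTheory.cond]
  rw [Measure.map_smul, Measure.map_smul, withDensity_smul_measure,
    map_restrict_treatment hT hZ hU hign hlogit true,
    map_restrict_treatment hT hZ hU hign hlogit false,
    ← withDensity_mul _ (hm false) (by fun_prop), ← withDensity_smul _ (hm true),
    ← withDensity_smul _ ((hm false).mul (by fun_prop))]
  congr 1
  ext x
  simp only [Pi.smul_apply, Pi.mul_apply, smul_eq_mul]
  rw [← ofReal_measureReal (measure_ne_top μ (T ⁻¹' {true})),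
    ← ofReal_measureReal (measure_ne_top μ (T ⁻¹' {false})),
    ← ENNReal.ofReal_inv_of_pos (hpos _), ← ENNReal.ofReal_inv_of_pos (hpos _),
    ← ENNReal.ofReal_mul (by positivity), ← ENNReal.ofReal_mul (logisticProb_pos _ _).le,
    ← ENNReal.ofReal_mul (by positivity), logisticProb_true_eq, hc, Real.exp_add]
  congr 1
  have h1 := (hpos true).ne'
  have h2 := (hpos false).ne'
  field_simp

variable {F : Type*} [NormedAddCommGroup F] [NormedSpace ℝ F] [MeasurableSpace F] [BorelSpace F]
  [SecondCountableTopology F]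

/-- Moments of `(Z, U)` among the treated are exponentially tilted moments among the controls. -/
lemma integrable_cond_treated_iff (hT : Measurable T) (hZ : Measurable Z) (hU : Measurable U)
    (hign : CondIndepGiven (MeasurableSpace.comap Z inferInstance) U T μ)
    (hlogit : μ[(T ⁻¹' {true}).indicator (fun _ => (1 : ℝ)) |
        MeasurableSpace.comap Z inferInstance] =ᵐ[μ]
      fun ω => Real.sigmoid (α₀ + ⟪θ₀, Z ω⟫))
    {h : EuclideanSpace ℝ (Fin p) × ℝ → F} (hh : Measurable h) :
    Integrable (fun ω => h (Z ω, U ω)) (μ[|T ⁻¹' {true}]) ↔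
      Integrable (fun ω => Real.exp ⟪θ₀, Z ω⟫ • h (Z ω, U ω)) (μ[|T ⁻¹' {false}]) := by
  obtain ⟨c, hc, hlaw⟩ := map_cond_treated hT hZ hU hign hlogit
  have hZU : Measurable fun ω => (Z ω, U ω) := hZ.prodMk hU
  have hdm : Measurable fun x : EuclideanSpace ℝ (Fin p) × ℝ =>
    Real.toNNReal (c * Real.exp ⟪θ₀, x.1⟫) := by fun_prop
  have h1 := integrable_map_measure (μ := μ[|T ⁻¹' {true}]) hh.aestronglyMeasurable
    hZU.aemeasurable
  have h2 := integrable_map_measure (μ := μ[|T ⁻¹' {false}])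
    (g := fun x => Real.exp ⟪θ₀, x.1⟫ • h x)
    (Measurable.aestronglyMeasurable (by fun_prop)) hZU.aemeasurable
  have h3 : Integrable h ((μ[|T ⁻¹' {true}]).map (fun ω => (Z ω, U ω))) ↔
      Integrable (fun x => Real.exp ⟪θ₀, x.1⟫ • h x)
        ((μ[|T ⁻¹' {false}]).map (fun ω => (Z ω, U ω))) := by
    rw [hlaw, show (fun x : EuclideanSpace ℝ (Fin p) × ℝ =>
      ENNReal.ofReal (c * Real.exp ⟪θ₀, x.1⟫)) = fun x =>
        ((Real.toNNReal (c * Real.exp ⟪θ₀, x.1⟫) : NNReal) : ENNReal) from rfl,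
      integrable_withDensity_iff_integrable_smul hdm, ← integrable_smul_iff hc.ne'
        (fun x => Real.exp ⟪θ₀, x.1⟫ • h x)]
    refine iff_of_eq (congrArg (fun g => Integrable g _) ?_)
    ext x
    simp only [Pi.smul_apply, NNReal.smul_def, Real.coe_toNNReal _
      (mul_pos hc (Real.exp_pos _)).le, mul_smul]
  exact h1.symm.trans (h3.trans h2)

lemma integral_eq_smul_of_map_eq_withDensity {ν₀ ν₁ : Measure Ω} (hZ : Measurable Z)
    (hU : Measurable U) {c : ℝ} (hc : 0 < c)
    (hlaw : ν₁.map (fun ω => (Z ω, U ω)) = (ν₀.map (fun ω => (Z ω, U ω))).withDensity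
        (fun x => ENNReal.ofReal (c * Real.exp ⟪θ₀, x.1⟫)))
    {h : EuclideanSpace ℝ (Fin p) × ℝ → F} (hh : Measurable h) :
    ∫ ω, h (Z ω, U ω) ∂ν₁ = c • ∫ ω, Real.exp ⟪θ₀, Z ω⟫ • h (Z ω, U ω) ∂ν₀ := by
  have hZU : Measurable fun ω => (Z ω, U ω) := hZ.prodMk hU
  rw [← integral_map hZU.aemeasurable hh.aestronglyMeasurable, hlaw,
    integral_withDensity_eq_integral_toReal_smul (by fun_prop)
      (Eventually.of_forall fun x => ENNReal.ofReal_lt_top),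
    integral_map hZU.aemeasurable (Measurable.aestronglyMeasurable (by fun_prop)),
    ← integral_smul]
  refine integral_congr_ae (Eventually.of_forall fun ω => ?_)
  simp only [ENNReal.toReal_ofReal (mul_pos hc (Real.exp_pos _)).le, mul_smul]

lemma integral_cond_treated (hT : Measurable T) (hZ : Measurable Z) (hU : Measurable U)
    (hign : CondIndepGiven (MeasurableSpace.comap Z inferInstance) U T μ)
    (hlogit : μ[(T ⁻¹' {true}).indicator (fun _ => (1 : ℝ)) |
        MeasurableSpace.comap Z inferInstance] =ᵐ[μ]
      fun ω => Real.sigmoid (α₀ + ⟪θ₀, Z ω⟫))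
    {h : EuclideanSpace ℝ (Fin p) × ℝ → F} (hh : Measurable h) :
    ∫ ω, h (Z ω, U ω) ∂(μ[|T ⁻¹' {true}]) =
      tiltedMean (μ[|T ⁻¹' {false}]) Z θ₀ (fun ω => h (Z ω, U ω)) := by
  obtain ⟨c, hc, hlaw⟩ := map_cond_treated hT hZ hU hign hlogit
  have hprob := cond_isProbabilityMeasure (measure_treatment_ne_zero hT hZ hU hign hlogit true)
  have hone := integral_eq_smul_of_map_eq_withDensity hZ hU hc hlaw (h := fun _ => (1 : ℝ))
    measurable_const
  simp only [smul_eq_mul, mul_one, integral_const, probReal_univ] at hone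
  rw [integral_eq_smul_of_map_eq_withDensity hZ hU hc hlaw hh, tiltedMean, ← inv_eq_of_mul_eq_one_left hone.symm]

end Selection

end CEB

namespace CEB

/-! ### The model -/

section CondIndep

variable {Ω α β : Type*} [MeasurableSpace Ω] [MeasurableSpace α] [MeasurableSpace β]
  {μ : Measure Ω} {D : Ω → α} {e : Ω → β}

/-- Conditioning on an event determined by `D` preserves independence of `D` and `e`. -/
lemma indepFun_cond [IsProbabilityMeasure μ] (h : IndepFun D e μ) (hD : Measurable D) {a : Set α}
    (ha : MeasurableSet a) (h0 : μ (D ⁻¹' a) ≠ 0) :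
    IndepFun D e (μ[|D ⁻¹' a]) := by
  rw [indepFun_iff_measure_inter_preimage_eq_mul] at h ⊢
  intro s t hs ht
  have e1 : D ⁻¹' a ∩ (D ⁻¹' s ∩ e ⁻¹' t) = D ⁻¹' (a ∩ s) ∩ e ⁻¹' t := by
    rw [preimage_inter, inter_assoc]
  rw [cond_apply (hD ha), cond_apply (hD ha), cond_apply (hD ha), e1, h _ _ (ha.inter hs) ht,
    h _ _ ha ht, preimage_inter, ← mul_assoc (μ (D ⁻¹' a))⁻¹ (μ (D ⁻¹' a)),
    ENNReal.inv_mul_cancel h0 (measure_ne_top _ _), one_mul, mul_assoc]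

/-- Conditioning on an event determined by `D` preserves the law of `e`, if `e` is independent
of `D`. -/
lemma identDistrib_cond [IsProbabilityMeasure μ] (h : IndepFun D e μ) (hD : Measurable D)
    (he : Measurable e) {a : Set α} (ha : MeasurableSet a) (h0 : μ (D ⁻¹' a) ≠ 0) :
    IdentDistrib e e (μ[|D ⁻¹' a]) μ := by
  refine ⟨he.aemeasurable, he.aemeasurable, ?_⟩
  rw [indepFun_iff_measure_inter_preimage_eq_mul] at h
  ext t ht
  rw [Measure.map_apply he ht, Measure.map_apply he ht, cond_apply (hD ha), h _ _ ha ht,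
    ← mul_assoc, ENNReal.inv_mul_cancel h0 (measure_ne_top _ _), one_mul]

end CondIndep

variable {Ω : Type*} [MeasurableSpace Ω] {p : ℕ}

/-- The standing assumptions on the sample: random sampling, exogenous measurement error, strong
ignorability, a logistic propensity score, identifiability, and the moment conditions at
`0`, `θ₀` and `2 θ₀`. The parameter space is not mentioned. -/
structure Model (S : Sample Ω p) (μ : Measure Ω) (α₀ : ℝ) (θ₀ : EuclideanSpace ℝ (Fin p)) :
    Prop where
  hT : ∀ i, Measurable (S.T i)
  hZ : ∀ i, Measurable (S.Z i)
  hY0 : ∀ i, Measurable (S.Y0 i)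
  hY1 : ∀ i, Measurable (S.Y1 i)
  herr : ∀ i, Measurable (S.err i)
  hindep : iIndepFun (fun i ω => (S.T i ω, S.Z i ω, S.Y0 i ω, S.Y1 i ω)) μ
  hident : ∀ i, IdentDistrib (fun ω => (S.T i ω, S.Z i ω, S.Y0 i ω, S.Y1 i ω))
    (fun ω => (S.T 0 ω, S.Z 0 ω, S.Y0 0 ω, S.Y1 0 ω)) μ μ
  herr_indep : iIndepFun S.err μ
  herr_ident : ∀ i, IdentDistrib (S.err i) (S.err 0) μ μ
  herr_data : IndepFun (fun ω i => (S.T i ω, S.Z i ω, S.Y i ω)) (fun ω i => S.err i ω) μ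
  herr_mean : ∫ ω, S.err 0 ω ∂μ = 0
  hign : CondIndepGiven (MeasurableSpace.comap (S.Z 0) inferInstance)
    (fun ω => (S.Y0 0 ω, S.Y1 0 ω)) (S.T 0) μ
  hlogit : μ[(S.T 0 ⁻¹' {true}).indicator (fun _ => (1 : ℝ)) |
      MeasurableSpace.comap (S.Z 0) inferInstance] =ᵐ[μ]
    fun ω => Real.sigmoid (α₀ + ⟪θ₀, S.Z 0 ω⟫)
  hident_Z : ∀ a : EuclideanSpace ℝ (Fin p), a ≠ 0 →
    ¬ ∃ c : ℝ, ∀ᵐ ω ∂μ, ⟪a, S.Z 0 ω⟫ = c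
  dom_zero : 0 ∈ interior (S.expDomain μ)
  dom_self : θ₀ ∈ interior (S.expDomain μ)
  dom_two : (2 : ℝ) • θ₀ ∈ interior (S.expDomain μ)
  hYtrt : Integrable (fun ω => (S.Y 0 ω) ^ 2) (S.trt μ)
  hYctl : Integrable (fun ω => (S.Y 0 ω) ^ 2 * Real.exp ⟪(2 : ℝ) • θ₀, S.Z 0 ω⟫) (S.ctl μ)

namespace Model

variable {μ : Measure Ω} [IsProbabilityMeasure μ] {S : Sample Ω p} {α₀ : ℝ}
  {θ₀ : EuclideanSpace ℝ (Fin p)}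

lemma measurable_Y (h : Model S μ α₀ θ₀) (i : ℕ) : Measurable (S.Y i) :=
  Measurable.ite (h.hT i (measurableSet_singleton true)) (h.hY1 i) (h.hY0 i)

lemma measurable_Zstar (h : Model S μ α₀ θ₀) (i : ℕ) : Measurable (S.Zstar i) :=
  (h.hZ i).add (h.herr i)

lemma hign_Y0 (h : Model S μ α₀ θ₀) :
    CondIndepGiven (MeasurableSpace.comap (S.Z 0) inferInstance) (S.Y0 0) (S.T 0) μ := by
  intro s t hs ht
  have := h.hign (s ×ˢ univ) t (hs.prod .univ) ht
  simpa [mk_preimage_prod] using this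

lemma measure_ne_zero (h : Model S μ α₀ θ₀) (b : Bool) : μ (S.T 0 ⁻¹' {b}) ≠ 0 :=
  measure_treatment_ne_zero (h.hT 0) (h.hZ 0) (h.hY0 0) h.hign_Y0 h.hlogit b

lemma measureReal_pos (h : Model S μ α₀ θ₀) (b : Bool) : 0 < μ.real (S.T 0 ⁻¹' {b}) :=
  ENNReal.toReal_pos (h.measure_ne_zero b) (measure_ne_top _ _)

lemma isProbabilityMeasure_ctl (h : Model S μ α₀ θ₀) : IsProbabilityMeasure (S.ctl μ) :=
  cond_isProbabilityMeasure (h.measure_ne_zero false)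

lemma isProbabilityMeasure_trt (h : Model S μ α₀ θ₀) : IsProbabilityMeasure (S.trt μ) :=
  cond_isProbabilityMeasure (h.measure_ne_zero true)

lemma indepFun_err (h : Model S μ α₀ θ₀) :
    IndepFun (fun ω => (S.T 0 ω, S.Z 0 ω, S.Y 0 ω)) (S.err 0) μ :=
  h.herr_data.comp (measurable_pi_apply 0) (measurable_pi_apply 0)

lemma measurable_data (h : Model S μ α₀ θ₀) (i : ℕ) :
    Measurable fun ω => (S.T i ω, S.Z i ω, S.Y i ω) :=
  (h.hT i).prodMk ((h.hZ i).prodMk (h.measurable_Y i))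

lemma preimage_data (b : Bool) : S.T 0 ⁻¹' {b} =
    (fun ω => (S.T 0 ω, S.Z 0 ω, S.Y 0 ω)) ⁻¹' (Prod.fst ⁻¹' {b}) := rfl

lemma indepFun_err_ctl (h : Model S μ α₀ θ₀) :
    IndepFun (fun ω => (S.T 0 ω, S.Z 0 ω, S.Y 0 ω)) (S.err 0) (S.ctl μ) := by
  rw [Sample.ctl, preimage_data]
  exact indepFun_cond h.indepFun_err (h.measurable_data 0)
    (measurable_fst (measurableSet_singleton _)) (h.measure_ne_zero false)

lemma identDistrib_err_cond (h : Model S μ α₀ θ₀) (b : Bool) :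
    IdentDistrib (S.err 0) (S.err 0) (μ[|S.T 0 ⁻¹' {b}]) μ := by
  rw [preimage_data]
  exact identDistrib_cond h.indepFun_err (h.measurable_data 0) (h.herr 0)
    (measurable_fst (measurableSet_singleton _)) (h.measure_ne_zero b)

lemma integral_err_ctl (h : Model S μ α₀ θ₀) {F : Type*} [NormedAddCommGroup F]
    [NormedSpace ℝ F] [MeasurableSpace F] [BorelSpace F] {k : EuclideanSpace ℝ (Fin p) → F}
    (hk : Measurable k) : ∫ ω, k (S.err 0 ω) ∂(S.ctl μ) = ∫ ω, k (S.err 0 ω) ∂μ :=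
  ((h.identDistrib_err_cond false).comp hk).integral_eq

lemma integrable_err_ctl_iff (h : Model S μ α₀ θ₀) {F : Type*} [NormedAddCommGroup F]
    [MeasurableSpace F] [BorelSpace F] {k : EuclideanSpace ℝ (Fin p) → F}
    (hk : Measurable k) : Integrable (fun ω => k (S.err 0 ω)) (S.ctl μ) ↔
      Integrable (fun ω => k (S.err 0 ω)) μ :=
  ((h.identDistrib_err_cond false).comp hk).integrable_iff

/-- Expectation of a product of a function of the true data and a function of the error, among the
controls. -/
lemma integral_data_smul_err (h : Model S μ α₀ θ₀) {F : Type*} [NormedAddCommGroup F]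
    [NormedSpace ℝ F] [MeasurableSpace F] [BorelSpace F] [SecondCountableTopology F]
    {f : EuclideanSpace ℝ (Fin p) × ℝ → ℝ} (hf : Measurable f)
    {k : EuclideanSpace ℝ (Fin p) → F} (hk : Measurable k) :
    ∫ ω, f (S.Z 0 ω, S.Y 0 ω) • k (S.err 0 ω) ∂(S.ctl μ) =
      (∫ ω, f (S.Z 0 ω, S.Y 0 ω) ∂(S.ctl μ)) • ∫ ω, k (S.err 0 ω) ∂μ := by
  rw [← h.integral_err_ctl hk]
  exact h.indepFun_err_ctl.integral_fun_comp_smul_comp (f := fun x => f x.2)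
    (h.measurable_data 0).aemeasurable (h.herr 0).aemeasurable
    (hf.comp measurable_snd).aestronglyMeasurable hk.aestronglyMeasurable

lemma integral_err_smul_data (h : Model S μ α₀ θ₀) {F : Type*} [NormedAddCommGroup F]
    [NormedSpace ℝ F] [MeasurableSpace F] [BorelSpace F] [SecondCountableTopology F]
    {f : EuclideanSpace ℝ (Fin p) × ℝ → F} (hf : Measurable f)
    {k : EuclideanSpace ℝ (Fin p) → ℝ} (hk : Measurable k) :
    ∫ ω, k (S.err 0 ω) • f (S.Z 0 ω, S.Y 0 ω) ∂(S.ctl μ) =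
      (∫ ω, k (S.err 0 ω) ∂μ) • ∫ ω, f (S.Z 0 ω, S.Y 0 ω) ∂(S.ctl μ) := by
  rw [← h.integral_err_ctl hk]
  exact h.indepFun_err_ctl.symm.integral_fun_comp_smul_comp (g := fun x => f x.2)
    (h.herr 0).aemeasurable (h.measurable_data 0).aemeasurable
    hk.aestronglyMeasurable (hf.comp measurable_snd).aestronglyMeasurable

lemma integrable_data_smul_err (h : Model S μ α₀ θ₀) {F : Type*} [NormedAddCommGroup F]
    [NormedSpace ℝ F] [MeasurableSpace F] [BorelSpace F]
    {f : EuclideanSpace ℝ (Fin p) × ℝ → ℝ} (hf : Measurable f)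
    {k : EuclideanSpace ℝ (Fin p) → F} (hk : Measurable k)
    (hfi : Integrable (fun ω => f (S.Z 0 ω, S.Y 0 ω)) (S.ctl μ))
    (hki : Integrable (fun ω => k (S.err 0 ω)) μ) :
    Integrable (fun ω => f (S.Z 0 ω, S.Y 0 ω) • k (S.err 0 ω)) (S.ctl μ) :=
  (h.indepFun_err_ctl.comp (hf.comp measurable_snd) hk).integrable_smul hfi
    ((h.integrable_err_ctl_iff hk).mpr hki)

lemma integrable_err_smul_data (h : Model S μ α₀ θ₀) {F : Type*} [NormedAddCommGroup F]
    [NormedSpace ℝ F] [MeasurableSpace F] [BorelSpace F]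
    {f : EuclideanSpace ℝ (Fin p) × ℝ → F} (hf : Measurable f)
    {k : EuclideanSpace ℝ (Fin p) → ℝ} (hk : Measurable k)
    (hfi : Integrable (fun ω => f (S.Z 0 ω, S.Y 0 ω)) (S.ctl μ))
    (hki : Integrable (fun ω => k (S.err 0 ω)) μ) :
    Integrable (fun ω => k (S.err 0 ω) • f (S.Z 0 ω, S.Y 0 ω)) (S.ctl μ) :=
  (h.indepFun_err_ctl.comp (hf.comp measurable_snd) hk).symm.integrable_smul
    ((h.integrable_err_ctl_iff hk).mpr hki) hfi

lemma exp_inner_Zstar (θ : EuclideanSpace ℝ (Fin p)) (i : ℕ) (ω : Ω) :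
    Real.exp ⟪θ, S.Zstar i ω⟫ = Real.exp ⟪θ, S.Z i ω⟫ * Real.exp ⟪θ, S.err i ω⟫ := by
  rw [Sample.Zstar, inner_add_right, Real.exp_add]

lemma integral_exp_Zstar (h : Model S μ α₀ θ₀) (θ : EuclideanSpace ℝ (Fin p)) :
    ∫ ω, Real.exp ⟪θ, S.Zstar 0 ω⟫ ∂(S.ctl μ) =
      (∫ ω, Real.exp ⟪θ, S.Z 0 ω⟫ ∂(S.ctl μ)) * S.M μ θ := by
  simp only [exp_inner_Zstar]
  exact h.integral_data_smul_err (f := fun x => Real.exp ⟪θ, x.1⟫)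
    (k := fun e => Real.exp ⟪θ, e⟫) (by fun_prop) (by fun_prop)

lemma exp_not_ae_zero {ν : Measure Ω} [IsProbabilityMeasure ν] (f : Ω → ℝ) :
    ¬ (fun ω => Real.exp (f ω)) =ᵐ[ν] 0 := by
  intro h
  obtain ⟨ω, hω⟩ := h.exists
  exact (Real.exp_pos (f ω)).ne' hω

lemma indepFun_exp (h : Model S μ α₀ θ₀) (θ : EuclideanSpace ℝ (Fin p)) :
    IndepFun (fun ω => Real.exp ⟪θ, S.Z 0 ω⟫) (fun ω => Real.exp ⟪θ, S.err 0 ω⟫) (S.ctl μ) := by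
  have hφ : Measurable fun x : Bool × EuclideanSpace ℝ (Fin p) × ℝ => Real.exp ⟪θ, x.2.1⟫ := by
    fun_prop
  have hψ : Measurable fun x : EuclideanSpace ℝ (Fin p) => Real.exp ⟪θ, x⟫ := by fun_prop
  exact h.indepFun_err_ctl.comp hφ hψ

lemma integrable_exp_Z (h : Model S μ α₀ θ₀) {θ : EuclideanSpace ℝ (Fin p)}
    (hθ : θ ∈ S.expDomain μ) : Integrable (fun ω => Real.exp ⟪θ, S.Z 0 ω⟫) (S.ctl μ) := by
  have := h.isProbabilityMeasure_ctl
  have hi := h.indepFun_exp θ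
  have hθ' : Integrable (fun ω => Real.exp ⟪θ, S.Zstar 0 ω⟫) (S.ctl μ) := hθ
  simp only [exp_inner_Zstar] at hθ'
  have hZ := h.hZ 0
  have he := h.herr 0
  have m1 : AEStronglyMeasurable (fun ω => Real.exp ⟪θ, S.Z 0 ω⟫) (S.ctl μ) :=
    Measurable.aestronglyMeasurable (by fun_prop)
  have m2 : AEStronglyMeasurable (fun ω => Real.exp ⟪θ, S.err 0 ω⟫) (S.ctl μ) :=
    Measurable.aestronglyMeasurable (by fun_prop)
  exact hi.integrable_left_of_integrable_op (· * ·) 1 one_ne_zero (by simp [enorm_mul]) hθ'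
    m1 m2 (exp_not_ae_zero _)

lemma integrable_exp_err (h : Model S μ α₀ θ₀) {θ : EuclideanSpace ℝ (Fin p)}
    (hθ : θ ∈ S.expDomain μ) : Integrable (fun ω => Real.exp ⟪θ, S.err 0 ω⟫) μ := by
  have := h.isProbabilityMeasure_ctl
  have hi := h.indepFun_exp θ
  have hθ' : Integrable (fun ω => Real.exp ⟪θ, S.Zstar 0 ω⟫) (S.ctl μ) := hθ
  simp only [exp_inner_Zstar] at hθ'
  have hZ := h.hZ 0
  have he := h.herr 0
  have m1 : AEStronglyMeasurable (fun ω => Real.exp ⟪θ, S.Z 0 ω⟫) (S.ctl μ) :=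
    Measurable.aestronglyMeasurable (by fun_prop)
  have m2 : AEStronglyMeasurable (fun ω => Real.exp ⟪θ, S.err 0 ω⟫) (S.ctl μ) :=
    Measurable.aestronglyMeasurable (by fun_prop)
  refine (h.integrable_err_ctl_iff (k := fun e => Real.exp ⟪θ, e⟫) (by fun_prop)).mp ?_
  exact hi.integrable_right_of_integrable_op (· * ·) 1 one_ne_zero (by simp [enorm_mul]) hθ'
    m1 m2 (exp_not_ae_zero _)

lemma integral_exp_Z_pos (h : Model S μ α₀ θ₀) {θ : EuclideanSpace ℝ (Fin p)}
    (hθ : θ ∈ S.expDomain μ) : 0 < ∫ ω, Real.exp ⟪θ, S.Z 0 ω⟫ ∂(S.ctl μ) := by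
  have := h.isProbabilityMeasure_ctl
  exact integral_exp_pos (h.integrable_exp_Z hθ)

lemma M_pos (h : Model S μ α₀ θ₀) {θ : EuclideanSpace ℝ (Fin p)}
    (hθ : θ ∈ S.expDomain μ) : 0 < S.M μ θ :=
  integral_exp_pos (h.integrable_exp_err hθ)

lemma integral_exp_Zstar_pos (h : Model S μ α₀ θ₀) {θ : EuclideanSpace ℝ (Fin p)}
    (hθ : θ ∈ S.expDomain μ) : 0 < ∫ ω, Real.exp ⟪θ, S.Zstar 0 ω⟫ ∂(S.ctl μ) := by
  rw [h.integral_exp_Zstar]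
  exact mul_pos (h.integral_exp_Z_pos hθ) (h.M_pos hθ)

/-! ### Envelopes in the model -/

lemma exists_envelope_Zstar (h : Model S μ α₀ θ₀) {θ : EuclideanSpace ℝ (Fin p)}
    (hθ : θ ∈ interior (S.expDomain μ)) : ∃ ρ : ℝ, 0 < ρ ∧
      Integrable (fun ω => Real.exp (⟪θ, S.Zstar 0 ω⟫ + ρ * ‖S.Zstar 0 ω‖)) (S.ctl μ) :=
  exists_integrable_exp_add_norm (h.measurable_Zstar 0).aemeasurable hθ

lemma exists_envelope_Z (h : Model S μ α₀ θ₀) {θ : EuclideanSpace ℝ (Fin p)}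
    (hθ : θ ∈ interior (S.expDomain μ)) : ∃ ρ : ℝ, 0 < ρ ∧
      Integrable (fun ω => Real.exp (⟪θ, S.Z 0 ω⟫ + ρ * ‖S.Z 0 ω‖)) (S.ctl μ) :=
  exists_integrable_exp_add_norm (h.hZ 0).aemeasurable
    (interior_mono (fun _ ht => h.integrable_exp_Z ht) hθ)

lemma exists_envelope_err (h : Model S μ α₀ θ₀) {θ : EuclideanSpace ℝ (Fin p)}
    (hθ : θ ∈ interior (S.expDomain μ)) : ∃ ρ : ℝ, 0 < ρ ∧
      Integrable (fun ω => Real.exp (⟪θ, S.err 0 ω⟫ + ρ * ‖S.err 0 ω‖)) μ :=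
  exists_integrable_exp_add_norm (h.herr 0).aemeasurable
    (interior_mono (fun _ ht => h.integrable_exp_err ht) hθ)

end Model

end CEB

namespace CEB

/-! ### Differentiation of tilted means -/

section TiltedMean

variable {F : Type*} [NormedAddCommGroup F] [NormedSpace ℝ F]

/-- The derivative of `(s, d) ↦ s⁻¹ • d`. -/
noncomputable def quotDeriv (s : ℝ) (d : F) : ℝ × F →L[ℝ] F :=
  s⁻¹ • ContinuousLinearMap.snd ℝ ℝ F -
    (s ^ 2)⁻¹ • (ContinuousLinearMap.fst ℝ ℝ F).smulRight d

lemma quotDeriv_apply (s : ℝ) (d : F) (x : ℝ × F) :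
    quotDeriv s d x = s⁻¹ • x.2 - ((s ^ 2)⁻¹ * x.1) • d := by
  simp [quotDeriv, mul_smul]

lemma hasStrictFDerivAt_quot {s : ℝ} (hs : s ≠ 0) (d : F) :
    HasStrictFDerivAt (fun x : ℝ × F => x.1⁻¹ • x.2) (quotDeriv s d) (s, d) := by
  have h1 : HasStrictFDerivAt (fun x : ℝ × F => x.1⁻¹)
      ((-(s ^ 2)⁻¹) • ContinuousLinearMap.fst ℝ ℝ F) (s, d) := by
    have := (hasStrictDerivAt_inv hs).comp_hasStrictFDerivAt (s, d)
      (f := Prod.fst) (hasStrictFDerivAt_fst (𝕜 := ℝ) (p := (s, d)))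
    exact this
  have h2 := h1.smul (hasStrictFDerivAt_snd (𝕜 := ℝ) (p := (s, d)))
  have h3 : quotDeriv s d = s⁻¹ • ContinuousLinearMap.snd ℝ ℝ F +
      ((-(s ^ 2)⁻¹) • ContinuousLinearMap.fst ℝ ℝ F).smulRight d := by
    ext x <;> simp [quotDeriv]
  rw [h3]
  exact h2

variable {p : ℕ} {Ω : Type*} [MeasurableSpace Ω] {ν : Measure Ω} [CompleteSpace F]
  {X : Ω → EuclideanSpace ℝ (Fin p)} {V : Ω → F} {θ₀ : EuclideanSpace ℝ (Fin p)} {ρ : ℝ}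

lemma hasFDerivAt_integral_exp (hX : AEMeasurable X ν) (hρ : 0 < ρ)
    (h1 : Integrable (fun ω => Real.exp (⟪θ₀, X ω⟫ + ρ * ‖X ω‖)) ν) :
    HasFDerivAt (fun θ => ∫ ω, Real.exp ⟪θ, X ω⟫ ∂ν)
      (∫ ω, expDeriv θ₀ (X ω) (1 : ℝ) ∂ν) θ₀ := by
  have := hasFDerivAt_integral_exp_smul (V := fun _ => (1 : ℝ)) hX aestronglyMeasurable_const hρ
    (by simpa using h1)
  simpa using this

lemma hasFDerivAt_tiltedMean (hX : AEMeasurable X ν) (hV : AEStronglyMeasurable V ν) (hρ : 0 < ρ)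
    (h1 : Integrable (fun ω => Real.exp (⟪θ₀, X ω⟫ + ρ * ‖X ω‖)) ν)
    (hint : Integrable (fun ω => Real.exp (⟪θ₀, X ω⟫ + ρ * ‖X ω‖) • V ω) ν)
    (hs : ∫ ω, Real.exp ⟪θ₀, X ω⟫ ∂ν ≠ 0) :
    HasFDerivAt (fun θ => tiltedMean ν X θ V)
      ((quotDeriv (∫ ω, Real.exp ⟪θ₀, X ω⟫ ∂ν) (∫ ω, Real.exp ⟪θ₀, X ω⟫ • V ω ∂ν)).comp
        ((∫ ω, expDeriv θ₀ (X ω) (1 : ℝ) ∂ν).prod (∫ ω, expDeriv θ₀ (X ω) (V ω) ∂ν))) θ₀ := by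
  have h2 := (hasFDerivAt_integral_exp hX hρ h1).prodMk
    (hasFDerivAt_integral_exp_smul hX hV hρ hint)
  exact (hasStrictFDerivAt_quot hs
    (∫ ω, Real.exp ⟪θ₀, X ω⟫ • V ω ∂ν)).hasFDerivAt.comp θ₀ h2

/-- The derivative of a tilted mean is a tilted covariance. -/
lemma fderiv_tiltedMean_apply (hX : AEMeasurable X ν) (hV : AEStronglyMeasurable V ν) (hρ : 0 < ρ)
    (h1 : Integrable (fun ω => Real.exp (⟪θ₀, X ω⟫ + ρ * ‖X ω‖)) ν)
    (hint : Integrable (fun ω => Real.exp (⟪θ₀, X ω⟫ + ρ * ‖X ω‖) • V ω) ν)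
    (hs : ∫ ω, Real.exp ⟪θ₀, X ω⟫ ∂ν ≠ 0) (a : EuclideanSpace ℝ (Fin p)) :
    fderiv ℝ (fun θ => tiltedMean ν X θ V) θ₀ a =
      tiltedMean ν X θ₀ (fun ω => ⟪a, X ω⟫ • V ω) -
        tiltedMean ν X θ₀ (fun ω => ⟪a, X ω⟫) • tiltedMean ν X θ₀ V := by
  rw [(hasFDerivAt_tiltedMean hX hV hρ h1 hint hs).fderiv]
  have i1 := integrable_expDeriv (V := fun _ => (1 : ℝ)) hX aestronglyMeasurable_const hρ
    (by simpa using h1)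
  have i2 := integrable_expDeriv hX hV hρ hint
  simp only [ContinuousLinearMap.comp_apply, ContinuousLinearMap.prod_apply, quotDeriv_apply,
    ContinuousLinearMap.integral_apply i1, ContinuousLinearMap.integral_apply i2, expDeriv_apply,
    tiltedMean, smul_smul, smul_eq_mul, mul_one]
  congr 2
  ring

lemma tiltedMean_inner_const [IsProbabilityMeasure ν] {W : Ω → EuclideanSpace ℝ (Fin p)}
    (hint : Integrable (fun ω => Real.exp ⟪θ₀, X ω⟫ • W ω) ν) (a : EuclideanSpace ℝ (Fin p)) :
    tiltedMean ν X θ₀ (fun ω => ⟪a, W ω⟫) = ⟪a, tiltedMean ν X θ₀ W⟫ := by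
  simp only [tiltedMean, inner_smul_right, smul_eq_mul]
  rw [← integral_inner hint a]
  simp only [inner_smul_right]

end TiltedMean

/-- Ratios of exponentially weighted averages (with nonnegative or signed base weights `c`) are
almost surely differentiable at `θ₀` uniformly in large `n`. -/
lemma IsRandomSample.ae_asympDiff_ratio {Ω : Type*} [MeasurableSpace Ω] {μ : Measure Ω}
    {O E F : Type*} [MeasurableSpace O]
    [NormedAddCommGroup E] [InnerProductSpace ℝ E] [MeasurableSpace E] [BorelSpace E]
    [SecondCountableTopology E] [NormedAddCommGroup F] [NormedSpace ℝ F] [CompleteSpace F]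
    [MeasurableSpace F] [BorelSpace F] [SecondCountableTopology F] {o : ℕ → Ω → O}
    (ho : IsRandomSample o μ) {X : O → E} {c : O → ℝ} {V : O → F}
    (hX : Measurable X) (hc : Measurable c) (hV : Measurable V) {θ₀ : E} {ρ : ℝ} (hρ : 0 < ρ)
    (hint : Integrable (fun ω => Real.exp (⟪θ₀, X (o 0 ω)⟫ + ρ * ‖X (o 0 ω)‖) * c (o 0 ω)) μ)
    (hintV : Integrable (fun ω => Real.exp (⟪θ₀, X (o 0 ω)⟫ + ρ * ‖X (o 0 ω)‖) •
      (c (o 0 ω) • V (o 0 ω))) μ)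
    {r : E → F} (hr : ∀ θ, r θ = (∫ ω, Real.exp ⟪θ, X (o 0 ω)⟫ * c (o 0 ω) ∂μ)⁻¹ •
      ∫ ω, Real.exp ⟪θ, X (o 0 ω)⟫ • (c (o 0 ω) • V (o 0 ω)) ∂μ)
    (hs : ∫ ω, Real.exp ⟪θ₀, X (o 0 ω)⟫ * c (o 0 ω) ∂μ ≠ 0) :
    ∀ᵐ ω ∂μ, AsympDiff (fun n θ => (sampleMean o (fun x => Real.exp ⟪θ, X x⟫ * c x) n ω)⁻¹ •
      sampleMean o (fun x => Real.exp ⟪θ, X x⟫ • (c x • V x)) n ω) (r θ₀) (fderiv ℝ r θ₀) θ₀ := by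
  have hX0 : AEMeasurable (fun ω => X (o 0 ω)) μ := (hX.comp (ho.measurable 0)).aemeasurable
  have hc0 : AEStronglyMeasurable (fun ω => c (o 0 ω)) μ :=
    (hc.comp (ho.measurable 0)).aestronglyMeasurable
  have hcV : Measurable fun x => c x • V x := hc.smul hV
  have hcV0 : AEStronglyMeasurable (fun ω => c (o 0 ω) • V (o 0 ω)) μ :=
    (hcV.comp (ho.measurable 0)).aestronglyMeasurable
  have d1 := hasFDerivAt_integral_exp_smul (V := fun ω => c (o 0 ω)) hX0 hc0 hρ hint
  have d2 := hasFDerivAt_integral_exp_smul hX0 hcV0 hρ hintV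
  have hr' : r = fun θ => (∫ ω, Real.exp ⟪θ, X (o 0 ω)⟫ • c (o 0 ω) ∂μ)⁻¹ •
      ∫ ω, Real.exp ⟪θ, X (o 0 ω)⟫ • (c (o 0 ω) • V (o 0 ω)) ∂μ := funext hr
  have d3 := ((hasStrictFDerivAt_quot hs (∫ ω, Real.exp ⟪θ₀, X (o 0 ω)⟫ •
    (c (o 0 ω) • V (o 0 ω)) ∂μ)).hasFDerivAt.comp θ₀ (d1.prodMk d2)).fderiv
  have e3 : fderiv ℝ r θ₀ = _ := (congrArg (fun g => fderiv ℝ g θ₀) hr').trans d3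
  filter_upwards [ho.ae_asympDiff hX hc hρ hint, ho.ae_asympDiff hX hcV hρ hintV] with ω a1 a2
  have := (a1.prodMk a2).comp (hasStrictFDerivAt_quot hs _)
  rw [e3, hr θ₀]
  exact this

end CEB

namespace CEB

/-! ### Moments within treatment groups -/

section Cond

variable {Ω : Type*} [MeasurableSpace Ω] {μ : Measure Ω} [IsProbabilityMeasure μ]
  {F : Type*} [NormedAddCommGroup F] [NormedSpace ℝ F] {s : Set Ω} {f : Ω → F}

lemma restrict_eq_smul_cond (h0 : μ s ≠ 0) : μ.restrict s = μ s • μ[|s] := by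
  rw [ProbabilityTheory.cond, smul_smul, ENNReal.mul_inv_cancel h0 (measure_ne_top _ _), one_smul]

lemma integral_indicator_cond (hs : MeasurableSet s) (h0 : μ s ≠ 0) :
    ∫ ω, s.indicator f ω ∂μ = μ.real s • ∫ ω, f ω ∂(μ[|s]) := by
  rw [integral_indicator hs, restrict_eq_smul_cond h0, integral_smul_measure]
  rfl

lemma integrable_indicator_cond (hs : MeasurableSet s) (h0 : μ s ≠ 0)
    (hf : Integrable f (μ[|s])) : Integrable (s.indicator f) μ := by
  rw [integrable_indicator_iff hs, IntegrableOn, restrict_eq_smul_cond h0]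
  exact hf.smul_measure (measure_ne_top _ _)

lemma memLp_indicator_cond (hs : MeasurableSet s) (h0 : μ s ≠ 0)
    (hf : MemLp f 2 (μ[|s])) : MemLp (s.indicator f) 2 μ := by
  rw [memLp_indicator_iff_restrict hs, restrict_eq_smul_cond h0]
  exact hf.smul_measure (measure_ne_top _ _)

end Cond

section L2

variable {Ω : Type*} [MeasurableSpace Ω] {ν : Measure Ω} [IsFiniteMeasure ν] {p : ℕ}
  {X : Ω → EuclideanSpace ℝ (Fin p)} {θ₀ : EuclideanSpace ℝ (Fin p)} {ρ : ℝ}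

lemma exp_sq_eq (x : EuclideanSpace ℝ (Fin p)) :
    (Real.exp (⟪θ₀, x⟫ + ρ / 2 * ‖x‖)) ^ 2 = Real.exp (⟪(2 : ℝ) • θ₀, x⟫ + ρ * ‖x‖) := by
  rw [← Real.exp_nat_mul, inner_smul_left]
  congr 1
  push_cast
  simp only [conj_trivial]
  ring

/-- An envelope at `2 θ₀` gives a square integrable envelope at `θ₀`. -/
lemma memLp_exp_add_norm (hX : AEMeasurable X ν)
    (h : Integrable (fun ω => Real.exp (⟪(2 : ℝ) • θ₀, X ω⟫ + ρ * ‖X ω‖)) ν) :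
    MemLp (fun ω => Real.exp (⟪θ₀, X ω⟫ + ρ / 2 * ‖X ω‖)) 2 ν := by
  rw [memLp_two_iff_integrable_sq (AEMeasurable.aestronglyMeasurable (by fun_prop))]
  simpa only [exp_sq_eq] using h

lemma memLp_exp_smul {F : Type*} [NormedAddCommGroup F] [NormedSpace ℝ F] {V : Ω → F}
    (hX : AEMeasurable X ν) (hV : AEStronglyMeasurable V ν) {C : ℝ}
    (hVX : ∀ ω, ‖V ω‖ ≤ C * Real.exp (ρ / 2 * ‖X ω‖))
    (h : Integrable (fun ω => Real.exp (⟪(2 : ℝ) • θ₀, X ω⟫ + ρ * ‖X ω‖)) ν) :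
    MemLp (fun ω => Real.exp ⟪θ₀, X ω⟫ • V ω) 2 ν := by
  refine (memLp_exp_add_norm hX h).of_le_mul (c := C) ?_ (Eventually.of_forall fun ω => ?_)
  · exact (show AEMeasurable (fun ω => Real.exp ⟪θ₀, X ω⟫) ν by
      fun_prop).aestronglyMeasurable.smul hV
  · rw [norm_smul, Real.norm_of_nonneg (Real.exp_pos _).le, Real.norm_of_nonneg (Real.exp_pos _).le,
      Real.exp_add, mul_left_comm]
    exact mul_le_mul_of_nonneg_left (hVX ω) (Real.exp_pos _).le

/-- If `exp ⟪θ₀, X⟫ V` is square integrable, its product with a small exponential of `‖X‖` is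
integrable. -/
lemma integrable_exp_add_norm_smul_of_memLp {V : Ω → ℝ} (hX : AEMeasurable X ν)
    (h0 : Integrable (fun ω => Real.exp (⟪(0 : EuclideanSpace ℝ (Fin p)), X ω⟫ + ρ * ‖X ω‖)) ν)
    (hV : MemLp (fun ω => Real.exp ⟪θ₀, X ω⟫ * V ω) 2 ν) :
    Integrable (fun ω => Real.exp (⟪θ₀, X ω⟫ + ρ / 2 * ‖X ω‖) • V ω) ν := by
  have h1 : MemLp (fun ω => Real.exp (⟪(0 : EuclideanSpace ℝ (Fin p)), X ω⟫ + ρ / 2 * ‖X ω‖)) 2 ν :=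
    memLp_exp_add_norm (θ₀ := 0) hX (by simpa using h0)
  refine (h1.integrable_mul hV).congr (Eventually.of_forall fun ω => ?_)
  simp only [Pi.mul_apply, inner_zero_left, zero_add, smul_eq_mul, Real.exp_add]
  ring

lemma Integrable.exp_add_norm_anti {F : Type*} [NormedAddCommGroup F] [NormedSpace ℝ F]
    {V : Ω → F} (hX : AEMeasurable X ν) (hV : AEStronglyMeasurable V ν) {ρ' : ℝ} (hρ : ρ' ≤ ρ)
    (h : Integrable (fun ω => Real.exp (⟪θ₀, X ω⟫ + ρ * ‖X ω‖) • V ω) ν) :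
    Integrable (fun ω => Real.exp (⟪θ₀, X ω⟫ + ρ' * ‖X ω‖) • V ω) ν := by
  refine h.mono ?_ (Eventually.of_forall fun ω => ?_)
  · exact (show AEMeasurable (fun ω => Real.exp (⟪θ₀, X ω⟫ + ρ' * ‖X ω‖)) ν by
      fun_prop).aestronglyMeasurable.smul hV
  · rw [norm_smul, norm_smul, Real.norm_of_nonneg (Real.exp_pos _).le,
      Real.norm_of_nonneg (Real.exp_pos _).le]
    gcongr

/-- A common envelope for the weighted averages of `1`, `X` and `V`. -/
lemma exists_common_envelope {V : Ω → ℝ} (hX : AEMeasurable X ν) (hV : AEMeasurable V ν)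
    (h1 : ∃ ρ : ℝ, 0 < ρ ∧ Integrable (fun ω => Real.exp (⟪θ₀, X ω⟫ + ρ * ‖X ω‖)) ν)
    (h0 : ∃ ρ : ℝ, 0 < ρ ∧
      Integrable (fun ω => Real.exp (⟪(0 : EuclideanSpace ℝ (Fin p)), X ω⟫ + ρ * ‖X ω‖)) ν)
    (hXV : MemLp (fun ω => Real.exp ⟪θ₀, X ω⟫ * V ω) 2 ν) :
    ∃ ρ : ℝ, 0 < ρ ∧ Integrable (fun ω => Real.exp (⟪θ₀, X ω⟫ + ρ * ‖X ω‖)) ν ∧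
      Integrable (fun ω => Real.exp (⟪θ₀, X ω⟫ + ρ * ‖X ω‖) • X ω) ν ∧
      Integrable (fun ω => Real.exp (⟪θ₀, X ω⟫ + ρ * ‖X ω‖) • V ω) ν := by
  obtain ⟨ρ₁, hρ₁, i1⟩ := h1
  obtain ⟨ρ₀, hρ₀, i0⟩ := h0
  refine ⟨min (ρ₁ / 2) (ρ₀ / 2), by positivity, ?_, ?_, ?_⟩
  · have := Integrable.exp_add_norm_anti (V := fun _ => (1 : ℝ)) hX aestronglyMeasurable_const
      (ρ' := min (ρ₁ / 2) (ρ₀ / 2)) ((min_le_left _ _).trans (half_le_self hρ₁.le))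
      (by simpa using i1)
    simpa using this
  · exact Integrable.exp_add_norm_anti hX hX.aestronglyMeasurable (min_le_left _ _)
      (integrable_exp_add_norm_smul hρ₁ hX hX.aestronglyMeasurable (fun _ => le_rfl) i1)
  · exact Integrable.exp_add_norm_anti hX hV.aestronglyMeasurable (min_le_right _ _)
      (integrable_exp_add_norm_smul_of_memLp hX i0 hXV)

end L2

variable {Ω : Type*} [MeasurableSpace Ω] {p : ℕ} {μ : Measure Ω} [IsProbabilityMeasure μ]
  {S : Sample Ω p} {α₀ : ℝ} {θ₀ : EuclideanSpace ℝ (Fin p)}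

/-- The gradient of the log moment generating function of the measurement error. -/
noncomputable def errMean (S : Sample Ω p) (μ : Measure Ω) (θ : EuclideanSpace ℝ (Fin p)) :
    EuclideanSpace ℝ (Fin p) :=
  tiltedMean μ (S.err 0) θ (S.err 0)

namespace Model

lemma measurableSet_treatment (h : Model S μ α₀ θ₀) (b : Bool) :
    MeasurableSet (S.T 0 ⁻¹' {b}) := h.hT 0 (measurableSet_singleton b)

lemma Y_ae_eq_ctl (h : Model S μ α₀ θ₀) : S.Y 0 =ᵐ[S.ctl μ] S.Y0 0 := by
  refine ae_cond_of_forall_mem (h.measurableSet_treatment false) fun ω hω => ?_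
  simp only [mem_preimage, mem_singleton_iff] at hω
  simp [Sample.Y, hω]

lemma Y_ae_eq_trt (h : Model S μ α₀ θ₀) : S.Y 0 =ᵐ[S.trt μ] S.Y1 0 := by
  refine ae_cond_of_forall_mem (h.measurableSet_treatment true) fun ω hω => ?_
  simp only [mem_preimage, mem_singleton_iff] at hω
  simp [Sample.Y, hω]

/-! ### Integrability -/

lemma integrable_exp_smul_Z (h : Model S μ α₀ θ₀) {θ : EuclideanSpace ℝ (Fin p)}
    (hθ : θ ∈ interior (S.expDomain μ)) :
    Integrable (fun ω => Real.exp ⟪θ, S.Z 0 ω⟫ • S.Z 0 ω) (S.ctl μ) := by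
  obtain ⟨ρ, hρ, hi⟩ := h.exists_envelope_Z hθ
  exact integrable_exp_smul (h.hZ 0).aemeasurable (h.hZ 0).aestronglyMeasurable
    (integrable_exp_add_norm_smul hρ (h.hZ 0).aemeasurable (h.hZ 0).aestronglyMeasurable
      (fun _ => le_rfl) hi) (by simpa using (half_pos hρ).le)

lemma integrable_exp_smul_err (h : Model S μ α₀ θ₀) {θ : EuclideanSpace ℝ (Fin p)}
    (hθ : θ ∈ interior (S.expDomain μ)) :
    Integrable (fun ω => Real.exp ⟪θ, S.err 0 ω⟫ • S.err 0 ω) μ := by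
  obtain ⟨ρ, hρ, hi⟩ := h.exists_envelope_err hθ
  exact integrable_exp_smul (h.herr 0).aemeasurable (h.herr 0).aestronglyMeasurable
    (integrable_exp_add_norm_smul hρ (h.herr 0).aemeasurable (h.herr 0).aestronglyMeasurable
      (fun _ => le_rfl) hi) (by simpa using (half_pos hρ).le)

lemma memLp_exp_Z_Y (h : Model S μ α₀ θ₀) :
    MemLp (fun ω => Real.exp ⟪θ₀, S.Z 0 ω⟫ * S.Y 0 ω) 2 (S.ctl μ) := by
  have hZ := h.hZ 0
  have hY := h.measurable_Y 0
  rw [memLp_two_iff_integrable_sq (Measurable.aestronglyMeasurable (by fun_prop))]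
  refine h.hYctl.congr (Eventually.of_forall fun ω => ?_)
  simp only [mul_pow, ← Real.exp_nat_mul, inner_smul_left, conj_trivial]
  push_cast
  ring

lemma memLp_exp_Zstar_Y (h : Model S μ α₀ θ₀) :
    MemLp (fun ω => Real.exp ⟪θ₀, S.Zstar 0 ω⟫ * S.Y 0 ω) 2 (S.ctl μ) := by
  have hZ := h.measurable_Zstar 0
  have hY := h.measurable_Y 0
  rw [memLp_two_iff_integrable_sq (Measurable.aestronglyMeasurable (by fun_prop))]
  have h1 := h.integrable_data_smul_err (f := fun x => x.2 ^ 2 * Real.exp ⟪(2 : ℝ) • θ₀, x.1⟫)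
    (k := fun e => Real.exp ⟪(2 : ℝ) • θ₀, e⟫) (by fun_prop) (by fun_prop) h.hYctl
    (h.integrable_exp_err (interior_subset h.dom_two))
  refine h1.congr (Eventually.of_forall fun ω => ?_)
  simp only [mul_pow, ← Real.exp_nat_mul, inner_smul_left, conj_trivial, Sample.Zstar,
    inner_add_right, smul_eq_mul]
  push_cast
  rw [mul_add, Real.exp_add]
  ring

lemma integrable_exp_Z_Y (h : Model S μ α₀ θ₀) :
    Integrable (fun ω => Real.exp ⟪θ₀, S.Z 0 ω⟫ * S.Y 0 ω) (S.ctl μ) := by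
  have := h.isProbabilityMeasure_ctl
  exact h.memLp_exp_Z_Y.integrable one_le_two

lemma exists_common_envelope_Z (h : Model S μ α₀ θ₀) : ∃ ρ : ℝ, 0 < ρ ∧
    Integrable (fun ω => Real.exp (⟪θ₀, S.Z 0 ω⟫ + ρ * ‖S.Z 0 ω‖)) (S.ctl μ) ∧
    Integrable (fun ω => Real.exp (⟪θ₀, S.Z 0 ω⟫ + ρ * ‖S.Z 0 ω‖) • S.Z 0 ω) (S.ctl μ) ∧
    Integrable (fun ω => Real.exp (⟪θ₀, S.Z 0 ω⟫ + ρ * ‖S.Z 0 ω‖) • S.Y 0 ω) (S.ctl μ) :=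
  have := h.isProbabilityMeasure_ctl
  exists_common_envelope (h.hZ 0).aemeasurable (h.measurable_Y 0).aemeasurable
    (h.exists_envelope_Z h.dom_self) (h.exists_envelope_Z h.dom_zero) h.memLp_exp_Z_Y

lemma exists_common_envelope_Zstar (h : Model S μ α₀ θ₀) : ∃ ρ : ℝ, 0 < ρ ∧
    Integrable (fun ω => Real.exp (⟪θ₀, S.Zstar 0 ω⟫ + ρ * ‖S.Zstar 0 ω‖)) (S.ctl μ) ∧
    Integrable (fun ω => Real.exp (⟪θ₀, S.Zstar 0 ω⟫ + ρ * ‖S.Zstar 0 ω‖) • S.Zstar 0 ω)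
      (S.ctl μ) ∧
    Integrable (fun ω => Real.exp (⟪θ₀, S.Zstar 0 ω⟫ + ρ * ‖S.Zstar 0 ω‖) • S.Y 0 ω)
      (S.ctl μ) :=
  have := h.isProbabilityMeasure_ctl
  exists_common_envelope (h.measurable_Zstar 0).aemeasurable (h.measurable_Y 0).aemeasurable
    (h.exists_envelope_Zstar h.dom_self) (h.exists_envelope_Zstar h.dom_zero) h.memLp_exp_Zstar_Y

lemma memLp_err (h : Model S μ α₀ θ₀) : MemLp (S.err 0) 2 μ := by
  obtain ⟨ρ, hρ, hi⟩ := h.exists_envelope_err h.dom_zero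
  have := memLp_exp_smul (θ₀ := 0) (V := S.err 0) (C := 1 / (ρ / 2)) (h.herr 0).aemeasurable
    (h.herr 0).aestronglyMeasurable (fun ω => le_mul_exp (half_pos hρ)) (by simpa using hi)
  simpa using this

/-- Square integrability of the true covariates among the treated comes from exponential moments
among the controls, by tilting. -/
lemma memLp_Z_trt (h : Model S μ α₀ θ₀) : MemLp (S.Z 0) 2 (S.trt μ) := by
  have := h.isProbabilityMeasure_trt
  obtain ⟨ρ, hρ, hi⟩ := h.exists_envelope_Z h.dom_self
  have h1 : Integrable (fun ω => Real.exp (ρ * ‖S.Z 0 ω‖)) (S.trt μ) := by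
    refine (integrable_cond_treated_iff (h.hT 0) (h.hZ 0) (h.hY0 0) h.hign_Y0 h.hlogit
      (h := fun x => Real.exp (ρ * ‖x.1‖)) (by fun_prop)).mpr ?_
    refine hi.congr (Eventually.of_forall fun ω => ?_)
    simp [Real.exp_add]
  have := memLp_exp_smul (θ₀ := 0) (V := S.Z 0) (C := 1 / (ρ / 2)) (h.hZ 0).aemeasurable
    (h.hZ 0).aestronglyMeasurable (fun ω => le_mul_exp (half_pos hρ)) (by simpa using h1)
  simpa using this

lemma memLp_err_trt (h : Model S μ α₀ θ₀) : MemLp (S.err 0) 2 (S.trt μ) :=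
  (h.identDistrib_err_cond true).memLp_iff.mpr h.memLp_err

lemma memLp_Zstar_trt (h : Model S μ α₀ θ₀) : MemLp (S.Zstar 0) 2 (S.trt μ) :=
  h.memLp_Z_trt.add h.memLp_err_trt

lemma memLp_Y_trt (h : Model S μ α₀ θ₀) : MemLp (S.Y 0) 2 (S.trt μ) :=
  (memLp_two_iff_integrable_sq (h.measurable_Y 0).aestronglyMeasurable).mpr h.hYtrt

lemma memLp_exp_Zstar (h : Model S μ α₀ θ₀) :
    MemLp (fun ω => Real.exp ⟪θ₀, S.Zstar 0 ω⟫) 2 (S.ctl μ) := by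
  have := h.isProbabilityMeasure_ctl
  obtain ⟨ρ, hρ, hi⟩ := h.exists_envelope_Zstar h.dom_two
  have := memLp_exp_smul (V := fun _ => (1 : ℝ)) (C := 1) (h.measurable_Zstar 0).aemeasurable
    aestronglyMeasurable_const (fun ω => by simp; positivity) hi
  simpa using this

lemma memLp_exp_smul_Zstar (h : Model S μ α₀ θ₀) :
    MemLp (fun ω => Real.exp ⟪θ₀, S.Zstar 0 ω⟫ • S.Zstar 0 ω) 2 (S.ctl μ) := by
  have := h.isProbabilityMeasure_ctl
  obtain ⟨ρ, hρ, hi⟩ := h.exists_envelope_Zstar h.dom_two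
  exact memLp_exp_smul (C := 1 / (ρ / 2)) (h.measurable_Zstar 0).aemeasurable
    (h.measurable_Zstar 0).aestronglyMeasurable (fun ω => le_mul_exp (half_pos hρ)) hi

/-! ### Population identities -/

/-- Removing the error from an exponentially tilted mean of the mismeasured covariates. -/
lemma tiltedMean_Zstar (h : Model S μ α₀ θ₀) {θ : EuclideanSpace ℝ (Fin p)}
    (hθ : θ ∈ interior (S.expDomain μ)) :
    tiltedMean (S.ctl μ) (S.Zstar 0) θ (S.Zstar 0) = S.B μ θ + errMean S μ θ := by
  have hθ' := interior_subset hθ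
  have hs := h.integral_exp_Z_pos hθ'
  have hM := h.M_pos hθ'
  have e1 : ∀ ω, Real.exp ⟪θ, S.Zstar 0 ω⟫ • S.Zstar 0 ω =
      Real.exp ⟪θ, S.err 0 ω⟫ • (Real.exp ⟪θ, S.Z 0 ω⟫ • S.Z 0 ω) +
        Real.exp ⟪θ, S.Z 0 ω⟫ • (Real.exp ⟪θ, S.err 0 ω⟫ • S.err 0 ω) := fun ω => by
    rw [exp_inner_Zstar, Sample.Zstar]
    module
  have m1 : Measurable fun x : EuclideanSpace ℝ (Fin p) × ℝ => Real.exp ⟪θ, x.1⟫ • x.1 := by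
    fun_prop
  have m2 : Measurable fun x : EuclideanSpace ℝ (Fin p) => Real.exp ⟪θ, x⟫ • x := by fun_prop
  have m3 : Measurable fun x : EuclideanSpace ℝ (Fin p) × ℝ => Real.exp ⟪θ, x.1⟫ := by
    fun_prop
  have m4 : Measurable fun x : EuclideanSpace ℝ (Fin p) => Real.exp ⟪θ, x⟫ := by fun_prop
  have e2 : ∫ ω, Real.exp ⟪θ, S.Zstar 0 ω⟫ • S.Zstar 0 ω ∂(S.ctl μ) =
      S.M μ θ • (∫ ω, Real.exp ⟪θ, S.Z 0 ω⟫ • S.Z 0 ω ∂(S.ctl μ)) +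
        (∫ ω, Real.exp ⟪θ, S.Z 0 ω⟫ ∂(S.ctl μ)) •
          ∫ ω, Real.exp ⟪θ, S.err 0 ω⟫ • S.err 0 ω ∂μ := by
    simp_rw [e1]
    rw [integral_add (h.integrable_err_smul_data m1 m4 (h.integrable_exp_smul_Z hθ)
        (h.integrable_exp_err hθ'))
      (h.integrable_data_smul_err m3 m2 (h.integrable_exp_Z hθ') (h.integrable_exp_smul_err hθ)),
      h.integral_err_smul_data m1 m4, h.integral_data_smul_err m3 m2]
    rfl
  rw [tiltedMean, e2, h.integral_exp_Zstar, Sample.B, errMean, tiltedMean, tiltedMean, smul_add,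
    smul_smul, smul_smul]
  congr 2
  · field_simp
  · change _ = (S.M μ θ)⁻¹
    field_simp

lemma tiltedMean_Zstar_Y (h : Model S μ α₀ θ₀) {θ : EuclideanSpace ℝ (Fin p)}
    (hθ : θ ∈ S.expDomain μ) :
    tiltedMean (S.ctl μ) (S.Zstar 0) θ (S.Y 0) = S.A μ θ := by
  have hs := h.integral_exp_Z_pos hθ
  have hM := h.M_pos hθ
  have e1 : ∀ ω, Real.exp ⟪θ, S.Zstar 0 ω⟫ • S.Y 0 ω =
      (Real.exp ⟪θ, S.Z 0 ω⟫ * S.Y 0 ω) • Real.exp ⟪θ, S.err 0 ω⟫ := fun ω => by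
    rw [exp_inner_Zstar]; simp only [smul_eq_mul]; ring
  rw [tiltedMean, h.integral_exp_Zstar, Sample.A, tiltedMean]
  simp_rw [e1]
  rw [h.integral_data_smul_err (f := fun x => Real.exp ⟪θ, x.1⟫ * x.2)
    (k := fun e => Real.exp ⟪θ, e⟫) (by fun_prop) (by fun_prop)]
  change _ * (_ * S.M μ θ) = _
  simp only [smul_eq_mul]
  field_simp

/-- Covariate balance: the treated mean of the mismeasured covariates is the tilted control mean of
the true covariates at `θ₀`. -/
lemma integral_Zstar_trt (h : Model S μ α₀ θ₀) :
    ∫ ω, S.Zstar 0 ω ∂(S.trt μ) = S.B μ θ₀ := by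
  have := h.isProbabilityMeasure_trt
  have h1 : ∫ ω, S.err 0 ω ∂(S.trt μ) = 0 :=
    (h.identDistrib_err_cond true).integral_eq.trans h.herr_mean
  have h2 : ∫ ω, S.Z 0 ω ∂(S.trt μ) = S.B μ θ₀ :=
    integral_cond_treated (h.hT 0) (h.hZ 0) (h.hY0 0) h.hign_Y0 h.hlogit measurable_fst
  simp only [Sample.Zstar]
  rw [integral_add (h.memLp_Z_trt.integrable one_le_two)
    (h.memLp_err_trt.integrable one_le_two), h1, h2, add_zero]

/-- Identification of the treatment effect. -/
lemma att_eq (h : Model S μ α₀ θ₀) :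
    S.att μ = (∫ ω, S.Y 0 ω ∂(S.trt μ)) - S.A μ θ₀ := by
  have := h.isProbabilityMeasure_trt
  have h0 : ∫ ω, S.Y0 0 ω ∂(S.trt μ) = S.A μ θ₀ := by
    refine (integral_cond_treated (h.hT 0) (h.hZ 0) (h.hY0 0) h.hign_Y0 h.hlogit
      measurable_snd).trans ?_
    simp only [Sample.A, tiltedMean, Sample.ctl]
    congr 1
    refine integral_congr_ae (h.Y_ae_eq_ctl.mono fun ω hω => ?_)
    simp only [hω]
  have i0 : Integrable (S.Y0 0) (S.trt μ) := by
    refine (integrable_cond_treated_iff (h.hT 0) (h.hZ 0) (h.hY0 0) h.hign_Y0 h.hlogit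
      measurable_snd).mpr ?_
    refine h.integrable_exp_Z_Y.congr (h.Y_ae_eq_ctl.mono fun ω hω => ?_)
    simp [hω]
  have i1 : Integrable (S.Y1 0) (S.trt μ) :=
    (h.memLp_Y_trt.integrable one_le_two).congr h.Y_ae_eq_trt
  rw [Sample.att, integral_sub i1 i0, h0, integral_congr_ae h.Y_ae_eq_trt]

end Model

end CEB

namespace CEB

/-! ### Derivatives of the population quantities -/

lemma integrable_exp_smul_smul {Ω E F : Type*} [MeasurableSpace Ω] {ν : Measure Ω}
    [NormedAddCommGroup E] [InnerProductSpace ℝ E] [NormedAddCommGroup F] [NormedSpace ℝ F]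
    [MeasurableSpace E] [BorelSpace E] [SecondCountableTopology E] {X : Ω → E} {V : Ω → F}
    {θ₀ : E} {ρ : ℝ} (hX : AEMeasurable X ν) (hV : AEStronglyMeasurable V ν) (hρ : 0 < ρ)
    (hint : Integrable (fun ω => Real.exp (⟪θ₀, X ω⟫ + ρ * ‖X ω‖) • V ω) ν) (a : E) :
    Integrable (fun ω => Real.exp ⟪θ₀, X ω⟫ • (⟪a, X ω⟫ • V ω)) ν :=
  ((integrable_expDeriv hX hV hρ hint).apply_continuousLinearMap a).congr
    (Eventually.of_forall fun _ => expDeriv_apply _ _ _ _)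

section Tilted

variable {p : ℕ} {Ω : Type*} [MeasurableSpace Ω] {ν : Measure Ω}
  {F : Type*} [NormedAddCommGroup F] [NormedSpace ℝ F] [CompleteSpace F]
  {X : Ω → EuclideanSpace ℝ (Fin p)} {V : Ω → F} {θ₀ : EuclideanSpace ℝ (Fin p)}

lemma integral_exp_smul_sub_tiltedMean (h1 : Integrable (fun ω => Real.exp ⟪θ₀, X ω⟫) ν)
    (hV : Integrable (fun ω => Real.exp ⟪θ₀, X ω⟫ • V ω) ν)
    (hs : ∫ ω, Real.exp ⟪θ₀, X ω⟫ ∂ν ≠ 0) :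
    ∫ ω, Real.exp ⟪θ₀, X ω⟫ • (V ω - tiltedMean ν X θ₀ V) ∂ν = 0 := by
  simp only [smul_sub]
  rw [integral_sub hV (h1.smul_const _), integral_smul_const, tiltedMean, smul_inv_smul₀ hs,
    sub_self]

lemma tiltedMean_apply {W : Ω → EuclideanSpace ℝ (Fin p)}
    (hint : Integrable (fun ω => Real.exp ⟪θ₀, X ω⟫ • W ω) ν) (i : Fin p) :
    tiltedMean ν X θ₀ W i = tiltedMean ν X θ₀ (fun ω => W ω i) := by
  have := (EuclideanSpace.proj (𝕜 := ℝ) i).integral_comp_comm hint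
  simp only [tiltedMean, PiLp.smul_apply, smul_eq_mul]
  congr 1
  simpa using this.symm

end Tilted

namespace Model

variable {Ω : Type*} [MeasurableSpace Ω] {p : ℕ}
  {μ : Measure Ω} [IsProbabilityMeasure μ] {S : Sample Ω p} {α₀ : ℝ}
  {θ₀ : EuclideanSpace ℝ (Fin p)}

/-- Among the controls, too, no nontrivial linear combination of the covariates is constant. -/
lemma eq_zero_of_ae_ctl (h : Model S μ α₀ θ₀) {a : EuclideanSpace ℝ (Fin p)} {c : ℝ}
    (hc : ∀ᵐ ω ∂(S.ctl μ), ⟪a, S.Z 0 ω⟫ = c) : a = 0 := by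
  by_contra ha
  refine h.hident_Z a ha ⟨c, ?_⟩
  have hs : MeasurableSet {z : EuclideanSpace ℝ (Fin p) | ⟪a, z⟫ = c} :=
    measurableSet_eq_fun (by fun_prop) measurable_const
  refine ae_of_ae_restrict_treatment (h.hT 0) (h.hZ 0) (h.hY0 0) h.hign_Y0 h.hlogit false hs ?_
  rw [restrict_eq_smul_cond (h.measure_ne_zero false)]
  exact Measure.ae_smul_measure hc _

lemma integrable_exp_smul_smul_Z (h : Model S μ α₀ θ₀) (a : EuclideanSpace ℝ (Fin p)) :
    Integrable (fun ω => Real.exp ⟪θ₀, S.Z 0 ω⟫ • (⟪a, S.Z 0 ω⟫ • S.Z 0 ω)) (S.ctl μ) := by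
  obtain ⟨ρ, hρ, -, hi, -⟩ := h.exists_common_envelope_Z
  exact integrable_exp_smul_smul (h.hZ 0).aemeasurable (h.hZ 0).aestronglyMeasurable hρ hi a

lemma integrable_exp_mul_inner_Z (h : Model S μ α₀ θ₀) (a : EuclideanSpace ℝ (Fin p)) :
    Integrable (fun ω => Real.exp ⟪θ₀, S.Z 0 ω⟫ * ⟪a, S.Z 0 ω⟫) (S.ctl μ) :=
  ((h.integrable_exp_smul_Z h.dom_self).const_inner a).congr
    (Eventually.of_forall fun ω => by simp [inner_smul_right])

lemma integral_exp_mul_inner_Z (h : Model S μ α₀ θ₀) (a : EuclideanSpace ℝ (Fin p)) :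
    ∫ ω, Real.exp ⟪θ₀, S.Z 0 ω⟫ * ⟪a, S.Z 0 ω⟫ ∂(S.ctl μ) =
      (∫ ω, Real.exp ⟪θ₀, S.Z 0 ω⟫ ∂(S.ctl μ)) * ⟪a, S.B μ θ₀⟫ := by
  have hs := h.integral_exp_Z_pos (interior_subset h.dom_self)
  have := integral_inner (𝕜 := ℝ) (h.integrable_exp_smul_Z h.dom_self) a
  simp only [inner_smul_right] at this
  rw [this, Sample.B, tiltedMean, inner_smul_right, mul_inv_cancel_left₀ hs.ne']

lemma fderiv_B_apply (h : Model S μ α₀ θ₀) (a : EuclideanSpace ℝ (Fin p)) :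
    fderiv ℝ (S.B μ) θ₀ a = tiltedMean (S.ctl μ) (S.Z 0) θ₀ (fun ω => ⟪a, S.Z 0 ω⟫ • S.Z 0 ω) -
      ⟪a, S.B μ θ₀⟫ • S.B μ θ₀ := by
  have := h.isProbabilityMeasure_ctl
  obtain ⟨ρ, hρ, h1, hi, -⟩ := h.exists_common_envelope_Z
  rw [show S.B μ = fun θ => tiltedMean (S.ctl μ) (S.Z 0) θ (S.Z 0) from rfl,
    fderiv_tiltedMean_apply (h.hZ 0).aemeasurable (h.hZ 0).aestronglyMeasurable hρ h1 hi
      (h.integral_exp_Z_pos (interior_subset h.dom_self)).ne',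
    tiltedMean_inner_const (h.integrable_exp_smul_Z h.dom_self)]

lemma hasFDerivAt_B (h : Model S μ α₀ θ₀) :
    HasFDerivAt (S.B μ) (fderiv ℝ (S.B μ) θ₀) θ₀ := by
  obtain ⟨ρ, hρ, h1, hi, -⟩ := h.exists_common_envelope_Z
  exact (hasFDerivAt_tiltedMean (h.hZ 0).aemeasurable (h.hZ 0).aestronglyMeasurable hρ h1 hi
    (h.integral_exp_Z_pos (interior_subset h.dom_self)).ne').differentiableAt.hasFDerivAt

/-- The matrix `H` represents the derivative of `B`. -/
lemma toEuclideanCLM_H (h : Model S μ α₀ θ₀) :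
    Matrix.toEuclideanCLM (n := Fin p) (𝕜 := ℝ) (S.H μ θ₀) = fderiv ℝ (S.B μ) θ₀ := by
  refine ContinuousLinearMap.coe_injective
    ((EuclideanSpace.basisFun (Fin p) ℝ).toBasis.ext fun j => ?_)
  simp only [OrthonormalBasis.coe_toBasis, EuclideanSpace.basisFun_apply,
    ContinuousLinearMap.coe_coe]
  ext i
  rw [h.fderiv_B_apply, Matrix.ofLp_toEuclideanCLM]
  simp only [PiLp.ofLp_single, Matrix.mulVec_single_one, PiLp.sub_apply, PiLp.smul_apply,
    EuclideanSpace.inner_single_left, map_one, one_mul, Matrix.col_apply, smul_eq_mul]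
  have := h.integrable_exp_smul_smul_Z (EuclideanSpace.single j 1)
  simp only [EuclideanSpace.inner_single_left, map_one, one_mul] at this
  rw [tiltedMean_apply this]
  simp only [Sample.H, Matrix.of_apply, PiLp.smul_apply, smul_eq_mul, mul_comm]

/-- `H` is a tilted covariance matrix, and it is nondegenerate since the controls identify. -/
lemma posDef_H (h : Model S μ α₀ θ₀) : (S.H μ θ₀).PosDef := by
  have hθ := interior_subset h.dom_self
  have hs := h.integral_exp_Z_pos hθ
  have i0 := h.integrable_exp_Z hθ
  refine Matrix.PosDef.of_dotProduct_mulVec_pos ?_ fun x hx => ?_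
  · ext i j
    simp only [Sample.H, Matrix.of_apply, Matrix.conjTranspose_apply, star_trivial, mul_comm]
  set a : EuclideanSpace ℝ (Fin p) := WithLp.toLp 2 x with ha
  have ha0 : a ≠ 0 := fun h0 => hx (by simpa [ha] using h0)
  set m : ℝ := ⟪a, S.B μ θ₀⟫ with hm
  have i2 := h.integrable_exp_smul_smul_Z a
  have j1 := h.integrable_exp_mul_inner_Z a
  have j2 : Integrable (fun ω => Real.exp ⟪θ₀, S.Z 0 ω⟫ * ⟪a, S.Z 0 ω⟫ ^ 2) (S.ctl μ) :=
    (i2.const_inner a).congr (Eventually.of_forall fun ω => by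
      simp only [inner_smul_right]; ring)
  have j3 : Integrable (fun ω => Real.exp ⟪θ₀, S.Z 0 ω⟫ * ⟪a, S.Z 0 ω⟫ ^ 2 -
      2 * m * (Real.exp ⟪θ₀, S.Z 0 ω⟫ * ⟪a, S.Z 0 ω⟫)) (S.ctl μ) := j2.sub (j1.const_mul _)
  have e2 : ∀ ω, Real.exp ⟪θ₀, S.Z 0 ω⟫ * (⟪a, S.Z 0 ω⟫ - m) ^ 2 =
      Real.exp ⟪θ₀, S.Z 0 ω⟫ * ⟪a, S.Z 0 ω⟫ ^ 2
        - 2 * m * (Real.exp ⟪θ₀, S.Z 0 ω⟫ * ⟪a, S.Z 0 ω⟫)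
        + m ^ 2 * Real.exp ⟪θ₀, S.Z 0 ω⟫ := fun ω => by ring
  have key : dotProduct (star x) ((S.H μ θ₀).mulVec x) =
      (∫ ω, Real.exp ⟪θ₀, S.Z 0 ω⟫ ∂(S.ctl μ))⁻¹ *
      ∫ ω, Real.exp ⟪θ₀, S.Z 0 ω⟫ * (⟪a, S.Z 0 ω⟫ - m) ^ 2 ∂(S.ctl μ) := by
    have e1 : dotProduct (star x) ((S.H μ θ₀).mulVec x) = ⟪a, fderiv ℝ (S.B μ) θ₀ a⟫ := by
      rw [← h.toEuclideanCLM_H, Matrix.inner_toEuclideanCLM]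
      rfl
    have e3 : ∫ ω, Real.exp ⟪θ₀, S.Z 0 ω⟫ * ⟪a, S.Z 0 ω⟫ ∂(S.ctl μ) =
        (∫ ω, Real.exp ⟪θ₀, S.Z 0 ω⟫ ∂(S.ctl μ)) * m := h.integral_exp_mul_inner_Z a
    have e4 : ⟪a, tiltedMean (S.ctl μ) (S.Z 0) θ₀ (fun ω => ⟪a, S.Z 0 ω⟫ • S.Z 0 ω)⟫ =
        (∫ ω, Real.exp ⟪θ₀, S.Z 0 ω⟫ ∂(S.ctl μ))⁻¹ *
          ∫ ω, Real.exp ⟪θ₀, S.Z 0 ω⟫ * ⟪a, S.Z 0 ω⟫ ^ 2 ∂(S.ctl μ) := by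
      rw [tiltedMean, inner_smul_right, ← integral_inner (𝕜 := ℝ) i2 a]
      congr 1
      refine integral_congr_ae (Eventually.of_forall fun ω => ?_)
      simp only [inner_smul_right]
      ring
    simp_rw [e2]
    rw [e1, h.fderiv_B_apply, inner_sub_right, inner_smul_right, e4,
      integral_add j3 (i0.const_mul _), integral_sub j2 (j1.const_mul _),
      integral_const_mul, integral_const_mul, e3, ← hm]
    field_simp
    ring
  rw [key]
  refine mul_pos (inv_pos.mpr hs) ?_
  have hnn : 0 ≤ᵐ[S.ctl μ] fun ω => Real.exp ⟪θ₀, S.Z 0 ω⟫ * (⟪a, S.Z 0 ω⟫ - m) ^ 2 :=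
    Eventually.of_forall fun ω => by simp only [Pi.zero_apply]; positivity
  refine (integral_nonneg_of_ae hnn).lt_of_ne fun h0 => ha0 ?_
  have hint : Integrable (fun ω => Real.exp ⟪θ₀, S.Z 0 ω⟫ * (⟪a, S.Z 0 ω⟫ - m) ^ 2)
      (S.ctl μ) :=
    (j3.add (i0.const_mul (m ^ 2))).congr
      (Eventually.of_forall fun ω => (e2 ω).symm)
  refine h.eq_zero_of_ae_ctl (c := m) ?_
  filter_upwards [(integral_eq_zero_iff_of_nonneg_ae hnn hint).mp h0.symm] with ω hω
  have : (⟪a, S.Z 0 ω⟫ - m) ^ 2 = 0 := by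
    simpa [(Real.exp_pos _).ne'] using hω
  exact sub_eq_zero.mp (pow_eq_zero_iff two_ne_zero |>.mp this)

lemma fderiv_A_apply (h : Model S μ α₀ θ₀) (a : EuclideanSpace ℝ (Fin p)) :
    fderiv ℝ (S.A μ) θ₀ a = ⟪S.gradA μ θ₀, a⟫ := by
  have := h.isProbabilityMeasure_ctl
  have hZ := h.hZ 0
  have hY := h.measurable_Y 0
  obtain ⟨ρ, hρ, h1, -, hi⟩ := h.exists_common_envelope_Z
  have hint : Integrable (fun ω => Real.exp ⟪θ₀, S.Z 0 ω⟫ • (S.Y 0 ω • S.Z 0 ω)) (S.ctl μ) := by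
    refine (integrable_expDeriv hZ.aemeasurable hY.aestronglyMeasurable hρ hi).mono
      (Measurable.aestronglyMeasurable (by fun_prop)) (Eventually.of_forall fun ω => ?_)
    rw [expDeriv, ContinuousLinearMap.norm_smulRight_apply, innerSL_apply_norm, norm_smul,
      norm_smul, norm_smul, mul_comm ‖S.Z 0 ω‖, mul_assoc]
  rw [show S.A μ = fun θ => tiltedMean (S.ctl μ) (S.Z 0) θ (S.Y 0) from rfl,
    fderiv_tiltedMean_apply hZ.aemeasurable hY.aestronglyMeasurable hρ h1 hi
      (h.integral_exp_Z_pos (interior_subset h.dom_self)).ne',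
    tiltedMean_inner_const (h.integrable_exp_smul_Z h.dom_self), Sample.gradA, inner_sub_left,
    real_inner_comm a, ← tiltedMean_inner_const hint, inner_smul_left, conj_trivial,
    real_inner_comm a, smul_eq_mul, mul_comm]
  congr 2
  · ext ω
    rw [inner_smul_right, smul_eq_mul, mul_comm]

end Model

end CEB

namespace CEB

namespace Model

variable {Ω : Type*} [MeasurableSpace Ω] {p : ℕ}
  {μ : Measure Ω} [IsProbabilityMeasure μ] {S : Sample Ω p} {α₀ : ℝ}
  {θ₀ : EuclideanSpace ℝ (Fin p)}

lemma hasFDerivAt_log_M (h : Model S μ α₀ θ₀) {θ : EuclideanSpace ℝ (Fin p)}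
    (hθ : θ ∈ interior (S.expDomain μ)) :
    HasFDerivAt (fun t => Real.log (S.M μ t)) (innerSL ℝ (errMean S μ θ)) θ := by
  obtain ⟨ρ, hρ, hi⟩ := h.exists_envelope_err hθ
  have he := (h.herr 0).aemeasurable (μ := μ)
  have h1 : HasFDerivAt (S.M μ) (∫ ω, expDeriv θ (S.err 0 ω) (1 : ℝ) ∂μ) θ :=
    hasFDerivAt_integral_exp he hρ hi
  refine (h1.log (h.M_pos (interior_subset hθ)).ne').congr_fderiv ?_
  have i1 := integrable_expDeriv (V := fun _ => (1 : ℝ)) he aestronglyMeasurable_const hρ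
    (by simpa using hi)
  ext a
  rw [_root_.smul_apply, ContinuousLinearMap.integral_apply i1, innerSL_apply_apply, errMean,
    tiltedMean, inner_smul_left, conj_trivial, real_inner_comm a,
    ← integral_inner (𝕜 := ℝ) (h.integrable_exp_smul_err hθ) a]
  simp only [expDeriv_apply, inner_smul_right, smul_eq_mul, mul_one]
  rfl

lemma differentiableAt_errMean (h : Model S μ α₀ θ₀) :
    DifferentiableAt ℝ (errMean S μ) θ₀ := by
  obtain ⟨ρ, hρ, hi⟩ := h.exists_envelope_err h.dom_self
  have he := h.herr 0
  have hi' : Integrable (fun ω => Real.exp (⟪θ₀, S.err 0 ω⟫ + ρ / 2 * ‖S.err 0 ω‖)) μ := by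
    have := Integrable.exp_add_norm_anti (V := fun _ => (1 : ℝ)) he.aemeasurable (ρ := ρ)
      aestronglyMeasurable_const (half_le_self hρ.le) (by simpa using hi)
    simpa using this
  exact (hasFDerivAt_tiltedMean he.aemeasurable he.aestronglyMeasurable (half_pos hρ) hi'
    (integrable_exp_add_norm_smul hρ he.aemeasurable he.aestronglyMeasurable
      (fun _ => le_rfl) hi) (h.M_pos (interior_subset h.dom_self)).ne').differentiableAt

/-- The correction by `log M` makes the limiting Hessian that of the error-free problem. -/
lemma fderiv_tiltedMean_Zstar (h : Model S μ α₀ θ₀) :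
    fderiv ℝ (fun θ => tiltedMean (S.ctl μ) (S.Zstar 0) θ (S.Zstar 0)) θ₀ -
      fderiv ℝ (errMean S μ) θ₀ = fderiv ℝ (S.B μ) θ₀ := by
  have e : (fun θ => tiltedMean (S.ctl μ) (S.Zstar 0) θ (S.Zstar 0)) =ᶠ[𝓝 θ₀]
      (S.B μ + errMean S μ) := by
    filter_upwards [isOpen_interior.mem_nhds h.dom_self] with θ hθ
    exact h.tiltedMean_Zstar hθ
  rw [e.fderiv_eq, fderiv_add h.hasFDerivAt_B.differentiableAt h.differentiableAt_errMean,
    add_sub_cancel_right]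

lemma fderiv_tiltedMean_Zstar_Y (h : Model S μ α₀ θ₀) :
    fderiv ℝ (fun θ => tiltedMean (S.ctl μ) (S.Zstar 0) θ (S.Y 0)) θ₀ =
      fderiv ℝ (S.A μ) θ₀ := by
  refine Filter.EventuallyEq.fderiv_eq ?_
  filter_upwards [isOpen_interior.mem_nhds h.dom_self] with θ hθ
  exact h.tiltedMean_Zstar_Y (interior_subset hθ)

end Model

/-! ### The sample of observations -/

/-- An observation: treatment, true covariates, outcome, and the covariate measurement error. -/
abbrev Obs (p : ℕ) : Type :=
  (Bool × EuclideanSpace ℝ (Fin p) × ℝ) × EuclideanSpace ℝ (Fin p)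

namespace Obs

variable {p : ℕ}

/-- Indicator of the control group. -/
noncomputable def ctlInd (x : Obs p) : ℝ := if x.1.1 then 0 else 1

/-- Indicator of the treatment group. -/
noncomputable def trtInd (x : Obs p) : ℝ := if x.1.1 then 1 else 0

/-- The mismeasured covariates. -/
noncomputable def cov (x : Obs p) : EuclideanSpace ℝ (Fin p) := x.1.2.1 + x.2

/-- The outcome. -/
noncomputable def out (x : Obs p) : ℝ := x.1.2.2

@[fun_prop]
lemma measurable_ctlInd : Measurable (ctlInd (p := p)) :=
  Measurable.ite (measurable_fst.fst (measurableSet_singleton true)) measurable_const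
    measurable_const

@[fun_prop]
lemma measurable_trtInd : Measurable (trtInd (p := p)) :=
  Measurable.ite (measurable_fst.fst (measurableSet_singleton true)) measurable_const
    measurable_const

@[fun_prop]
lemma measurable_cov : Measurable (cov (p := p)) :=
  measurable_fst.snd.fst.add measurable_snd

@[fun_prop]
lemma measurable_out : Measurable (out (p := p)) := measurable_fst.snd.snd

end Obs

open Obs

/-- The observation of subject `i`. -/
noncomputable def Sample.obs {Ω : Type*} {p : ℕ} (S : Sample Ω p) (i : ℕ) (ω : Ω) : Obs p :=
  ((S.T i ω, S.Z i ω, S.Y i ω), S.err i ω)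

section Sums

variable {Ω : Type*} {p : ℕ} {F : Type*} [NormedAddCommGroup F] [NormedSpace ℝ F]
  (S : Sample Ω p) (n : ℕ) (ω : Ω)

lemma sum_controlIdx (f : ℕ → F) :
    ∑ i ∈ S.controlIdx n ω, f i = ∑ i ∈ Finset.range n, ctlInd (S.obs i ω) • f i := by
  rw [Sample.controlIdx, Finset.sum_filter]
  refine Finset.sum_congr rfl fun i _ => ?_
  cases hT : S.T i ω <;> simp [ctlInd, Sample.obs, hT]

lemma sum_treatedIdx (f : ℕ → F) :
    ∑ i ∈ S.treatedIdx n ω, f i = ∑ i ∈ Finset.range n, trtInd (S.obs i ω) • f i := by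
  rw [Sample.treatedIdx, Finset.sum_filter]
  refine Finset.sum_congr rfl fun i _ => ?_
  cases hT : S.T i ω <;> simp [trtInd, Sample.obs, hT]

lemma inv_sampleMean_smul {O : Type*} (o : ℕ → Ω → O) (f : O → ℝ) (g : O → F) :
    (sampleMean o f n ω)⁻¹ • sampleMean o g n ω =
      (∑ i ∈ Finset.range n, f (o i ω))⁻¹ • ∑ i ∈ Finset.range n, g (o i ω) := by
  rcases eq_or_ne n 0 with rfl | hn
  · simp [sampleMean]
  · have hn' : (n : ℝ) ≠ 0 := Nat.cast_ne_zero.mpr hn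
    rw [sampleMean, sampleMean, smul_smul, smul_eq_mul, mul_inv, inv_inv, mul_right_comm,
      mul_inv_cancel₀ hn', one_mul]

lemma treatedMean_eq (f : Obs p → F) :
    S.treatedMean n ω (fun i ω => f (S.obs i ω)) =
      (sampleMean S.obs trtInd n ω)⁻¹ • sampleMean S.obs (fun x => trtInd x • f x) n ω := by
  have hc : ((S.treatedIdx n ω).card : ℝ) = ∑ i ∈ Finset.range n, trtInd (S.obs i ω) := by
    have := sum_treatedIdx S n ω (fun _ => (1 : ℝ))
    simpa using this
  rw [inv_sampleMean_smul, Sample.treatedMean, hc, sum_treatedIdx]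

lemma sum_controlIdx_exp (θ : EuclideanSpace ℝ (Fin p)) :
    ∑ i ∈ S.controlIdx n ω, Real.exp ⟪θ, S.Zstar i ω⟫ =
      ∑ i ∈ Finset.range n, Real.exp ⟪θ, cov (S.obs i ω)⟫ * ctlInd (S.obs i ω) := by
  rw [sum_controlIdx]
  exact Finset.sum_congr rfl fun i _ => mul_comm _ _

/-- The exponentially tilted sample mean over the control group. -/
noncomputable def ctlTilt (S : Sample Ω p) (n : ℕ) (ω : Ω) (θ : EuclideanSpace ℝ (Fin p))
    (f : Obs p → F) : F :=
  (sampleMean S.obs (fun x => Real.exp ⟪θ, cov x⟫ * ctlInd x) n ω)⁻¹ •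
    sampleMean S.obs (fun x => Real.exp ⟪θ, cov x⟫ • (ctlInd x • f x)) n ω

lemma ctlTilt_eq (θ : EuclideanSpace ℝ (Fin p)) (f : Obs p → F) :
    ctlTilt S n ω θ f = (∑ i ∈ S.controlIdx n ω, Real.exp ⟪θ, S.Zstar i ω⟫)⁻¹ •
      ∑ i ∈ S.controlIdx n ω, Real.exp ⟪θ, S.Zstar i ω⟫ • f (S.obs i ω) := by
  rw [ctlTilt, inv_sampleMean_smul, sum_controlIdx_exp, sum_controlIdx]
  congr 1
  refine Finset.sum_congr rfl fun i _ => smul_comm _ _ _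

lemma attEst_eq (θ : EuclideanSpace ℝ (Fin p)) :
    S.attEst n ω θ = S.treatedMean n ω S.Y - ctlTilt S n ω θ out := by
  rw [Sample.attEst, ctlTilt_eq, smul_eq_mul, Finset.mul_sum]
  congr 1
  refine Finset.sum_congr rfl fun i _ => ?_
  rw [Sample.weight, div_eq_inv_mul, mul_assoc]
  rfl

end Sums

namespace Model

variable {Ω : Type*} [MeasurableSpace Ω] {p : ℕ}
  {μ : Measure Ω} [IsProbabilityMeasure μ] {S : Sample Ω p} {α₀ : ℝ}
  {θ₀ : EuclideanSpace ℝ (Fin p)} {F : Type*} [NormedAddCommGroup F] [NormedSpace ℝ F]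

lemma measurable_obs (h : Model S μ α₀ θ₀) (i : ℕ) : Measurable (S.obs i) :=
  (h.measurable_data i).prodMk (h.herr i)

lemma isRandomSample_obs (h : Model S μ α₀ θ₀) : IsRandomSample S.obs μ := by
  have hg : Measurable fun x : Bool × EuclideanSpace ℝ (Fin p) × ℝ × ℝ =>
      (x.1, x.2.1, if x.1 then x.2.2.2 else x.2.2.1) := by
    refine measurable_fst.prodMk (measurable_snd.fst.prodMk ?_)
    exact Measurable.ite (measurable_fst (measurableSet_singleton true)) measurable_snd.snd.snd
      measurable_snd.snd.fst
  refine ⟨h.measurable_obs, ?_, fun i => ?_⟩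
  · exact iIndepFun_prodMk_of_indepFun h.measurable_data h.herr
      (h.hindep.comp (fun _ => _) fun _ => hg) h.herr_indep h.herr_data
  · have hi : ∀ i, IndepFun (fun ω => (S.T i ω, S.Z i ω, S.Y i ω)) (S.err i) μ := fun i =>
      h.herr_data.comp (measurable_pi_apply i) (measurable_pi_apply i)
    exact ((h.hident i).comp hg).prodMk (h.herr_ident i) (hi i) (hi 0)

lemma ctlInd_smul (f : Ω → F) : (fun ω => ctlInd (S.obs 0 ω) • f ω) =
    (S.T 0 ⁻¹' {false}).indicator f := by
  ext ω
  cases hT : S.T 0 ω <;> simp [ctlInd, Sample.obs, hT]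

lemma trtInd_smul (f : Ω → F) : (fun ω => trtInd (S.obs 0 ω) • f ω) =
    (S.T 0 ⁻¹' {true}).indicator f := by
  ext ω
  cases hT : S.T 0 ω <;> simp [trtInd, Sample.obs, hT]

lemma integral_ctlInd_smul (h : Model S μ α₀ θ₀) (f : Ω → F) :
    ∫ ω, ctlInd (S.obs 0 ω) • f ω ∂μ = μ.real (S.T 0 ⁻¹' {false}) • ∫ ω, f ω ∂(S.ctl μ) := by
  rw [ctlInd_smul]
  exact integral_indicator_cond (h.measurableSet_treatment false) (h.measure_ne_zero false)

lemma integral_trtInd_smul (h : Model S μ α₀ θ₀) (f : Ω → F) :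
    ∫ ω, trtInd (S.obs 0 ω) • f ω ∂μ = μ.real (S.T 0 ⁻¹' {true}) • ∫ ω, f ω ∂(S.trt μ) := by
  rw [trtInd_smul]
  exact integral_indicator_cond (h.measurableSet_treatment true) (h.measure_ne_zero true)

lemma integrable_ctlInd_smul (h : Model S μ α₀ θ₀) {f : Ω → F} (hf : Integrable f (S.ctl μ)) :
    Integrable (fun ω => ctlInd (S.obs 0 ω) • f ω) μ := by
  rw [ctlInd_smul]
  exact integrable_indicator_cond (h.measurableSet_treatment false) (h.measure_ne_zero false) hf

lemma integrable_trtInd_smul (h : Model S μ α₀ θ₀) {f : Ω → F} (hf : Integrable f (S.trt μ)) :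
    Integrable (fun ω => trtInd (S.obs 0 ω) • f ω) μ := by
  rw [trtInd_smul]
  exact integrable_indicator_cond (h.measurableSet_treatment true) (h.measure_ne_zero true) hf

lemma memLp_ctlInd_smul (h : Model S μ α₀ θ₀) {f : Ω → F} (hf : MemLp f 2 (S.ctl μ)) :
    MemLp (fun ω => ctlInd (S.obs 0 ω) • f ω) 2 μ := by
  rw [ctlInd_smul]
  exact memLp_indicator_cond (h.measurableSet_treatment false) (h.measure_ne_zero false) hf

lemma memLp_trtInd_smul (h : Model S μ α₀ θ₀) {f : Ω → F} (hf : MemLp f 2 (S.trt μ)) :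
    MemLp (fun ω => trtInd (S.obs 0 ω) • f ω) 2 μ := by
  rw [trtInd_smul]
  exact memLp_indicator_cond (h.measurableSet_treatment true) (h.measure_ne_zero true) hf

lemma integral_exp_mul_ctlInd (h : Model S μ α₀ θ₀) (θ : EuclideanSpace ℝ (Fin p)) :
    ∫ ω, Real.exp ⟪θ, cov (S.obs 0 ω)⟫ * ctlInd (S.obs 0 ω) ∂μ =
      μ.real (S.T 0 ⁻¹' {false}) * ∫ ω, Real.exp ⟪θ, S.Zstar 0 ω⟫ ∂(S.ctl μ) := by
  rw [← smul_eq_mul (a := μ.real _), ← h.integral_ctlInd_smul]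
  exact integral_congr_ae (Eventually.of_forall fun ω => mul_comm _ _)

lemma integral_trtInd (h : Model S μ α₀ θ₀) :
    ∫ ω, trtInd (S.obs 0 ω) ∂μ = μ.real (S.T 0 ⁻¹' {true}) := by
  have := h.isProbabilityMeasure_trt
  simpa using h.integral_trtInd_smul (fun _ => (1 : ℝ))

/-- The tilted mean over the controls as a ratio of expectations over the whole population. -/
lemma tiltedMean_ctl_eq (h : Model S μ α₀ θ₀) (f : Ω → F) (θ : EuclideanSpace ℝ (Fin p)) :
    tiltedMean (S.ctl μ) (S.Zstar 0) θ f =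
      (∫ ω, Real.exp ⟪θ, cov (S.obs 0 ω)⟫ * ctlInd (S.obs 0 ω) ∂μ)⁻¹ •
        ∫ ω, Real.exp ⟪θ, cov (S.obs 0 ω)⟫ • (ctlInd (S.obs 0 ω) • f ω) ∂μ := by
  have e : ∫ ω, Real.exp ⟪θ, cov (S.obs 0 ω)⟫ • (ctlInd (S.obs 0 ω) • f ω) ∂μ =
      μ.real (S.T 0 ⁻¹' {false}) • ∫ ω, Real.exp ⟪θ, S.Zstar 0 ω⟫ • f ω ∂(S.ctl μ) := by
    rw [← h.integral_ctlInd_smul]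
    exact integral_congr_ae (Eventually.of_forall fun ω => smul_comm _ _ _)
  rw [h.integral_exp_mul_ctlInd, e, smul_smul, mul_inv, mul_right_comm,
    inv_mul_cancel₀ (h.measureReal_pos false).ne', one_mul, tiltedMean]

/-! ### Centred contributions of one subject -/

variable (S μ θ₀) in
/-- The mean of `exp (θ₀ᵀ Z*)` over the control population, counted as zero for treated subjects. -/
noncomputable def ctlScale : ℝ :=
  μ.real (S.T 0 ⁻¹' {false}) * ∫ ω, Real.exp ⟪θ₀, S.Zstar 0 ω⟫ ∂(S.ctl μ)

lemma ctlFactor_smul (x : F) (ω : Ω) : S.ctlFactor μ θ₀ ω • x =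
    (ctlScale μ S θ₀)⁻¹ • ((Real.exp ⟪θ₀, cov (S.obs 0 ω)⟫ * ctlInd (S.obs 0 ω)) • x) := by
  have : cov (S.obs 0 ω) = S.Zstar 0 ω := rfl
  cases hT : S.T 0 ω <;>
    simp [Sample.ctlFactor, ctlScale, ctlInd, Sample.obs, hT, smul_smul, div_eq_inv_mul, cov,
      Sample.Zstar]

lemma trtFactor_smul (x : F) (ω : Ω) : S.trtFactor μ ω • x =
    (μ.real (S.T 0 ⁻¹' {true}))⁻¹ • (trtInd (S.obs 0 ω) • x) := by
  cases hT : S.T 0 ω <;> simp [Sample.trtFactor, trtInd, Sample.obs, hT]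

lemma memLp_ctl_smul_sub (h : Model S μ α₀ θ₀) {f : Ω → F}
    (hf : MemLp (fun ω => Real.exp ⟪θ₀, S.Zstar 0 ω⟫ • f ω) 2 (S.ctl μ)) (m : F) :
    MemLp (fun ω => (Real.exp ⟪θ₀, cov (S.obs 0 ω)⟫ * ctlInd (S.obs 0 ω)) • (f ω - m)) 2 μ := by
  have h1 : MemLp (fun ω => Real.exp ⟪θ₀, S.Zstar 0 ω⟫ • m) 2 (S.ctl μ) := by
    refine (h.memLp_exp_Zstar.norm.const_mul ‖m‖).mono
      (h.memLp_exp_Zstar.aestronglyMeasurable.smul_const m) (Eventually.of_forall fun ω => ?_)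
    simp [norm_smul, mul_comm]
  refine (h.memLp_ctlInd_smul (hf.sub h1)).congr_norm ?_ (Eventually.of_forall fun ω => ?_)
  · refine (h.memLp_ctlInd_smul (hf.sub h1)).aestronglyMeasurable.congr
      (Eventually.of_forall fun ω => ?_)
    simp only [Pi.sub_apply, ← smul_sub, smul_smul]
    rw [mul_comm]; rfl
  · simp only [Pi.sub_apply, ← smul_sub, smul_smul]
    rw [mul_comm]; rfl

lemma memLp_trt_smul_sub (h : Model S μ α₀ θ₀) {f : Ω → F} (hf : MemLp f 2 (S.trt μ)) (m : F) :
    MemLp (fun ω => trtInd (S.obs 0 ω) • (f ω - m)) 2 μ := by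
  have := h.isProbabilityMeasure_trt
  exact h.memLp_trtInd_smul (hf.sub (memLp_const m))

lemma integral_ctl_smul_sub [CompleteSpace F] (h : Model S μ α₀ θ₀) {f : Ω → F}
    (hf : MemLp (fun ω => Real.exp ⟪θ₀, S.Zstar 0 ω⟫ • f ω) 2 (S.ctl μ)) :
    ∫ ω, (Real.exp ⟪θ₀, cov (S.obs 0 ω)⟫ * ctlInd (S.obs 0 ω)) •
      (f ω - tiltedMean (S.ctl μ) (S.Zstar 0) θ₀ f) ∂μ = 0 := by
  have := h.isProbabilityMeasure_ctl
  have hθ := interior_subset h.dom_self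
  have e := integral_exp_smul_sub_tiltedMean (V := f) (X := S.Zstar 0) (θ₀ := θ₀) hθ
    (hf.integrable one_le_two) (h.integral_exp_Zstar_pos hθ).ne'
  have e2 := h.integral_ctlInd_smul
    (fun ω => Real.exp ⟪θ₀, S.Zstar 0 ω⟫ • (f ω - tiltedMean (S.ctl μ) (S.Zstar 0) θ₀ f))
  rw [e, smul_zero] at e2
  rw [← e2]
  refine integral_congr_ae (Eventually.of_forall fun ω => ?_)
  simp only [smul_smul]
  rw [mul_comm]; rfl

lemma integral_trt_smul_sub [CompleteSpace F] (h : Model S μ α₀ θ₀) {f : Ω → F}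
    (hf : MemLp f 2 (S.trt μ)) :
    ∫ ω, trtInd (S.obs 0 ω) • (f ω - ∫ ω', f ω' ∂(S.trt μ)) ∂μ = 0 := by
  have := h.isProbabilityMeasure_trt
  rw [h.integral_trtInd_smul, integral_sub (hf.integrable one_le_two) (integrable_const _)]
  simp

end Model

end CEB

namespace CEB

open Obs

/-! ### Linearisation of ratios of sample means -/

section Ratio

variable {Ω O : Type*} [MeasurableSpace Ω] [MeasurableSpace O] {μ : Measure Ω}
  [IsProbabilityMeasure μ] {o : ℕ → Ω → O}

lemma sampleMean_smul_sub {F : Type*} [AddCommGroup F] [Module ℝ F] (o : ℕ → Ω → O) (w : O → ℝ)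
    (V : O → F) (m : F) (n : ℕ) (ω : Ω) :
    sampleMean o (fun x => w x • (V x - m)) n ω =
      sampleMean o (fun x => w x • V x) n ω - sampleMean o w n ω • m := by
  simp only [sampleMean, smul_sub, Finset.sum_sub_distrib, smul_eq_mul, mul_smul,
    ← Finset.sum_smul]

lemma sampleMean_const_smul {F : Type*} [AddCommGroup F] [Module ℝ F] (o : ℕ → Ω → O) (c : ℝ)
    (f : O → F) (n : ℕ) (ω : Ω) :
    sampleMean o (fun x => c • f x) n ω = c • sampleMean o f n ω := by
  simp only [sampleMean, ← Finset.smul_sum]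
  rw [smul_comm]

lemma sampleMean_add {F : Type*} [AddCommGroup F] [Module ℝ F] (o : ℕ → Ω → O) (f g : O → F)
    (n : ℕ) (ω : Ω) : sampleMean o (fun x => f x + g x) n ω =
      sampleMean o f n ω + sampleMean o g n ω := by
  simp only [sampleMean, Finset.sum_add_distrib, smul_add]

lemma sampleMean_sub {F : Type*} [AddCommGroup F] [Module ℝ F] (o : ℕ → Ω → O) (f g : O → F)
    (n : ℕ) (ω : Ω) : sampleMean o (fun x => f x - g x) n ω =
      sampleMean o f n ω - sampleMean o g n ω := by
  simp only [sampleMean, Finset.sum_sub_distrib, smul_sub]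

lemma sampleMean_clm {F G : Type*} [NormedAddCommGroup F] [NormedSpace ℝ F]
    [NormedAddCommGroup G] [NormedSpace ℝ G] (o : ℕ → Ω → O) (L : F →L[ℝ] G) (f : O → F)
    (n : ℕ) (ω : Ω) : sampleMean o (fun x => L (f x)) n ω = L (sampleMean o f n ω) := by
  simp only [sampleMean, map_smul, map_sum]

lemma IsRandomSample.bddInProb_real (ho : IsRandomSample o μ) {f : O → ℝ} (hf : Measurable f)
    (h2 : MemLp (fun ω => f (o 0 ω)) 2 μ) (h0 : ∫ ω, f (o 0 ω) ∂μ = 0) :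
    BddInProb μ fun (n : ℕ) ω => √(n : ℝ) • sampleMean o f n ω :=
  .of_tendstoInDistribution (ho.tendstoInDistribution_real hf h2 h0)

lemma IsRandomSample.bddInProb_euclidean {p : ℕ} (ho : IsRandomSample o μ)
    {f : O → EuclideanSpace ℝ (Fin p)} (hf : Measurable f)
    (h2 : MemLp (fun ω => f (o 0 ω)) 2 μ) (h0 : ∫ ω, f (o 0 ω) ∂μ = 0) :
    BddInProb μ fun (n : ℕ) ω => √(n : ℝ) • sampleMean o f n ω :=
  .of_tendstoInDistribution (ho.tendstoInDistribution_euclidean hf h2 h0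
    (C := Matrix.of fun i j => ∫ ω, f (o 0 ω) i * f (o 0 ω) j ∂μ) fun _ _ => rfl)

/-- A ratio of sample means is asymptotically linear: replacing the random denominator by its limit
costs a product of a factor tending to zero and a factor bounded in probability. -/
lemma IsRandomSample.tendstoInMeasure_sqrt_ratio {F : Type*} [NormedAddCommGroup F]
    [NormedSpace ℝ F] (ho : IsRandomSample o μ) {w : O → ℝ} (hw : Measurable w) (V : O → F)
    (hint : Integrable (fun ω => w (o 0 ω)) μ) (hs : ∫ ω, w (o 0 ω) ∂μ ≠ 0) (m : F)
    (hbdd : BddInProb μ fun (n : ℕ) ω => √(n : ℝ) • sampleMean o (fun x => w x • (V x - m)) n ω) :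
    TendstoInMeasure μ (fun (n : ℕ) ω => √(n : ℝ) •
      ((sampleMean o w n ω)⁻¹ • sampleMean o (fun x => w x • V x) n ω - m -
        sampleMean o (fun x => (∫ ω, w (o 0 ω) ∂μ)⁻¹ • (w x • (V x - m))) n ω)) atTop 0 := by
  refine hbdd.tendstoInMeasure_zero fun c hc => ?_
  set s := ∫ ω, w (o 0 ω) ∂μ
  have hev : ∀ᶠ x : ℝ in 𝓝 s, x ≠ 0 ∧ ‖x⁻¹ - s⁻¹‖ < c := by
    refine Filter.Eventually.and (isOpen_ne.mem_nhds hs) ?_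
    have h2 : Tendsto (fun x : ℝ => ‖x⁻¹ - s⁻¹‖) (𝓝 s) (𝓝 0) := by
      simpa using ((continuousAt_inv₀ hs).tendsto.sub_const s⁻¹).norm
    exact h2.eventually_lt_const hc
  obtain ⟨δ, hδ, hball⟩ := Metric.eventually_nhds_iff.mp hev
  refine (ho.eventuallyInProb_sampleMean hw hint hδ).mono (Eventually.of_forall fun n ω hω => ?_)
  obtain ⟨h1, h2⟩ := hball (by simpa [dist_eq_norm] using hω)
  have e : (sampleMean o w n ω)⁻¹ • sampleMean o (fun x => w x • V x) n ω - m -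
        sampleMean o (fun x => s⁻¹ • (w x • (V x - m))) n ω =
      ((sampleMean o w n ω)⁻¹ - s⁻¹) • sampleMean o (fun x => w x • (V x - m)) n ω := by
    rw [sampleMean_const_smul, sampleMean_smul_sub, sub_smul, smul_sub (sampleMean o w n ω)⁻¹,
      inv_smul_smul₀ h1]
  rw [e, smul_comm, norm_smul]
  exact mul_le_mul_of_nonneg_right h2.le (norm_nonneg _)

end Ratio

namespace Model

variable {Ω : Type*} [MeasurableSpace Ω] {p : ℕ}
  {μ : Measure Ω} [IsProbabilityMeasure μ] {S : Sample Ω p} {α₀ : ℝ}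
  {θ₀ : EuclideanSpace ℝ (Fin p)} {F : Type*} [NormedAddCommGroup F] [NormedSpace ℝ F]

/-! ### The influence functions -/

variable (S μ θ₀) in
/-- The influence function of the tilted mean of `f` over the controls. -/
noncomputable def ctlInfl (f : Obs p → F) (x : Obs p) : F :=
  (∫ ω, Real.exp ⟪θ₀, cov (S.obs 0 ω)⟫ * ctlInd (S.obs 0 ω) ∂μ)⁻¹ •
    ((Real.exp ⟪θ₀, cov x⟫ * ctlInd x) •
      (f x - tiltedMean (S.ctl μ) (S.Zstar 0) θ₀ (fun ω => f (S.obs 0 ω))))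

variable (S μ) in
/-- The influence function of the mean of `f` over the treated. -/
noncomputable def trtInfl (f : Obs p → F) (x : Obs p) : F :=
  (∫ ω, trtInd (S.obs 0 ω) ∂μ)⁻¹ • (trtInd x • (f x - ∫ ω, f (S.obs 0 ω) ∂(S.trt μ)))

variable (S μ θ₀) in
/-- `ψ` as a function of the observation. -/
noncomputable def psiObs (x : Obs p) : EuclideanSpace ℝ (Fin p) :=
  ctlInfl μ S θ₀ cov x - trtInfl μ S cov x

variable (S μ θ₀) in
/-- `η` as a function of the observation. -/
noncomputable def etaObs (x : Obs p) : ℝ := trtInfl μ S out x - ctlInfl μ S θ₀ out x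

variable (S μ θ₀) in
/-- `φ` as a function of the observation. -/
noncomputable def phiObs (x : Obs p) : ℝ :=
  etaObs μ S θ₀ x + ⟪S.gradA μ θ₀,
    Matrix.toEuclideanCLM (n := Fin p) (𝕜 := ℝ) (S.H μ θ₀)⁻¹ (psiObs μ S θ₀ x)⟫

lemma measurable_ctlInfl [MeasurableSpace F] [BorelSpace F] [SecondCountableTopology F]
    {f : Obs p → F} (hf : Measurable f) : Measurable (ctlInfl μ S θ₀ f) := by
  unfold ctlInfl; fun_prop

lemma measurable_trtInfl [MeasurableSpace F] [BorelSpace F] [SecondCountableTopology F]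
    {f : Obs p → F} (hf : Measurable f) : Measurable (trtInfl μ S f) := by
  unfold trtInfl; fun_prop

lemma measurable_psiObs : Measurable (psiObs μ S θ₀) :=
  (measurable_ctlInfl measurable_cov).sub (measurable_trtInfl measurable_cov)

lemma measurable_etaObs : Measurable (etaObs μ S θ₀) :=
  (measurable_trtInfl measurable_out).sub (measurable_ctlInfl measurable_out)

lemma measurable_phiObs : Measurable (phiObs μ S θ₀) := by
  have h1 := measurable_etaObs (μ := μ) (S := S) (θ₀ := θ₀)
  have h2 := measurable_psiObs (μ := μ) (S := S) (θ₀ := θ₀)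
  unfold phiObs
  fun_prop

lemma psi_eq (h : Model S μ α₀ θ₀) (ω : Ω) : S.psi μ θ₀ ω = psiObs μ S θ₀ (S.obs 0 ω) := by
  rw [Sample.psi, ctlFactor_smul, trtFactor_smul, psiObs, ctlInfl, trtInfl, h.integral_trtInd,
    h.integral_exp_mul_ctlInd]
  rfl

lemma eta_eq (h : Model S μ α₀ θ₀) (ω : Ω) : S.eta μ θ₀ ω = etaObs μ S θ₀ (S.obs 0 ω) := by
  have e := h.tiltedMean_Zstar_Y (interior_subset h.dom_self)
  rw [Sample.eta, ← smul_eq_mul, ← smul_eq_mul, ctlFactor_smul, trtFactor_smul, etaObs, ctlInfl,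
    trtInfl, h.integral_trtInd, h.integral_exp_mul_ctlInd, ← e]
  rfl

lemma phi_eq (h : Model S μ α₀ θ₀) (ω : Ω) : S.phi μ θ₀ ω = phiObs μ S θ₀ (S.obs 0 ω) := by
  rw [Sample.phi, h.eta_eq, h.psi_eq, phiObs, Matrix.inner_toEuclideanCLM]

lemma memLp_ctlInfl (h : Model S μ α₀ θ₀) {f : Obs p → F}
    (hf : MemLp (fun ω => Real.exp ⟪θ₀, S.Zstar 0 ω⟫ • f (S.obs 0 ω)) 2 (S.ctl μ)) :
    MemLp (fun ω => ctlInfl μ S θ₀ f (S.obs 0 ω)) 2 μ :=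
  (h.memLp_ctl_smul_sub hf _).const_smul _

lemma memLp_trtInfl (h : Model S μ α₀ θ₀) {f : Obs p → F}
    (hf : MemLp (fun ω => f (S.obs 0 ω)) 2 (S.trt μ)) :
    MemLp (fun ω => trtInfl μ S f (S.obs 0 ω)) 2 μ :=
  (h.memLp_trt_smul_sub hf _).const_smul _

lemma memLp_cov_ctl (h : Model S μ α₀ θ₀) :
    MemLp (fun ω => Real.exp ⟪θ₀, S.Zstar 0 ω⟫ • cov (S.obs 0 ω)) 2 (S.ctl μ) :=
  h.memLp_exp_smul_Zstar

lemma memLp_cov_trt (h : Model S μ α₀ θ₀) : MemLp (fun ω => cov (S.obs 0 ω)) 2 (S.trt μ) :=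
  h.memLp_Zstar_trt

lemma memLp_out_ctl (h : Model S μ α₀ θ₀) :
    MemLp (fun ω => Real.exp ⟪θ₀, S.Zstar 0 ω⟫ • out (S.obs 0 ω)) 2 (S.ctl μ) :=
  h.memLp_exp_Zstar_Y

lemma memLp_out_trt (h : Model S μ α₀ θ₀) : MemLp (fun ω => out (S.obs 0 ω)) 2 (S.trt μ) :=
  h.memLp_Y_trt

lemma memLp_psi (h : Model S μ α₀ θ₀) : MemLp (fun ω => psiObs μ S θ₀ (S.obs 0 ω)) 2 μ :=
  (h.memLp_ctlInfl h.memLp_cov_ctl).sub (h.memLp_trtInfl h.memLp_cov_trt)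

lemma memLp_eta (h : Model S μ α₀ θ₀) : MemLp (fun ω => etaObs μ S θ₀ (S.obs 0 ω)) 2 μ :=
  (h.memLp_trtInfl h.memLp_out_trt).sub (h.memLp_ctlInfl h.memLp_out_ctl)

lemma memLp_phi (h : Model S μ α₀ θ₀) : MemLp (fun ω => phiObs μ S θ₀ (S.obs 0 ω)) 2 μ :=
  h.memLp_eta.add (((innerSL ℝ (S.gradA μ θ₀)).comp
    (Matrix.toEuclideanCLM (n := Fin p) (𝕜 := ℝ) (S.H μ θ₀)⁻¹)).comp_memLp' h.memLp_psi)

lemma integral_ctlInfl [CompleteSpace F] (h : Model S μ α₀ θ₀) {f : Obs p → F}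
    (hf : MemLp (fun ω => Real.exp ⟪θ₀, S.Zstar 0 ω⟫ • f (S.obs 0 ω)) 2 (S.ctl μ)) :
    ∫ ω, ctlInfl μ S θ₀ f (S.obs 0 ω) ∂μ = 0 := by
  simp only [ctlInfl]
  rw [integral_smul, h.integral_ctl_smul_sub hf, smul_zero]

lemma integral_trtInfl [CompleteSpace F] (h : Model S μ α₀ θ₀) {f : Obs p → F}
    (hf : MemLp (fun ω => f (S.obs 0 ω)) 2 (S.trt μ)) :
    ∫ ω, trtInfl μ S f (S.obs 0 ω) ∂μ = 0 := by
  simp only [trtInfl]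
  rw [integral_smul, h.integral_trt_smul_sub hf, smul_zero]

lemma integral_psiObs (h : Model S μ α₀ θ₀) : ∫ ω, psiObs μ S θ₀ (S.obs 0 ω) ∂μ = 0 := by
  unfold psiObs
  rw [integral_sub ((h.memLp_ctlInfl h.memLp_cov_ctl).integrable one_le_two)
    ((h.memLp_trtInfl h.memLp_cov_trt).integrable one_le_two),
    h.integral_ctlInfl h.memLp_cov_ctl, h.integral_trtInfl h.memLp_cov_trt, sub_zero]

lemma integral_etaObs (h : Model S μ α₀ θ₀) : ∫ ω, etaObs μ S θ₀ (S.obs 0 ω) ∂μ = 0 := by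
  unfold etaObs
  rw [integral_sub ((h.memLp_trtInfl h.memLp_out_trt).integrable one_le_two)
    ((h.memLp_ctlInfl h.memLp_out_ctl).integrable one_le_two),
    h.integral_trtInfl h.memLp_out_trt, h.integral_ctlInfl h.memLp_out_ctl, sub_zero]

lemma integral_phiObs (h : Model S μ α₀ θ₀) : ∫ ω, phiObs μ S θ₀ (S.obs 0 ω) ∂μ = 0 := by
  have hψ := h.memLp_psi.integrable one_le_two
  set L := (innerSL ℝ (S.gradA μ θ₀)).comp
    (Matrix.toEuclideanCLM (n := Fin p) (𝕜 := ℝ) (S.H μ θ₀)⁻¹)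
  have e : ∀ x, phiObs μ S θ₀ x = etaObs μ S θ₀ x + L (psiObs μ S θ₀ x) := fun _ => rfl
  simp only [e]
  rw [integral_add (h.memLp_eta.integrable one_le_two) (L.integrable_comp hψ), h.integral_etaObs,
    L.integral_comp_comm hψ, h.integral_psiObs, map_zero, add_zero]

/-! ### Behaviour of the estimating equation at the true parameter -/

lemma integrable_exp_mul_ctlInd (h : Model S μ α₀ θ₀) {θ : EuclideanSpace ℝ (Fin p)}
    (hθ : θ ∈ S.expDomain μ) :
    Integrable (fun ω => Real.exp ⟪θ, cov (S.obs 0 ω)⟫ * ctlInd (S.obs 0 ω)) μ :=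
  (h.integrable_ctlInd_smul hθ).congr (Eventually.of_forall fun _ => mul_comm _ _)

lemma integrable_trtInd (h : Model S μ α₀ θ₀) : Integrable (fun ω => trtInd (S.obs 0 ω)) μ := by
  have := h.isProbabilityMeasure_trt
  simpa using h.integrable_trtInd_smul (integrable_const (1 : ℝ))

lemma integral_exp_mul_ctlInd_pos (h : Model S μ α₀ θ₀) {θ : EuclideanSpace ℝ (Fin p)}
    (hθ : θ ∈ S.expDomain μ) :
    0 < ∫ ω, Real.exp ⟪θ, cov (S.obs 0 ω)⟫ * ctlInd (S.obs 0 ω) ∂μ := by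
  rw [h.integral_exp_mul_ctlInd]
  exact mul_pos (h.measureReal_pos false) (h.integral_exp_Zstar_pos hθ)

lemma integral_trtInd_pos (h : Model S μ α₀ θ₀) : 0 < ∫ ω, trtInd (S.obs 0 ω) ∂μ := by
  rw [h.integral_trtInd]
  exact h.measureReal_pos true

lemma tendstoInMeasure_sqrt_ctlTilt (h : Model S μ α₀ θ₀) {f : Obs p → F}
    (hbdd : BddInProb μ fun (n : ℕ) ω => √(n : ℝ) • sampleMean S.obs (fun x =>
      (Real.exp ⟪θ₀, cov x⟫ * ctlInd x) •
        (f x - tiltedMean (S.ctl μ) (S.Zstar 0) θ₀ (fun ω => f (S.obs 0 ω)))) n ω) :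
    TendstoInMeasure μ (fun (n : ℕ) ω => √(n : ℝ) • (ctlTilt S n ω θ₀ f -
      tiltedMean (S.ctl μ) (S.Zstar 0) θ₀ (fun ω => f (S.obs 0 ω)) -
        sampleMean S.obs (ctlInfl μ S θ₀ f) n ω)) atTop 0 := by
  have hθ := interior_subset h.dom_self
  have := h.isRandomSample_obs.tendstoInMeasure_sqrt_ratio
    (w := fun x => Real.exp ⟪θ₀, cov x⟫ * ctlInd x) (by fun_prop) f
    (h.integrable_exp_mul_ctlInd hθ) (h.integral_exp_mul_ctlInd_pos hθ).ne' _ hbdd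
  refine this.congr (fun n => Eventually.of_forall fun ω => ?_) (ae_eq_refl _)
  have e : ctlInfl μ S θ₀ f = fun x => (∫ ω, Real.exp ⟪θ₀, cov (S.obs 0 ω)⟫ *
      ctlInd (S.obs 0 ω) ∂μ)⁻¹ • ((Real.exp ⟪θ₀, cov x⟫ * ctlInd x) •
        (f x - tiltedMean (S.ctl μ) (S.Zstar 0) θ₀ (fun ω => f (S.obs 0 ω)))) := rfl
  rw [e]
  simp only [ctlTilt, mul_smul]

lemma tendstoInMeasure_sqrt_treatedMean (h : Model S μ α₀ θ₀) {f : Obs p → F}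
    (hbdd : BddInProb μ fun (n : ℕ) ω => √(n : ℝ) • sampleMean S.obs (fun x =>
      trtInd x • (f x - ∫ ω, f (S.obs 0 ω) ∂(S.trt μ))) n ω) :
    TendstoInMeasure μ (fun (n : ℕ) ω => √(n : ℝ) •
      (S.treatedMean n ω (fun i ω => f (S.obs i ω)) - ∫ ω, f (S.obs 0 ω) ∂(S.trt μ) -
        sampleMean S.obs (trtInfl μ S f) n ω)) atTop 0 := by
  have := h.isRandomSample_obs.tendstoInMeasure_sqrt_ratio measurable_trtInd f
    h.integrable_trtInd h.integral_trtInd_pos.ne' _ hbdd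
  refine this.congr (fun n => Eventually.of_forall fun ω => ?_) (ae_eq_refl _)
  beta_reduce
  rw [treatedMean_eq]
  rfl

end Model

end CEB

namespace CEB

open Obs

/-! ### Separation of the minimiser -/

section Basic

variable {Ω : Type*} {p : ℕ} (S : Sample Ω p)

lemma sampleMean_mono {O : Type*} (o : ℕ → Ω → O) {f g : O → ℝ} (hfg : ∀ x, f x ≤ g x) (n : ℕ)
    (ω : Ω) : sampleMean o f n ω ≤ sampleMean o g n ω :=
  mul_le_mul_of_nonneg_left (Finset.sum_le_sum fun _ _ => hfg _) (by positivity)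

lemma sampleMean_mul_const {O : Type*} (o : ℕ → Ω → O) (f : O → ℝ) (c : ℝ) (n : ℕ)
    (ω : Ω) : sampleMean o (fun x => f x * c) n ω = sampleMean o f n ω * c := by
  simp only [sampleMean, smul_eq_mul, ← Finset.sum_mul, mul_assoc]

lemma ctlInd_nonneg (x : Obs p) : 0 ≤ ctlInd x := by
  unfold ctlInd; split_ifs <;> norm_num

/-- The sum of `exp (θᵀ Z*)` over the controls, divided by the total sample size. -/
noncomputable def ctlMean (n : ℕ) (ω : Ω) (θ : EuclideanSpace ℝ (Fin p)) : ℝ :=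
  sampleMean S.obs (fun x => Real.exp ⟪θ, cov x⟫ * ctlInd x) n ω

lemma loss_eq {n : ℕ} (hn : 0 < n) (ω : Ω) {θ : EuclideanSpace ℝ (Fin p)}
    (h : 0 < ctlMean S n ω θ) : S.loss n ω θ =
      Real.log n + Real.log (ctlMean S n ω θ) - ⟪θ, S.treatedMean n ω S.Zstar⟫ := by
  have hn' : (n : ℝ) ≠ 0 := Nat.cast_ne_zero.mpr hn.ne'
  rw [Sample.loss, ← Real.log_mul hn' h.ne', sum_controlIdx_exp, ctlMean, sampleMean, smul_eq_mul,
    mul_inv_cancel_left₀ hn']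

/-- The corrected loss function. -/
noncomputable def correctedLoss [MeasurableSpace Ω] (μ : Measure Ω) (n : ℕ) (ω : Ω)
    (θ : EuclideanSpace ℝ (Fin p)) : ℝ :=
  S.loss n ω θ - Real.log (S.M μ θ)

end Basic

namespace Model

variable {Ω : Type*} [MeasurableSpace Ω] {p : ℕ}
  {μ : Measure Ω} [IsProbabilityMeasure μ] {S : Sample Ω p} {α₀ : ℝ}
  {θ₀ : EuclideanSpace ℝ (Fin p)}

lemma measurable_ctlMean (h : Model S μ α₀ θ₀) (n : ℕ) (θ : EuclideanSpace ℝ (Fin p)) :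
    Measurable fun ω => ctlMean S n ω θ :=
  h.isRandomSample_obs.measurable_sampleMean (by fun_prop) n

lemma ae_tendsto_ctlMean (h : Model S μ α₀ θ₀) {θ : EuclideanSpace ℝ (Fin p)}
    (hθ : θ ∈ S.expDomain μ) : ∀ᵐ ω ∂μ, Tendsto (fun n => ctlMean S n ω θ) atTop
      (𝓝 (∫ ω, Real.exp ⟪θ, cov (S.obs 0 ω)⟫ * ctlInd (S.obs 0 ω) ∂μ)) :=
  h.isRandomSample_obs.ae_tendsto_sampleMean (by fun_prop) (h.integrable_exp_mul_ctlInd hθ)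

section TreatedMean

variable {F : Type*} [NormedAddCommGroup F] [NormedSpace ℝ F] [CompleteSpace F]
    [MeasurableSpace F] [BorelSpace F] [SecondCountableTopology F]

lemma measurable_treatedMean (h : Model S μ α₀ θ₀) {f : Obs p → F} (hf : Measurable f) (n : ℕ) :
    Measurable fun ω => S.treatedMean n ω (fun i ω => f (S.obs i ω)) := by
  simp only [treatedMean_eq]
  exact (h.isRandomSample_obs.measurable_sampleMean measurable_trtInd n).inv.smul
    (h.isRandomSample_obs.measurable_sampleMean (by fun_prop) n)

lemma ae_tendsto_treatedMean (h : Model S μ α₀ θ₀) {f : Obs p → F} (hf : Measurable f)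
    (hint : Integrable (fun ω => f (S.obs 0 ω)) (S.trt μ)) :
    ∀ᵐ ω ∂μ, Tendsto (fun n => S.treatedMean n ω (fun i ω => f (S.obs i ω))) atTop
      (𝓝 (∫ ω, f (S.obs 0 ω) ∂(S.trt μ))) := by
  have h1 := h.isRandomSample_obs.ae_tendsto_sampleMean measurable_trtInd h.integrable_trtInd
  have h2 := h.isRandomSample_obs.ae_tendsto_sampleMean (f := fun x => trtInd x • f x)
    (by fun_prop) (h.integrable_trtInd_smul hint)
  rw [h.integral_trtInd] at h1
  rw [h.integral_trtInd_smul] at h2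
  filter_upwards [h1, h2] with ω h1 h2
  have h3 := (h1.inv₀ (h.measureReal_pos true).ne').smul h2
  rw [inv_smul_smul₀ (h.measureReal_pos true).ne'] at h3
  simpa only [treatedMean_eq] using h3

end TreatedMean

lemma measurable_treatedMean_Zstar (h : Model S μ α₀ θ₀) (n : ℕ) :
    Measurable fun ω => S.treatedMean n ω S.Zstar :=
  h.measurable_treatedMean measurable_cov n

lemma ae_tendsto_treatedMean_Zstar (h : Model S μ α₀ θ₀) :
    ∀ᵐ ω ∂μ, Tendsto (fun n => S.treatedMean n ω S.Zstar) atTop (𝓝 (S.B μ θ₀)) := by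
  have := h.isProbabilityMeasure_trt
  rw [← h.integral_Zstar_trt]
  have hint : Integrable (fun ω => cov (S.obs 0 ω)) (S.trt μ) :=
    h.memLp_cov_trt.integrable one_le_two
  have := h.ae_tendsto_treatedMean measurable_cov hint
  exact this

/-- Strict convexity of the limiting loss: tilting by `θ₀` balances the covariates, so the
population loss exceeds its value at `θ₀` everywhere else. -/
lemma log_integral_exp_lt (h : Model S μ α₀ θ₀) {θ : EuclideanSpace ℝ (Fin p)}
    (hθ : θ ∈ S.expDomain μ) (hne : θ ≠ θ₀) :
    Real.log (∫ ω, Real.exp ⟪θ₀, S.Z 0 ω⟫ ∂(S.ctl μ)) + ⟪θ - θ₀, S.B μ θ₀⟫ <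
      Real.log (∫ ω, Real.exp ⟪θ, S.Z 0 ω⟫ ∂(S.ctl μ)) := by
  have hθ₀ := interior_subset h.dom_self
  have hs := h.integral_exp_Z_pos hθ₀
  set a := θ - θ₀ with ha
  set m := ⟪a, S.B μ θ₀⟫ with hm
  have i0 := h.integrable_exp_Z hθ₀
  have j1 := h.integrable_exp_mul_inner_Z a
  have e3 : ∫ ω, Real.exp ⟪θ₀, S.Z 0 ω⟫ * ⟪a, S.Z 0 ω⟫ ∂(S.ctl μ) =
      (∫ ω, Real.exp ⟪θ₀, S.Z 0 ω⟫ ∂(S.ctl μ)) * m := h.integral_exp_mul_inner_Z a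
  -- the gap is the mean of `exp (θ₀ᵀ Z) * (exp v - 1 - v)` with `v = aᵀ Z - m`
  have e4 : ∀ ω, Real.exp ⟪θ₀, S.Z 0 ω⟫ *
      (Real.exp (⟪a, S.Z 0 ω⟫ - m) - 1 - (⟪a, S.Z 0 ω⟫ - m)) =
      Real.exp (-m) * Real.exp ⟪θ, S.Z 0 ω⟫ - (1 - m) * Real.exp ⟪θ₀, S.Z 0 ω⟫ -
        Real.exp ⟪θ₀, S.Z 0 ω⟫ * ⟪a, S.Z 0 ω⟫ := fun ω => by
    have : θ = θ₀ + a := by rw [ha]; abel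
    rw [this, inner_add_left, Real.exp_add, sub_eq_add_neg ⟪a, S.Z 0 ω⟫ m, Real.exp_add]
    ring
  have i4 : Integrable (fun ω => Real.exp (-m) * Real.exp ⟪θ, S.Z 0 ω⟫ -
      (1 - m) * Real.exp ⟪θ₀, S.Z 0 ω⟫) (S.ctl μ) :=
    ((h.integrable_exp_Z hθ).const_mul _).sub (i0.const_mul _)
  have hnn : 0 ≤ᵐ[S.ctl μ] fun ω => Real.exp ⟪θ₀, S.Z 0 ω⟫ *
      (Real.exp (⟪a, S.Z 0 ω⟫ - m) - 1 - (⟪a, S.Z 0 ω⟫ - m)) :=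
    Eventually.of_forall fun ω => mul_nonneg (Real.exp_pos _).le (by
      linarith [Real.add_one_le_exp (⟪a, S.Z 0 ω⟫ - m)])
  have hint : Integrable (fun ω => Real.exp ⟪θ₀, S.Z 0 ω⟫ *
      (Real.exp (⟪a, S.Z 0 ω⟫ - m) - 1 - (⟪a, S.Z 0 ω⟫ - m))) (S.ctl μ) :=
    (i4.sub j1).congr (Eventually.of_forall fun ω => (e4 ω).symm)
  have hpos : 0 < ∫ ω, Real.exp ⟪θ₀, S.Z 0 ω⟫ *
      (Real.exp (⟪a, S.Z 0 ω⟫ - m) - 1 - (⟪a, S.Z 0 ω⟫ - m)) ∂(S.ctl μ) := by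
    refine (integral_nonneg_of_ae hnn).lt_of_ne fun h0 => hne (sub_eq_zero.mp ?_)
    refine h.eq_zero_of_ae_ctl (c := m) ?_
    filter_upwards [(integral_eq_zero_iff_of_nonneg_ae hnn hint).mp h0.symm] with ω hω
    by_contra hc
    have h1 := Real.add_one_lt_exp (sub_ne_zero.mpr hc)
    have h2 : Real.exp (⟪a, S.Z 0 ω⟫ - m) - 1 - (⟪a, S.Z 0 ω⟫ - m) = 0 := by
      simpa [(Real.exp_pos _).ne'] using hω
    linarith
  simp_rw [e4] at hpos
  rw [integral_sub i4 j1, integral_sub ((h.integrable_exp_Z hθ).const_mul _) (i0.const_mul _),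
    integral_const_mul, integral_const_mul, e3] at hpos
  have h5 : (∫ ω, Real.exp ⟪θ₀, S.Z 0 ω⟫ ∂(S.ctl μ)) * Real.exp m <
      ∫ ω, Real.exp ⟪θ, S.Z 0 ω⟫ ∂(S.ctl μ) := by
    have h6 : ∫ ω, Real.exp ⟪θ₀, S.Z 0 ω⟫ ∂(S.ctl μ) <
        Real.exp (-m) * ∫ ω, Real.exp ⟪θ, S.Z 0 ω⟫ ∂(S.ctl μ) := by linarith
    have h7 := mul_lt_mul_of_pos_right h6 (Real.exp_pos m)
    rwa [mul_right_comm, ← Real.exp_add, neg_add_cancel, Real.exp_zero, one_mul] at h7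
  have h8 := Real.log_lt_log (by positivity) h5
  rwa [Real.log_mul hs.ne' (Real.exp_pos _).ne', Real.log_exp] at h8

/-- The corrected loss separates a neighbourhood of any other parameter from `θ₀`. The infimum over
a small ball is controlled by averaging the pointwise lower envelope of the exponentials. -/
lemma exists_nhds_correctedLoss_lt (h : Model S μ α₀ θ₀) {θ₁ : EuclideanSpace ℝ (Fin p)}
    (hθ₁ : θ₁ ∈ interior (S.expDomain μ)) (hne : θ₁ ≠ θ₀) :
    ∃ t ∈ 𝓝 θ₁, EventuallyInProb μ fun n ω => ∀ θ ∈ t,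
      correctedLoss S μ n ω θ₀ < correctedLoss S μ n ω θ := by
  have ho := h.isRandomSample_obs
  have hX : Measurable fun ω => cov (S.obs 0 ω) := measurable_cov.comp (ho.measurable 0)
  have hc : Measurable fun ω => ctlInd (S.obs 0 ω) := measurable_ctlInd.comp (ho.measurable 0)
  have hd₀ := interior_subset h.dom_self
  have hd₁ := interior_subset hθ₁
  set w : ℝ → ℝ := fun ρ => ∫ ω, Real.exp (⟪θ₁, cov (S.obs 0 ω)⟫ - ρ * ‖cov (S.obs 0 ω)‖) *
    ctlInd (S.obs 0 ω) ∂μ with hw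
  have hdom : ∀ ρ : ℝ, 0 ≤ ρ → ∀ ω, ‖Real.exp (⟪θ₁, cov (S.obs 0 ω)⟫ - ρ * ‖cov (S.obs 0 ω)‖) *
      ctlInd (S.obs 0 ω)‖ ≤ Real.exp ⟪θ₁, cov (S.obs 0 ω)⟫ * ctlInd (S.obs 0 ω) := fun ρ hρ ω => by
    rw [Real.norm_of_nonneg (mul_nonneg (Real.exp_pos _).le (ctlInd_nonneg _))]
    refine mul_le_mul_of_nonneg_right (Real.exp_le_exp.mpr ?_) (ctlInd_nonneg _)
    linarith [mul_nonneg hρ (norm_nonneg (cov (S.obs 0 ω)))]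
  have hint : ∀ ρ : ℝ, 0 ≤ ρ → Integrable (fun ω => Real.exp (⟪θ₁, cov (S.obs 0 ω)⟫ -
      ρ * ‖cov (S.obs 0 ω)‖) * ctlInd (S.obs 0 ω)) μ := fun ρ hρ =>
    (h.integrable_exp_mul_ctlInd hd₁).mono' (Measurable.aestronglyMeasurable (by fun_prop))
      (Eventually.of_forall (hdom ρ hρ))
  have hwlim : Tendsto w (𝓝[>] 0) (𝓝 (∫ ω, Real.exp ⟪θ₁, cov (S.obs 0 ω)⟫ *
      ctlInd (S.obs 0 ω) ∂μ)) := by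
    refine tendsto_integral_filter_of_dominated_convergence _
      (Eventually.of_forall fun ρ => Measurable.aestronglyMeasurable (by fun_prop))
      ?_ (h.integrable_exp_mul_ctlInd hd₁) (Eventually.of_forall fun ω => ?_)
    · filter_upwards [self_mem_nhdsWithin] with ρ hρ
      exact Eventually.of_forall (hdom ρ (le_of_lt hρ))
    · have : Continuous fun ρ : ℝ => Real.exp (⟪θ₁, cov (S.obs 0 ω)⟫ -
          ρ * ‖cov (S.obs 0 ω)‖) * ctlInd (S.obs 0 ω) := by fun_prop
      simpa using (this.tendsto 0).mono_left nhdsWithin_le_nhds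
  have hs₁ := h.integral_exp_mul_ctlInd_pos hd₁
  have hs₀ := h.integral_exp_mul_ctlInd_pos hd₀
  set s₁ := ∫ ω, Real.exp ⟪θ₁, cov (S.obs 0 ω)⟫ * ctlInd (S.obs 0 ω) ∂μ
  set s₀ := ∫ ω, Real.exp ⟪θ₀, cov (S.obs 0 ω)⟫ * ctlInd (S.obs 0 ω) ∂μ
  set Δ := Real.log s₁ - Real.log s₀ - ⟪θ₁ - θ₀, S.B μ θ₀⟫ - Real.log (S.M μ θ₁) +
    Real.log (S.M μ θ₀) with hΔdef
  have hΔ : 0 < Δ := by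
    have e : ∀ θ ∈ S.expDomain μ,
        Real.log (∫ ω, Real.exp ⟪θ, cov (S.obs 0 ω)⟫ * ctlInd (S.obs 0 ω) ∂μ) =
        Real.log (μ.real (S.T 0 ⁻¹' {false})) +
          (Real.log (∫ ω, Real.exp ⟪θ, S.Z 0 ω⟫ ∂(S.ctl μ)) + Real.log (S.M μ θ)) := by
      intro θ hθ
      rw [h.integral_exp_mul_ctlInd, Real.log_mul (h.measureReal_pos false).ne'
        (h.integral_exp_Zstar_pos hθ).ne', h.integral_exp_Zstar,
        Real.log_mul (h.integral_exp_Z_pos hθ).ne' (h.M_pos hθ).ne']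
    have := h.log_integral_exp_lt hd₁ hne
    rw [hΔdef]
    linarith [e θ₁ hd₁, e θ₀ hd₀]
  have hlim : Tendsto (fun ρ : ℝ => Real.log (w ρ) - Real.log s₀ - ⟪θ₁ - θ₀, S.B μ θ₀⟫ -
      ρ * ‖S.B μ θ₀‖ - (Real.log (S.M μ θ₁) + Δ / 2) + Real.log (S.M μ θ₀)) (𝓝[>] 0)
      (𝓝 (Δ / 2)) := by
    have h1 := hwlim.log hs₁.ne'
    have h2 : Tendsto (fun ρ : ℝ => ρ * ‖S.B μ θ₀‖) (𝓝[>] 0) (𝓝 0) := by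
      have : Continuous fun ρ : ℝ => ρ * ‖S.B μ θ₀‖ := by fun_prop
      simpa using (this.tendsto 0).mono_left nhdsWithin_le_nhds
    have h3 := ((((h1.sub_const (Real.log s₀)).sub_const ⟪θ₁ - θ₀, S.B μ θ₀⟫).sub h2).sub_const
      (Real.log (S.M μ θ₁) + Δ / 2)).add_const (Real.log (S.M μ θ₀))
    convert h3 using 2
    linarith
  obtain ⟨ρ, hρ, hwρ, hlρ⟩ : ∃ ρ : ℝ, 0 < ρ ∧ 0 < w ρ ∧ 0 < Real.log (w ρ) - Real.log s₀ -
      ⟪θ₁ - θ₀, S.B μ θ₀⟫ - ρ * ‖S.B μ θ₀‖ - (Real.log (S.M μ θ₁) + Δ / 2) +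
        Real.log (S.M μ θ₀) := by
    have := (hwlim.eventually_const_lt hs₁).and (hlim.eventually_const_lt (half_pos hΔ))
    obtain ⟨ρ, ⟨h1, h2⟩, hρ⟩ := (this.and self_mem_nhdsWithin).exists
    exact ⟨ρ, hρ, h1, h2⟩
  have hMc : ∀ᶠ θ in 𝓝 θ₁, Real.log (S.M μ θ) < Real.log (S.M μ θ₁) + Δ / 2 :=
    (h.hasFDerivAt_log_M hθ₁).continuousAt.eventually_lt_const (by linarith)
  refine ⟨{θ | ‖θ - θ₁‖ ≤ ρ ∧ Real.log (S.M μ θ) < Real.log (S.M μ θ₁) + Δ / 2},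
    Filter.Eventually.and ?_ hMc, ?_⟩
  · filter_upwards [Metric.closedBall_mem_nhds θ₁ hρ] with θ hθ
    simpa [dist_eq_norm] using hθ
  set W : ℕ → Ω → ℝ := fun n ω => sampleMean S.obs (fun x => Real.exp (⟪θ₁, cov x⟫ -
    ρ * ‖cov x‖) * ctlInd x) n ω with hW
  have hWm : ∀ n, Measurable (W n) := fun n => ho.measurable_sampleMean (by fun_prop) n
  have hlower : EventuallyInProb μ fun n ω => 0 < W n ω ∧ 0 < ctlMean S n ω θ₀ ∧
      0 < Real.log (W n ω) - Real.log (ctlMean S n ω θ₀) -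
        ⟪θ₁ - θ₀, S.treatedMean n ω S.Zstar⟫ - ρ * ‖S.treatedMean n ω S.Zstar‖ -
        (Real.log (S.M μ θ₁) + Δ / 2) + Real.log (S.M μ θ₀) := by
    refine EventuallyInProb.of_ae ?_ fun n => ?_
    · filter_upwards [ho.ae_tendsto_sampleMean (f := fun x => Real.exp (⟪θ₁, cov x⟫ -
        ρ * ‖cov x‖) * ctlInd x) (by fun_prop) (hint ρ hρ.le), h.ae_tendsto_ctlMean hd₀,
        h.ae_tendsto_treatedMean_Zstar] with ω h1 h2 h3
      have h4 : Tendsto (fun n => Real.log (W n ω) - Real.log (ctlMean S n ω θ₀) -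
        ⟪θ₁ - θ₀, S.treatedMean n ω S.Zstar⟫ - ρ * ‖S.treatedMean n ω S.Zstar‖ -
        (Real.log (S.M μ θ₁) + Δ / 2) + Real.log (S.M μ θ₀)) atTop _ :=
        (((((h1.log hwρ.ne').sub (h2.log hs₀.ne')).sub (tendsto_const_nhds.inner h3)).sub
          (h3.norm.const_mul ρ)).sub_const _).add_const _
      exact (h1.eventually_const_lt hwρ).and ((h2.eventually_const_lt hs₀).and
        (h4.eventually_const_lt hlρ))
    · have m1 := hWm n
      have m2 := h.measurable_ctlMean n θ₀
      have m3 := h.measurable_treatedMean_Zstar n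
      have m4 : Measurable fun ω => Real.log (W n ω) - Real.log (ctlMean S n ω θ₀) -
          ⟪θ₁ - θ₀, S.treatedMean n ω S.Zstar⟫ - ρ * ‖S.treatedMean n ω S.Zstar‖ -
          (Real.log (S.M μ θ₁) + Δ / 2) + Real.log (S.M μ θ₀) :=
        ((((m1.log.sub m2.log).sub (measurable_const.inner m3)).sub
          (m3.norm.const_mul ρ)).sub_const _).add_const _
      exact ((measurableSet_lt measurable_const m1).inter
        ((measurableSet_lt measurable_const m2).inter
          (measurableSet_lt measurable_const m4))).nullMeasurableSet
  refine hlower.mono ?_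
  filter_upwards [eventually_gt_atTop 0] with n hn ω ⟨h1, h2, h3⟩ θ ⟨ht1, ht2⟩
  have hWle : W n ω ≤ ctlMean S n ω θ := by
    refine sampleMean_mono _ (fun x => mul_le_mul_of_nonneg_right (Real.exp_le_exp.mpr ?_)
      (ctlInd_nonneg _)) n ω
    have := abs_le.mp ((abs_real_inner_le_norm (θ - θ₁) (cov x)).trans
      (mul_le_mul_of_nonneg_right ht1 (norm_nonneg _)))
    rw [inner_sub_left] at this
    linarith [this.1]
  have hlog := Real.log_le_log h1 hWle
  have hz := (real_inner_le_norm (θ - θ₁) (S.treatedMean n ω S.Zstar)).trans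
    (mul_le_mul_of_nonneg_right ht1 (norm_nonneg _))
  rw [correctedLoss, correctedLoss, loss_eq S hn ω h2, loss_eq S hn ω (h1.trans_le hWle)]
  rw [inner_sub_left] at hz h3
  linarith

/-- The corrected loss separates compact sets of other parameters from `θ₀`. -/
lemma eventuallyInProb_correctedLoss_lt_of_isCompact (h : Model S μ α₀ θ₀)
    {K : Set (EuclideanSpace ℝ (Fin p))} (hK : IsCompact K)
    (hKd : K ⊆ interior (S.expDomain μ)) (hne : θ₀ ∉ K) :
    EventuallyInProb μ fun n ω => ∀ θ ∈ K,
      correctedLoss S μ n ω θ₀ < correctedLoss S μ n ω θ := by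
  refine hK.induction_on (p := fun t => EventuallyInProb μ fun n ω => ∀ θ ∈ t,
      correctedLoss S μ n ω θ₀ < correctedLoss S μ n ω θ) ?_ ?_ ?_ ?_
  · exact .of_forall (Eventually.of_forall fun n ω θ hθ => hθ.elim)
  · exact fun s t hst ht => ht.mono (Eventually.of_forall fun n ω H θ hθ => H θ (hst hθ))
  · exact fun s t hs ht => (hs.and ht).mono (Eventually.of_forall fun n ω H θ hθ =>
      hθ.elim (H.1 θ) (H.2 θ))
  · intro θ₁ hθ₁
    obtain ⟨t, ht, hp⟩ := h.exists_nhds_correctedLoss_lt (hKd hθ₁) (ne_of_mem_of_not_mem hθ₁ hne)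
    exact ⟨t, mem_nhdsWithin_of_mem_nhds ht, hp⟩

end Model

end CEB

namespace CEB

open Obs

/-! ### Coercivity of the loss for bounded errors -/

/-- Up to `δ`, an essential supremum of a bounded random variable. -/
lemma exists_ae_le_and_measure_ne_zero {Ω : Type*} [MeasurableSpace Ω] {μ : Measure Ω}
    [IsProbabilityMeasure μ] {f : Ω → ℝ} {C δ : ℝ} (hC : ∀ᵐ ω ∂μ, |f ω| ≤ C) (hδ : 0 < δ) :
    ∃ a : ℝ, (∀ᵐ ω ∂μ, f ω ≤ a) ∧ μ {ω | a - δ < f ω} ≠ 0 := by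
  set A : Set ℝ := {t | ∀ᵐ ω ∂μ, f ω ≤ t} with hA
  have hne : A.Nonempty := ⟨C, hC.mono fun ω h => (abs_le.mp h).2⟩
  have hbdd : BddBelow A := by
    refine ⟨-C, fun t ht => ?_⟩
    obtain ⟨ω, h1, h2⟩ := (hC.and ht).exists
    exact (abs_le.mp h1).1.trans h2
  obtain ⟨a, ha, hlt⟩ := exists_lt_of_csInf_lt hne (lt_add_of_pos_right (sInf A) hδ)
  refine ⟨a, ha, fun h0 => ?_⟩
  have : a - δ ∈ A := by
    have h1 : ∀ᵐ ω ∂μ, ¬ a - δ < f ω := measure_eq_zero_iff_ae_notMem.mp h0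
    exact h1.mono fun ω h => not_lt.mp h
  linarith [csInf_le hbdd this]

namespace Model

variable {Ω : Type*} [MeasurableSpace Ω] {p : ℕ}
  {μ : Measure Ω} [IsProbabilityMeasure μ] {S : Sample Ω p} {α₀ : ℝ}
  {θ₀ : EuclideanSpace ℝ (Fin p)}

/-- In every direction some controls lie beyond the mean of the treated covariates. -/
lemma exists_measure_beyond_ne_zero (h : Model S μ α₀ θ₀) {u : EuclideanSpace ℝ (Fin p)}
    (hu : u ≠ 0) : ∃ δ : ℝ, 0 < δ ∧ ∃ K : ℝ, 0 ≤ K ∧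
      μ {ω | S.T 0 ω = false ∧ ⟪u, S.B μ θ₀⟫ + δ < ⟪u, S.Z 0 ω⟫ ∧ ‖S.Z 0 ω‖ ≤ K} ≠ 0 := by
  by_contra! H
  refine hu ?_
  have hθ₀ := interior_subset h.dom_self
  have hs := h.integral_exp_Z_pos hθ₀
  have i0 := h.integrable_exp_Z hθ₀
  set m := ⟪u, S.B μ θ₀⟫ with hm
  have h1 : ∀ᵐ ω ∂μ, ∀ k : ℕ, ¬ (S.T 0 ω = false ∧ m + 1 / ((k : ℝ) + 1) < ⟪u, S.Z 0 ω⟫ ∧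
      ‖S.Z 0 ω‖ ≤ k) :=
    ae_all_iff.mpr fun k =>
      measure_eq_zero_iff_ae_notMem.mp (H _ (by positivity) k (Nat.cast_nonneg k))
  have h2 : ∀ᵐ ω ∂(S.ctl μ), ⟪u, S.Z 0 ω⟫ ≤ m := by
    have h3 : ∀ᵐ ω ∂(S.ctl μ), S.T 0 ω = false :=
      ae_cond_of_forall_mem (h.measurableSet_treatment false) fun ω hω => hω
    filter_upwards [h3, (cond_absolutelyContinuous (μ := μ)).ae_le h1] with ω hT hk
    by_contra! hlt
    obtain ⟨k₁, hk₁⟩ := exists_nat_one_div_lt (sub_pos.mpr hlt)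
    obtain ⟨k₂, hk₂⟩ := exists_nat_ge ‖S.Z 0 ω‖
    refine hk (max k₁ k₂) ⟨hT, ?_, ?_⟩
    · have : 1 / (((max k₁ k₂ : ℕ) : ℝ) + 1) ≤ 1 / ((k₁ : ℝ) + 1) := by
        gcongr; exact le_max_left _ _
      linarith
    · exact hk₂.trans (by exact_mod_cast le_max_right k₁ k₂)
  have j1 := h.integrable_exp_mul_inner_Z u
  have e3 : ∫ ω, Real.exp ⟪θ₀, S.Z 0 ω⟫ * ⟪u, S.Z 0 ω⟫ ∂(S.ctl μ) =
      (∫ ω, Real.exp ⟪θ₀, S.Z 0 ω⟫ ∂(S.ctl μ)) * m := h.integral_exp_mul_inner_Z u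
  have hnn : 0 ≤ᵐ[S.ctl μ] fun ω => Real.exp ⟪θ₀, S.Z 0 ω⟫ * (m - ⟪u, S.Z 0 ω⟫) :=
    h2.mono fun ω hω => mul_nonneg (Real.exp_pos _).le (sub_nonneg.mpr hω)
  have e4 : ∀ ω, Real.exp ⟪θ₀, S.Z 0 ω⟫ * (m - ⟪u, S.Z 0 ω⟫) =
      Real.exp ⟪θ₀, S.Z 0 ω⟫ * m - Real.exp ⟪θ₀, S.Z 0 ω⟫ * ⟪u, S.Z 0 ω⟫ := fun ω => by ring
  have h0 : ∫ ω, Real.exp ⟪θ₀, S.Z 0 ω⟫ * (m - ⟪u, S.Z 0 ω⟫) ∂(S.ctl μ) = 0 := by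
    simp_rw [e4]
    rw [integral_sub (i0.mul_const m) j1, integral_mul_const, e3, sub_self]
  have hint : Integrable (fun ω => Real.exp ⟪θ₀, S.Z 0 ω⟫ * (m - ⟪u, S.Z 0 ω⟫)) (S.ctl μ) :=
    ((i0.mul_const m).sub j1).congr (Eventually.of_forall fun ω => (e4 ω).symm)
  refine h.eq_zero_of_ae_ctl (c := m) ?_
  filter_upwards [(integral_eq_zero_iff_of_nonneg_ae hnn hint).mp h0] with ω hω
  have : m - ⟪u, S.Z 0 ω⟫ = 0 := by simpa [(Real.exp_pos _).ne'] using hω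
  linarith

lemma M_pos_and_le (h : Model S μ α₀ θ₀) {θ : EuclideanSpace ℝ (Fin p)} {b : ℝ}
    (hb : ∀ᵐ ω ∂μ, ⟪θ, S.err 0 ω⟫ ≤ b) : 0 < S.M μ θ ∧ S.M μ θ ≤ Real.exp b := by
  have he := h.herr 0
  have hi : Integrable (fun ω => Real.exp ⟪θ, S.err 0 ω⟫) μ :=
    (integrable_const (Real.exp b)).mono' (Measurable.aestronglyMeasurable (by fun_prop))
      (hb.mono fun ω hω => by
        rw [Real.norm_of_nonneg (Real.exp_pos _).le]; exact Real.exp_le_exp.mpr hω)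
  refine ⟨integral_exp_pos hi, ?_⟩
  have := integral_mono_ae hi (integrable_const (Real.exp b))
    (hb.mono fun ω hω => Real.exp_le_exp.mpr hω)
  rwa [integral_const, probReal_univ, one_smul] at this

/-- For bounded errors the corrected loss grows linearly along all directions close to a given
one: the controls beyond the treated mean whose error nearly attains its supremum outweigh the
correction. -/
lemma exists_nhds_correctedLoss_lt_smul (h : Model S μ α₀ θ₀) {C : ℝ}
    (hC : ∀ᵐ ω ∂μ, ‖S.err 0 ω‖ ≤ C) {u₀ : EuclideanSpace ℝ (Fin p)} (hu₀ : ‖u₀‖ = 1) :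
    ∃ t ∈ 𝓝 u₀, ∃ R : ℝ, EventuallyInProb μ fun n ω => ∀ r : ℝ, R ≤ r → ∀ u ∈ t,
      correctedLoss S μ n ω θ₀ < correctedLoss S μ n ω (r • u) := by
  have ho := h.isRandomSample_obs
  have hd₀ := interior_subset h.dom_self
  have hC0 : 0 ≤ C := by
    obtain ⟨ω, hω⟩ := hC.exists
    exact (norm_nonneg _).trans hω
  obtain ⟨δ', hδ', K, hK, hdata⟩ := h.exists_measure_beyond_ne_zero (u := u₀)
    (by rw [← norm_ne_zero_iff, hu₀]; exact one_ne_zero)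
  obtain ⟨δ, hδ, rfl⟩ : ∃ δ : ℝ, 0 < δ ∧ δ' = 4 * δ := ⟨δ' / 4, by positivity, by ring⟩
  set m := ⟪u₀, S.B μ θ₀⟫ with hm
  have hbd : ∀ᵐ ω ∂μ, |⟪u₀, S.err 0 ω⟫| ≤ C := hC.mono fun ω hω =>
    (abs_real_inner_le_norm _ _).trans (by rwa [hu₀, one_mul])
  obtain ⟨a, ha, herr⟩ := exists_ae_le_and_measure_ne_zero hbd hδ
  -- the observations that make the exponential sum large
  set A : Set (Bool × EuclideanSpace ℝ (Fin p) × ℝ) :=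
    {x | x.1 = false ∧ m + 4 * δ < ⟪u₀, x.2.1⟫ ∧ ‖x.2.1‖ ≤ K} with hA
  set E : Set (EuclideanSpace ℝ (Fin p)) := {e | a - δ < ⟪u₀, e⟫ ∧ ‖e‖ ≤ C} with hE
  have hi : Measurable fun z : EuclideanSpace ℝ (Fin p) => ⟪u₀, z⟫ := by fun_prop
  have hAm : MeasurableSet A :=
    (measurable_fst (measurableSet_singleton false)).inter
      ((measurableSet_lt measurable_const (hi.comp measurable_snd.fst)).inter
        (measurableSet_le measurable_snd.fst.norm measurable_const))
  have hEm : MeasurableSet E :=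
    (measurableSet_lt measurable_const hi).inter (measurableSet_le measurable_norm measurable_const)
  set g : Obs p → ℝ := (A ×ˢ E).indicator 1 with hg
  have hgm : Measurable g := measurable_one.indicator (hAm.prod hEm)
  have hgint : Integrable (fun ω => g (S.obs 0 ω)) μ :=
    (integrable_const (1 : ℝ)).mono' (hgm.comp (h.measurable_obs 0)).aestronglyMeasurable
      (Eventually.of_forall fun ω => by
        simp only [hg, indicator]; split_ifs <;> simp)
  set q := ∫ ω, g (S.obs 0 ω) ∂μ with hq
  have hqpos : 0 < q := by
    have e1 : (fun ω => g (S.obs 0 ω)) = (S.obs 0 ⁻¹' (A ×ˢ E)).indicator 1 := rfl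
    have e2 : S.obs 0 ⁻¹' (A ×ˢ E) =
      (fun ω => (S.T 0 ω, S.Z 0 ω, S.Y 0 ω)) ⁻¹' A ∩ S.err 0 ⁻¹' E := rfl
    rw [hq, e1, integral_indicator_one (h.measurable_obs 0 (hAm.prod hEm)), e2]
    refine ENNReal.toReal_pos ?_ (measure_ne_top _ _)
    rw [h.indepFun_err.measure_inter_preimage_eq_mul _ _ hAm hEm]
    refine mul_ne_zero hdata fun h0 => herr ?_
    rw [measure_eq_zero_iff_ae_notMem] at h0 ⊢
    filter_upwards [h0, hC] with ω h1 h2 h3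
    exact h1 ⟨h3, h2⟩
  set κ := Real.log (∫ ω, Real.exp ⟪θ₀, cov (S.obs 0 ω)⟫ * ctlInd (S.obs 0 ω) ∂μ) -
    ⟪θ₀, S.B μ θ₀⟫ - Real.log (S.M μ θ₀) + 1 with hκ
  set N := K + 2 * C + ‖S.B μ θ₀‖ + 1 with hN
  have hNpos : 0 < N := by positivity
  refine ⟨{u | ‖u - u₀‖ ≤ δ / N}, ?_, max 0 ((κ - Real.log (q / 2)) / δ), ?_⟩
  · filter_upwards [Metric.closedBall_mem_nhds u₀ (div_pos hδ hNpos)] with u hu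
    simpa [dist_eq_norm] using hu
  set W : ℕ → Ω → ℝ := fun n ω => sampleMean S.obs g n ω with hW
  have hs₀ := h.integral_exp_mul_ctlInd_pos hd₀
  have hev : EventuallyInProb μ fun n ω => q / 2 < W n ω ∧ 0 < ctlMean S n ω θ₀ ∧
      ⟪u₀, S.treatedMean n ω S.Zstar⟫ < m + δ ∧ ‖S.treatedMean n ω S.Zstar‖ < ‖S.B μ θ₀‖ + 1 ∧
      Real.log (ctlMean S n ω θ₀) - ⟪θ₀, S.treatedMean n ω S.Zstar⟫ - Real.log (S.M μ θ₀) <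
        κ := by
    refine EventuallyInProb.of_ae ?_ fun n => ?_
    · filter_upwards [ho.ae_tendsto_sampleMean hgm hgint, h.ae_tendsto_ctlMean hd₀,
        h.ae_tendsto_treatedMean_Zstar] with ω h1 h2 h3
      have h4 : Tendsto (fun n => Real.log (ctlMean S n ω θ₀) -
        ⟪θ₀, S.treatedMean n ω S.Zstar⟫ - Real.log (S.M μ θ₀)) atTop (𝓝 (κ - 1)) := by
        have h5 : Tendsto (fun n => ⟪θ₀, S.treatedMean n ω S.Zstar⟫) atTop
            (𝓝 ⟪θ₀, S.B μ θ₀⟫) := tendsto_const_nhds.inner h3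
        have := ((h2.log hs₀.ne').sub h5).sub_const (Real.log (S.M μ θ₀))
        convert this using 2
        rw [hκ]; ring
      exact (h1.eventually_const_lt (half_lt_self hqpos)).and
        ((h2.eventually_const_lt hs₀).and
          (((tendsto_const_nhds.inner h3).eventually_lt_const (lt_add_of_pos_right m hδ)).and
            ((h3.norm.eventually_lt_const (lt_add_one _)).and
              (h4.eventually_lt_const (sub_one_lt κ)))))
    · have m1 : Measurable (W n) := ho.measurable_sampleMean hgm n
      have m2 := h.measurable_ctlMean n θ₀
      have m3 := h.measurable_treatedMean_Zstar n
      have m4 : Measurable fun ω => Real.log (ctlMean S n ω θ₀) -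
          ⟪θ₀, S.treatedMean n ω S.Zstar⟫ - Real.log (S.M μ θ₀) :=
        (m2.log.sub (measurable_const.inner m3)).sub_const _
      have m5 : Measurable fun ω => ⟪u₀, S.treatedMean n ω S.Zstar⟫ := measurable_const.inner m3
      exact ((measurableSet_lt measurable_const m1).inter
        ((measurableSet_lt measurable_const m2).inter
          ((measurableSet_lt m5 measurable_const).inter
            ((measurableSet_lt m3.norm measurable_const).inter
              (measurableSet_lt m4 measurable_const))))).nullMeasurableSet
  refine hev.mono ?_
  filter_upwards [eventually_gt_atTop 0] with n hn ω ⟨h1, h2, h3, h4, h5⟩ r hr u hu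
  have hr0 : 0 ≤ r := (le_max_left _ _).trans hr
  have hrδ : κ - Real.log (q / 2) ≤ r * δ :=
    (div_le_iff₀ hδ).mp ((le_max_right _ _).trans hr)
  set ν := δ / N with hν
  have hν0 : 0 ≤ ν := by positivity
  have hνN : ν * N = δ := div_mul_cancel₀ δ hNpos.ne'
  have hdir : ∀ x : EuclideanSpace ℝ (Fin p), |⟪u, x⟫ - ⟪u₀, x⟫| ≤ ν * ‖x‖ := fun x => by
    rw [← inner_sub_left]
    exact (abs_real_inner_le_norm _ _).trans (mul_le_mul_of_nonneg_right hu (norm_nonneg _))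
  -- lower bound for the exponential sum
  have hlow : W n ω * Real.exp (r * (m + a + 3 * δ - ν * (K + C))) ≤ ctlMean S n ω (r • u) := by
    rw [hW, ← sampleMean_mul_const]
    refine sampleMean_mono _ (fun x => ?_) n ω
    by_cases hx : x ∈ A ×ˢ E
    · obtain ⟨⟨hx1, hx2, hx3⟩, hx4, hx5⟩ := hx
      have hx0 : x ∈ A ×ˢ E := ⟨⟨hx1, hx2, hx3⟩, hx4, hx5⟩
      have e1 : g x = 1 := indicator_of_mem hx0 1
      have e2 : ctlInd x = 1 := by simp [ctlInd, hx1]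
      rw [e1, e2, one_mul, mul_one, real_inner_smul_left]
      refine Real.exp_le_exp.mpr (mul_le_mul_of_nonneg_left ?_ hr0)
      have h6 := (abs_le.mp (hdir (cov x))).1
      have h7 : ν * ‖cov x‖ ≤ ν * (K + C) :=
        mul_le_mul_of_nonneg_left ((norm_add_le _ _).trans (add_le_add hx3 hx5)) hν0
      have h8 : ⟪u₀, cov x⟫ = ⟪u₀, x.1.2.1⟫ + ⟪u₀, x.2⟫ := inner_add_right _ _ _
      linarith
    · have e1 : g x = 0 := indicator_of_notMem hx 1
      rw [e1, zero_mul]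
      exact mul_nonneg (Real.exp_pos _).le (ctlInd_nonneg _)
  -- upper bound for the correction
  obtain ⟨hM0, hM1⟩ := h.M_pos_and_le (θ := r • u) (b := r * (a + ν * C)) (by
    filter_upwards [ha, hC] with ω' h6 h7
    rw [real_inner_smul_left]
    refine mul_le_mul_of_nonneg_left ?_ hr0
    have h8 := (abs_le.mp (hdir (S.err 0 ω'))).2
    have h9 := mul_le_mul_of_nonneg_left h7 hν0
    linarith)
  have hlogM : Real.log (S.M μ (r • u)) ≤ r * (a + ν * C) := by
    have := Real.log_le_log hM0 hM1
    rwa [Real.log_exp] at this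
  have hq2 : 0 < q / 2 := half_pos hqpos
  have hpos : 0 < q / 2 * Real.exp (r * (m + a + 3 * δ - ν * (K + C))) := by positivity
  have hlow' : q / 2 * Real.exp (r * (m + a + 3 * δ - ν * (K + C))) ≤ ctlMean S n ω (r • u) :=
    (mul_le_mul_of_nonneg_right h1.le (Real.exp_pos _).le).trans hlow
  have hlog := Real.log_le_log hpos hlow'
  rw [Real.log_mul hq2.ne' (Real.exp_pos _).ne', Real.log_exp] at hlog
  -- upper bound for the balancing term
  have hz : ⟪r • u, S.treatedMean n ω S.Zstar⟫ ≤ r * (m + δ + ν * (‖S.B μ θ₀‖ + 1)) := by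
    rw [real_inner_smul_left]
    refine mul_le_mul_of_nonneg_left ?_ hr0
    have h6 := (abs_le.mp (hdir (S.treatedMean n ω S.Zstar))).2
    have h7 := mul_le_mul_of_nonneg_left h4.le hν0
    linarith
  rw [correctedLoss, correctedLoss, loss_eq S hn ω h2, loss_eq S hn ω (hpos.trans_le hlow')]
  have key : r * (m + a + 3 * δ - ν * (K + C)) - r * (m + δ + ν * (‖S.B μ θ₀‖ + 1)) -
      r * (a + ν * C) = r * δ := by
    have : ν * K + 2 * (ν * C) + ν * (‖S.B μ θ₀‖ + 1) = δ := by rw [← hνN, hN]; ring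
    linear_combination (-r) * this
  linarith

/-- For bounded errors the minimisation may be restricted to a fixed ball. -/
lemma exists_eventuallyInProb_correctedLoss_lt_of_norm_le (h : Model S μ α₀ θ₀) {C : ℝ}
    (hC : ∀ᵐ ω ∂μ, ‖S.err 0 ω‖ ≤ C) : ∃ R : ℝ, EventuallyInProb μ fun n ω =>
      ∀ θ : EuclideanSpace ℝ (Fin p), R ≤ ‖θ‖ →
        correctedLoss S μ n ω θ₀ < correctedLoss S μ n ω θ := by
  obtain ⟨R, hR⟩ : ∃ R : ℝ, EventuallyInProb μ fun n ω => ∀ r : ℝ, R ≤ r →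
      ∀ u ∈ Metric.sphere (0 : EuclideanSpace ℝ (Fin p)) 1,
        correctedLoss S μ n ω θ₀ < correctedLoss S μ n ω (r • u) := by
    refine (isCompact_sphere (0 : EuclideanSpace ℝ (Fin p)) 1).induction_on
      (p := fun t => ∃ R : ℝ, EventuallyInProb μ fun n ω => ∀ r : ℝ, R ≤ r → ∀ u ∈ t,
        correctedLoss S μ n ω θ₀ < correctedLoss S μ n ω (r • u)) ?_ ?_ ?_ ?_
    · exact ⟨0, .of_forall (Eventually.of_forall fun n ω r hr u hu => hu.elim)⟩
    · rintro s t hst ⟨R, hR⟩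
      exact ⟨R, hR.mono (Eventually.of_forall fun n ω H r hr u hu => H r hr u (hst hu))⟩
    · rintro s t ⟨R₁, h₁⟩ ⟨R₂, h₂⟩
      exact ⟨max R₁ R₂, (h₁.and h₂).mono (Eventually.of_forall fun n ω H r hr u hu =>
        hu.elim (H.1 r ((le_max_left _ _).trans hr) u) (H.2 r ((le_max_right _ _).trans hr) u))⟩
    · intro u hu
      obtain ⟨t, ht, R, hp⟩ := h.exists_nhds_correctedLoss_lt_smul hC (by simpa using hu)
      exact ⟨t, mem_nhdsWithin_of_mem_nhds ht, R, hp⟩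
  refine ⟨max R 1, hR.mono (Eventually.of_forall fun n ω H θ hθ => ?_)⟩
  have h1 : 0 < ‖θ‖ := zero_lt_one.trans_le ((le_max_right _ _).trans hθ)
  have := H ‖θ‖ ((le_max_left _ _).trans hθ) (‖θ‖⁻¹ • θ) (by
    simp [norm_smul, inv_mul_cancel₀ h1.ne'])
  rwa [smul_inv_smul₀ h1.ne'] at this

/-! ### Existence and consistency -/

/-- With probability tending to one the corrected loss on `Θ` exceeds its value at `θ₀` outside
any given ball around `θ₀`. -/
lemma eventuallyInProb_correctedLoss_lt (h : Model S μ α₀ θ₀)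
    {Θ : Set (EuclideanSpace ℝ (Fin p))}
    (hΘ : IsCompact Θ ∨ (IsClosed Θ ∧ ∃ C : ℝ, ∀ᵐ ω ∂μ, ‖S.err 0 ω‖ ≤ C))
    (hd : Θ ⊆ interior (S.expDomain μ)) {ε : ℝ} (hε : 0 < ε) :
    EventuallyInProb μ fun n ω => ∀ θ ∈ Θ, ε ≤ ‖θ - θ₀‖ →
      correctedLoss S μ n ω θ₀ < correctedLoss S μ n ω θ := by
  have hcl : IsClosed {θ : EuclideanSpace ℝ (Fin p) | ε ≤ ‖θ - θ₀‖} :=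
    isClosed_le continuous_const (by fun_prop)
  have hne : θ₀ ∉ {θ : EuclideanSpace ℝ (Fin p) | ε ≤ ‖θ - θ₀‖} := by
    simpa using hε
  rcases hΘ with hcomp | ⟨hclosed, C, hC⟩
  · have := h.eventuallyInProb_correctedLoss_lt_of_isCompact (hcomp.inter_right hcl)
      (inter_subset_left.trans hd) fun hmem => hne hmem.2
    exact this.mono (Eventually.of_forall fun n ω H θ hθ hθε => H θ ⟨hθ, hθε⟩)
  · obtain ⟨R, hR⟩ := h.exists_eventuallyInProb_correctedLoss_lt_of_norm_le hC
    have hK : IsCompact (Metric.closedBall (0 : EuclideanSpace ℝ (Fin p)) R ∩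
        (Θ ∩ {θ | ε ≤ ‖θ - θ₀‖})) :=
      (isCompact_closedBall _ _).inter_right (hclosed.inter hcl)
    have := h.eventuallyInProb_correctedLoss_lt_of_isCompact hK
      ((inter_subset_right.trans inter_subset_left).trans hd) fun hmem => hne hmem.2.2
    refine (hR.and this).mono (Eventually.of_forall fun n ω H θ hθ hθε => ?_)
    rcases le_total R ‖θ‖ with h1 | h1
    · exact H.1 θ h1
    · exact H.2 θ ⟨by simpa using h1, hθ, hθε⟩

lemma continuousOn_correctedLoss (h : Model S μ α₀ θ₀) (n : ℕ) (ω : Ω) :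
    ContinuousOn (correctedLoss S μ n ω) (interior (S.expDomain μ)) := by
  refine ContinuousOn.sub (Continuous.continuousOn ?_) fun θ hθ =>
    (h.hasFDerivAt_log_M hθ).continuousAt.continuousWithinAt
  refine Continuous.sub ?_ (by fun_prop)
  rcases (S.controlIdx n ω).eq_empty_or_nonempty with h0 | h0
  · simp only [h0, Finset.sum_empty]
    exact continuous_const
  · refine Continuous.log (by fun_prop) fun θ => ?_
    exact (Finset.sum_pos (fun i _ => Real.exp_pos _) h0).ne'

lemma eventuallyInProb_exists_isCEB (h : Model S μ α₀ θ₀)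
    {Θ : Set (EuclideanSpace ℝ (Fin p))} (hθ₀ : θ₀ ∈ interior Θ)
    (hΘ : IsCompact Θ ∨ (IsClosed Θ ∧ ∃ C : ℝ, ∀ᵐ ω ∂μ, ‖S.err 0 ω‖ ≤ C))
    (hd : Θ ⊆ interior (S.expDomain μ)) :
    EventuallyInProb μ fun n ω => ∃ θ, S.IsCEB μ Θ n ω θ := by
  obtain ⟨ε, hε, hball⟩ := Metric.nhds_basis_closedBall.mem_iff.mp
    (mem_interior_iff_mem_nhds.mp hθ₀)
  refine (h.eventuallyInProb_correctedLoss_lt hΘ hd hε).mono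
    (Eventually.of_forall fun n ω H => ?_)
  obtain ⟨θ₁, hθ₁, hmin⟩ := (isCompact_closedBall θ₀ ε).exists_isMinOn
    ⟨θ₀, Metric.mem_closedBall_self hε.le⟩
    ((h.continuousOn_correctedLoss n ω).mono (hball.trans hd))
  refine ⟨θ₁, hball hθ₁, fun θ hθ => ?_⟩
  rcases le_total ε ‖θ - θ₀‖ with h1 | h1
  · exact (hmin (Metric.mem_closedBall_self hε.le)).trans (H θ hθ h1).le
  · exact hmin (by simpa [dist_eq_norm] using h1)

lemma tendstoInMeasure_of_isCEB (h : Model S μ α₀ θ₀)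
    {Θ : Set (EuclideanSpace ℝ (Fin p))} (hθ₀ : θ₀ ∈ interior Θ)
    (hΘ : IsCompact Θ ∨ (IsClosed Θ ∧ ∃ C : ℝ, ∀ᵐ ω ∂μ, ‖S.err 0 ω‖ ≤ C))
    (hd : Θ ⊆ interior (S.expDomain μ)) {θhat : ℕ → Ω → EuclideanSpace ℝ (Fin p)}
    (hCEB : EventuallyInProb μ fun n ω => S.IsCEB μ Θ n ω (θhat n ω)) :
    TendstoInMeasure μ θhat atTop fun _ => θ₀ := by
  rw [tendstoInMeasure_iff_eventuallyInProb]
  intro ε hε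
  refine (hCEB.and (h.eventuallyInProb_correctedLoss_lt hΘ hd hε)).mono
    (Eventually.of_forall fun n ω ⟨⟨h1, h2⟩, H⟩ => ?_)
  by_contra! hc
  exact absurd (h2 (interior_subset hθ₀)) (not_le.mpr (H _ h1 hc))

end Model

end CEB

namespace CEB

open Obs

/-! ### Sums and images of sequences tending to zero in probability -/

section InMeasure

variable {Ω : Type*} [MeasurableSpace Ω] {μ : Measure Ω}
  {E F : Type*} [NormedAddCommGroup E] [NormedSpace ℝ E] [NormedAddCommGroup F] [NormedSpace ℝ F]

lemma tendstoInMeasure_zero_iff {X : ℕ → Ω → E} : TendstoInMeasure μ X atTop 0 ↔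
    ∀ ε : ℝ, 0 < ε → EventuallyInProb μ (fun n ω => ‖X n ω‖ < ε) := by
  simp [tendstoInMeasure_iff_eventuallyInProb]

lemma tendstoInMeasure_zero_add {X Y : ℕ → Ω → E} (hX : TendstoInMeasure μ X atTop 0)
    (hY : TendstoInMeasure μ Y atTop 0) :
    TendstoInMeasure μ (fun n ω => X n ω + Y n ω) atTop 0 := by
  rw [tendstoInMeasure_zero_iff] at *
  intro ε hε
  refine ((hX _ (half_pos hε)).and (hY _ (half_pos hε))).mono
    (Eventually.of_forall fun n ω h => ?_)
  linarith [norm_add_le (X n ω) (Y n ω), h.1, h.2]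

lemma tendstoInMeasure_zero_clm (L : E →L[ℝ] F) {X : ℕ → Ω → E}
    (hX : TendstoInMeasure μ X atTop 0) : TendstoInMeasure μ (fun n ω => L (X n ω)) atTop 0 := by
  rw [tendstoInMeasure_zero_iff] at *
  intro ε hε
  refine (hX (ε / (‖L‖ + 1)) (by positivity)).mono (Eventually.of_forall fun n ω h => ?_)
  have h1 : 0 < ‖L‖ + 1 := by positivity
  calc ‖L (X n ω)‖ ≤ ‖L‖ * ‖X n ω‖ := L.le_opNorm _
    _ ≤ (‖L‖ + 1) * ‖X n ω‖ := by gcongr; linarith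
    _ < ε := by rwa [lt_div_iff₀' h1] at h

lemma tendstoInMeasure_zero_neg {X : ℕ → Ω → E} (hX : TendstoInMeasure μ X atTop 0) :
    TendstoInMeasure μ (fun n ω => -X n ω) atTop 0 :=
  tendstoInMeasure_zero_clm (-ContinuousLinearMap.id ℝ E) hX

end InMeasure

section Score

variable {Ω : Type*} [MeasurableSpace Ω] {p : ℕ}

/-- The estimating function: the gradient of the corrected loss. -/
noncomputable def score (S : Sample Ω p) (μ : Measure Ω) (n : ℕ) (ω : Ω)
    (θ : EuclideanSpace ℝ (Fin p)) : EuclideanSpace ℝ (Fin p) :=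
  ctlTilt S n ω θ cov - S.treatedMean n ω S.Zstar - errMean S μ θ

end Score

namespace Model

variable {Ω : Type*} [MeasurableSpace Ω] {p : ℕ}
  {μ : Measure Ω} [IsProbabilityMeasure μ] {S : Sample Ω p} {α₀ : ℝ}
  {θ₀ : EuclideanSpace ℝ (Fin p)}

/-! ### The estimating equation -/

lemma hasFDerivAt_correctedLoss (h : Model S μ α₀ θ₀) {n : ℕ} {ω : Ω}
    (hne : (S.controlIdx n ω).Nonempty) {θ : EuclideanSpace ℝ (Fin p)}
    (hθ : θ ∈ interior (S.expDomain μ)) :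
    HasFDerivAt (correctedLoss S μ n ω) (innerSL ℝ (score S μ n ω θ)) θ := by
  have hx : ∀ x : EuclideanSpace ℝ (Fin p), HasFDerivAt (fun t => ⟪t, x⟫) (innerSL ℝ x) θ :=
    fun x => (innerSL ℝ x).hasFDerivAt.congr_of_eventuallyEq
      (Eventually.of_forall fun t => real_inner_comm x t)
  have h1 : HasFDerivAt (fun t => ∑ i ∈ S.controlIdx n ω, Real.exp ⟪t, S.Zstar i ω⟫)
      (∑ i ∈ S.controlIdx n ω, Real.exp ⟪θ, S.Zstar i ω⟫ • innerSL ℝ (S.Zstar i ω)) θ :=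
    HasFDerivAt.fun_sum fun i _ => (hx _).exp
  have h2 := h1.log (Finset.sum_pos (fun i _ => Real.exp_pos _) hne).ne'
  have h3 := (h2.sub (hx (S.treatedMean n ω S.Zstar))).sub (h.hasFDerivAt_log_M hθ)
  refine h3.congr_fderiv ?_
  have e : ctlTilt S n ω θ cov = (∑ i ∈ S.controlIdx n ω, Real.exp ⟪θ, S.Zstar i ω⟫)⁻¹ •
      ∑ i ∈ S.controlIdx n ω, Real.exp ⟪θ, S.Zstar i ω⟫ • S.Zstar i ω := ctlTilt_eq S n ω θ cov
  rw [score, e, map_sub, map_sub, map_smul, map_sum]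
  simp only [map_smul]

lemma eventuallyInProb_controlIdx_nonempty (h : Model S μ α₀ θ₀) :
    EventuallyInProb μ fun n ω => (S.controlIdx n ω).Nonempty := by
  have hd := interior_subset h.dom_self
  have h1 : EventuallyInProb μ fun n ω => 0 < ctlMean S n ω θ₀ := by
    refine .of_ae ?_ fun n =>
      (measurableSet_lt measurable_const (h.measurable_ctlMean n θ₀)).nullMeasurableSet
    filter_upwards [h.ae_tendsto_ctlMean hd] with ω h1
    exact h1.eventually_const_lt (h.integral_exp_mul_ctlInd_pos hd)
  refine h1.mono (Eventually.of_forall fun n ω hω => ?_)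
  by_contra hc
  rw [Finset.not_nonempty_iff_eq_empty] at hc
  have := sum_controlIdx_exp S n ω θ₀
  rw [hc, Finset.sum_empty] at this
  rw [ctlMean, sampleMean, ← this, smul_zero] at hω
  exact hω.false

/-- With probability tending to one the estimator solves the estimating equation, being an
interior minimiser. -/
lemma eventuallyInProb_score_eq_zero (h : Model S μ α₀ θ₀)
    {Θ : Set (EuclideanSpace ℝ (Fin p))} (hθ₀ : θ₀ ∈ interior Θ)
    (hd : Θ ⊆ interior (S.expDomain μ)) {θhat : ℕ → Ω → EuclideanSpace ℝ (Fin p)}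
    (hCEB : EventuallyInProb μ fun n ω => S.IsCEB μ Θ n ω (θhat n ω))
    (hcons : TendstoInMeasure μ θhat atTop fun _ => θ₀) :
    EventuallyInProb μ fun n ω => score S μ n ω (θhat n ω) = 0 := by
  obtain ⟨ε, hε, hball⟩ := Metric.nhds_basis_ball.mem_iff.mp (isOpen_interior.mem_nhds hθ₀)
  rw [tendstoInMeasure_iff_eventuallyInProb] at hcons
  refine ((hCEB.and (hcons ε hε)).and h.eventuallyInProb_controlIdx_nonempty).mono
    (Eventually.of_forall fun n ω ⟨⟨⟨h1, h2⟩, h3⟩, h4⟩ => ?_)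
  have hint : θhat n ω ∈ interior Θ := hball (by simpa [dist_eq_norm] using h3)
  have hmin : IsLocalMin (correctedLoss S μ n ω) (θhat n ω) :=
    h2.isLocalMin (mem_interior_iff_mem_nhds.mp hint)
  have h5 := hmin.hasFDerivAt_eq_zero (h.hasFDerivAt_correctedLoss h4 (hd h1))
  simpa using congrArg (fun L => ‖L‖) h5

/-! ### Measurability -/

lemma aemeasurable_ctlTilt (h : Model S μ α₀ θ₀) {F : Type*} [NormedAddCommGroup F]
    [NormedSpace ℝ F] [MeasurableSpace F] [BorelSpace F] [SecondCountableTopology F]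
    {f : Obs p → F} (hf : Measurable f) (n : ℕ) {t : Ω → EuclideanSpace ℝ (Fin p)}
    (ht : AEMeasurable t μ) : AEMeasurable (fun ω => ctlTilt S n ω (t ω) f) μ := by
  have hx : ∀ i, AEMeasurable (fun ω => Real.exp ⟪t ω, cov (S.obs i ω)⟫) μ := fun i =>
    (ht.inner (measurable_cov.comp (h.measurable_obs i)).aemeasurable).exp
  have hc : ∀ i, AEMeasurable (fun ω => ctlInd (S.obs i ω)) μ := fun i =>
    (measurable_ctlInd.comp (h.measurable_obs i)).aemeasurable
  have hf' : ∀ i, AEMeasurable (fun ω => f (S.obs i ω)) μ := fun i =>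
    (hf.comp (h.measurable_obs i)).aemeasurable
  have s1 : AEMeasurable (fun ω => ∑ i ∈ Finset.range n,
      Real.exp ⟪t ω, cov (S.obs i ω)⟫ * ctlInd (S.obs i ω)) μ :=
    Finset.aemeasurable_fun_sum _ fun i _ => (hx i).mul (hc i)
  have s2 : AEMeasurable (fun ω => ∑ i ∈ Finset.range n,
      Real.exp ⟪t ω, cov (S.obs i ω)⟫ • (ctlInd (S.obs i ω) • f (S.obs i ω))) μ :=
    Finset.aemeasurable_fun_sum _ fun i _ => (hx i).smul ((hc i).smul (hf' i))
  have c : AEMeasurable (fun _ : Ω => (n : ℝ)⁻¹) μ := aemeasurable_const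
  exact (c.smul s1).inv.smul (c.smul s2)

lemma measurable_errMean (h : Model S μ α₀ θ₀) : Measurable (errMean S μ) := by
  have he := h.herr 0
  have h1 : StronglyMeasurable fun θ : EuclideanSpace ℝ (Fin p) =>
      ∫ ω, Real.exp ⟪θ, S.err 0 ω⟫ ∂μ :=
    StronglyMeasurable.integral_prod_right (f := fun θ ω => Real.exp ⟪θ, S.err 0 ω⟫)
      (Measurable.stronglyMeasurable (by unfold Function.uncurry; fun_prop))
  have h2 : StronglyMeasurable fun θ : EuclideanSpace ℝ (Fin p) =>
      ∫ ω, Real.exp ⟪θ, S.err 0 ω⟫ • S.err 0 ω ∂μ :=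
    StronglyMeasurable.integral_prod_right (f := fun θ ω => Real.exp ⟪θ, S.err 0 ω⟫ • S.err 0 ω)
      (Measurable.stronglyMeasurable (by unfold Function.uncurry; fun_prop))
  exact h1.measurable.inv.smul h2.measurable

lemma aemeasurable_score (h : Model S μ α₀ θ₀) (n : ℕ) {t : Ω → EuclideanSpace ℝ (Fin p)}
    (ht : AEMeasurable t μ) : AEMeasurable (fun ω => score S μ n ω (t ω)) μ :=
  ((h.aemeasurable_ctlTilt measurable_cov n ht).sub
    (h.measurable_treatedMean_Zstar n).aemeasurable).sub (h.measurable_errMean.comp_aemeasurable ht)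

/-! ### Differentiability of the estimating function, uniformly in the sample size -/

lemma ae_asympDiff_ctlTilt (h : Model S μ α₀ θ₀) {F : Type*} [NormedAddCommGroup F]
    [NormedSpace ℝ F] [CompleteSpace F] [MeasurableSpace F] [BorelSpace F]
    [SecondCountableTopology F] {f : Obs p → F} (hf : Measurable f) {ρ : ℝ} (hρ : 0 < ρ)
    (h1 : Integrable (fun ω => Real.exp (⟪θ₀, S.Zstar 0 ω⟫ + ρ * ‖S.Zstar 0 ω‖)) (S.ctl μ))
    (hint : Integrable (fun ω => Real.exp (⟪θ₀, S.Zstar 0 ω⟫ + ρ * ‖S.Zstar 0 ω‖) •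
      f (S.obs 0 ω)) (S.ctl μ)) :
    ∀ᵐ ω ∂μ, AsympDiff (fun n θ => ctlTilt S n ω θ f)
      (tiltedMean (S.ctl μ) (S.Zstar 0) θ₀ (fun ω => f (S.obs 0 ω)))
      (fderiv ℝ (fun θ => tiltedMean (S.ctl μ) (S.Zstar 0) θ (fun ω => f (S.obs 0 ω))) θ₀) θ₀ := by
  have hd := interior_subset h.dom_self
  refine h.isRandomSample_obs.ae_asympDiff_ratio measurable_cov measurable_ctlInd hf hρ
    ((h.integrable_ctlInd_smul h1).congr (Eventually.of_forall fun ω => mul_comm _ _))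
    ((h.integrable_ctlInd_smul hint).congr (Eventually.of_forall fun ω => smul_comm _ _ _))
    (fun θ => h.tiltedMean_ctl_eq _ θ) (h.integral_exp_mul_ctlInd_pos hd).ne'

/-- The limiting Hessian as an invertible operator. -/
noncomputable def hessEquiv (h : Model S μ α₀ θ₀) :
    EuclideanSpace ℝ (Fin p) ≃L[ℝ] EuclideanSpace ℝ (Fin p) :=
  ContinuousLinearEquiv.equivOfInverse (Matrix.toEuclideanCLM (n := Fin p) (𝕜 := ℝ) (S.H μ θ₀))
    (Matrix.toEuclideanCLM (n := Fin p) (𝕜 := ℝ) (S.H μ θ₀)⁻¹)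
    (fun x => by
      have hu : IsUnit (S.H μ θ₀).det := (Matrix.isUnit_iff_isUnit_det _).mp h.posDef_H.isUnit
      rw [← mul_apply_eq_comp, ← map_mul, Matrix.nonsing_inv_mul _ hu, map_one]
      rfl)
    (fun x => by
      have hu : IsUnit (S.H μ θ₀).det := (Matrix.isUnit_iff_isUnit_det _).mp h.posDef_H.isUnit
      rw [← mul_apply_eq_comp, ← map_mul, Matrix.mul_nonsing_inv _ hu, map_one]
      rfl)

lemma coe_hessEquiv (h : Model S μ α₀ θ₀) :
    (h.hessEquiv : EuclideanSpace ℝ (Fin p) →L[ℝ] EuclideanSpace ℝ (Fin p)) =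
      fderiv ℝ (S.B μ) θ₀ := by
  rw [← h.toEuclideanCLM_H]; rfl

lemma ae_asympDiff_score (h : Model S μ α₀ θ₀) :
    ∀ᵐ ω ∂μ, AsympDiff (fun n => score S μ n ω)
      (tiltedMean (S.ctl μ) (S.Zstar 0) θ₀ (S.Zstar 0) - S.B μ θ₀ - errMean S μ θ₀)
      (h.hessEquiv : EuclideanSpace ℝ (Fin p) →L[ℝ] EuclideanSpace ℝ (Fin p)) θ₀ := by
  obtain ⟨ρ, hρ, h1, h2, -⟩ := h.exists_common_envelope_Zstar
  rw [coe_hessEquiv, ← h.fderiv_tiltedMean_Zstar]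
  filter_upwards [h.ae_asympDiff_ctlTilt measurable_cov hρ h1 h2, h.ae_tendsto_treatedMean_Zstar]
    with ω a1 a2
  have a3 := (a1.sub (AsympDiff.const θ₀ a2)).sub
    (AsympDiff.of_hasFDerivAt h.differentiableAt_errMean.hasFDerivAt)
  rw [sub_zero] at a3
  exact a3

end Model

end CEB

namespace CEB

open Obs

namespace Model

variable {Ω : Type*} [MeasurableSpace Ω] {p : ℕ}
  {μ : Measure Ω} [IsProbabilityMeasure μ] {S : Sample Ω p} {α₀ : ℝ}
  {θ₀ : EuclideanSpace ℝ (Fin p)}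

/-! ### Asymptotic linearity at the true parameter -/

lemma tendstoInMeasure_sqrt_ctlTilt_cov (h : Model S μ α₀ θ₀) :
    TendstoInMeasure μ (fun (n : ℕ) ω => √(n : ℝ) • (ctlTilt S n ω θ₀ cov -
      tiltedMean (S.ctl μ) (S.Zstar 0) θ₀ (S.Zstar 0) -
        sampleMean S.obs (ctlInfl μ S θ₀ cov) n ω)) atTop 0 :=
  h.tendstoInMeasure_sqrt_ctlTilt (h.isRandomSample_obs.bddInProb_euclidean (by fun_prop)
    (h.memLp_ctl_smul_sub h.memLp_cov_ctl _) (h.integral_ctl_smul_sub h.memLp_cov_ctl))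

lemma tendstoInMeasure_sqrt_ctlTilt_out (h : Model S μ α₀ θ₀) :
    TendstoInMeasure μ (fun (n : ℕ) ω => √(n : ℝ) • (ctlTilt S n ω θ₀ out - S.A μ θ₀ -
        sampleMean S.obs (ctlInfl μ S θ₀ out) n ω)) atTop 0 := by
  rw [← h.tiltedMean_Zstar_Y (interior_subset h.dom_self)]
  exact h.tendstoInMeasure_sqrt_ctlTilt (h.isRandomSample_obs.bddInProb_real (by fun_prop)
    (h.memLp_ctl_smul_sub h.memLp_out_ctl _) (h.integral_ctl_smul_sub h.memLp_out_ctl))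

lemma tendstoInMeasure_sqrt_treatedMean_cov (h : Model S μ α₀ θ₀) :
    TendstoInMeasure μ (fun (n : ℕ) ω => √(n : ℝ) • (S.treatedMean n ω S.Zstar - S.B μ θ₀ -
        sampleMean S.obs (trtInfl μ S cov) n ω)) atTop 0 := by
  rw [← h.integral_Zstar_trt]
  exact h.tendstoInMeasure_sqrt_treatedMean (f := cov) (h.isRandomSample_obs.bddInProb_euclidean
    (by fun_prop) (h.memLp_trt_smul_sub h.memLp_cov_trt _)
    (h.integral_trt_smul_sub h.memLp_cov_trt))

lemma tendstoInMeasure_sqrt_treatedMean_out (h : Model S μ α₀ θ₀) :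
    TendstoInMeasure μ (fun (n : ℕ) ω => √(n : ℝ) •
      (S.treatedMean n ω S.Y - ∫ ω, S.Y 0 ω ∂(S.trt μ) -
        sampleMean S.obs (trtInfl μ S out) n ω)) atTop 0 :=
  h.tendstoInMeasure_sqrt_treatedMean (f := out) (h.isRandomSample_obs.bddInProb_real
    (by fun_prop) (h.memLp_trt_smul_sub h.memLp_out_trt _)
    (h.integral_trt_smul_sub h.memLp_out_trt))

lemma tendstoInMeasure_sqrt_score (h : Model S μ α₀ θ₀) :
    TendstoInMeasure μ (fun (n : ℕ) ω => √(n : ℝ) •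
      (score S μ n ω θ₀ - sampleMean S.obs (psiObs μ S θ₀) n ω)) atTop 0 := by
  refine (tendstoInMeasure_zero_add h.tendstoInMeasure_sqrt_ctlTilt_cov
    (tendstoInMeasure_zero_neg h.tendstoInMeasure_sqrt_treatedMean_cov)).congr
    (fun n => Eventually.of_forall fun ω => ?_) (ae_eq_refl _)
  have e : sampleMean S.obs (psiObs μ S θ₀) n ω = sampleMean S.obs (ctlInfl μ S θ₀ cov) n ω -
      sampleMean S.obs (trtInfl μ S cov) n ω := sampleMean_sub _ _ _ n ω
  rw [h.tiltedMean_Zstar h.dom_self]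
  simp only [e, score]
  module

lemma bddInProb_sqrt_score (h : Model S μ α₀ θ₀) :
    BddInProb μ fun (n : ℕ) ω => √(n : ℝ) • score S μ n ω θ₀ := by
  have h1 := h.isRandomSample_obs.bddInProb_euclidean measurable_psiObs h.memLp_psi
    h.integral_psiObs
  refine h1.add_of_tendstoInMeasure (h.tendstoInMeasure_sqrt_score.congr
    (fun n => Eventually.of_forall fun ω => ?_) (ae_eq_refl _))
  simp only [Pi.sub_apply, smul_sub]

/-! ### Asymptotic normality -/

section Normality

variable {θhat : ℕ → Ω → EuclideanSpace ℝ (Fin p)}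

lemma bddInProb_sqrt_sub (h : Model S μ α₀ θ₀) (hθm : ∀ n, AEMeasurable (θhat n) μ)
    (hcons : TendstoInMeasure μ θhat atTop fun _ => θ₀)
    (hroot : EventuallyInProb μ fun n ω => score S μ n ω (θhat n ω) = 0) :
    BddInProb μ fun (n : ℕ) ω => √(n : ℝ) • (θhat n ω - θ₀) :=
  bddInProb_sqrt_of_root h.ae_asympDiff_score hcons hθm
    (fun n => h.aemeasurable_score n (hθm n))
    (fun n => h.aemeasurable_score n aemeasurable_const) hroot h.bddInProb_sqrt_score

/-- The estimator is asymptotically linear with influence function `-H⁻¹ ψ`. -/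
lemma tendstoInMeasure_sqrt_sub (h : Model S μ α₀ θ₀) (hθm : ∀ n, AEMeasurable (θhat n) μ)
    (hcons : TendstoInMeasure μ θhat atTop fun _ => θ₀)
    (hroot : EventuallyInProb μ fun n ω => score S μ n ω (θhat n ω) = 0) :
    TendstoInMeasure μ (fun (n : ℕ) ω => √(n : ℝ) • (θhat n ω - θ₀) +
      h.hessEquiv.symm (√(n : ℝ) • sampleMean S.obs (psiObs μ S θ₀) n ω)) atTop 0 := by
  have h1 := tendstoInMeasure_sqrt_of_root h.ae_asympDiff_score hcons hθm
    (fun n => h.aemeasurable_score n (hθm n))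
    (fun n => h.aemeasurable_score n aemeasurable_const) hroot h.bddInProb_sqrt_score
  have h2 := tendstoInMeasure_zero_clm
    (-(h.hessEquiv.symm : EuclideanSpace ℝ (Fin p) →L[ℝ] EuclideanSpace ℝ (Fin p)))
    h.tendstoInMeasure_sqrt_score
  refine (tendstoInMeasure_zero_add h1 h2).congr
    (fun n => Eventually.of_forall fun ω => ?_) (ae_eq_refl _)
  simp only [_root_.neg_apply, ContinuousLinearEquiv.coe_coe, smul_sub, map_sub]
  abel

lemma sigmaTheta_apply (h : Model S μ α₀ θ₀) (i j : Fin p) : S.sigmaTheta μ θ₀ i j =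
    ∫ ω, (-h.hessEquiv.symm (psiObs μ S θ₀ (S.obs 0 ω))) i *
      (-h.hessEquiv.symm (psiObs μ S θ₀ (S.obs 0 ω))) j ∂μ := by
  set Q := (S.H μ θ₀)⁻¹ with hQ
  have hc : ∀ (x : EuclideanSpace ℝ (Fin p)) (i : Fin p),
      (-h.hessEquiv.symm x) i = -∑ k, Q i k * x k := fun x i => rfl
  have hcomp : ∀ k, MemLp (fun ω => psiObs μ S θ₀ (S.obs 0 ω) k) 2 μ := fun k =>
    (EuclideanSpace.proj (𝕜 := ℝ) k).comp_memLp' h.memLp_psi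
  have hint : ∀ k l, Integrable (fun ω => Q i k * (psiObs μ S θ₀ (S.obs 0 ω) k *
      psiObs μ S θ₀ (S.obs 0 ω) l) * Q j l) μ := fun k l =>
    (((hcomp k).integrable_mul (hcomp l)).const_mul _).mul_const _
  have hV : ∀ k l, S.V μ θ₀ k l = ∫ ω, psiObs μ S θ₀ (S.obs 0 ω) k *
      psiObs μ S θ₀ (S.obs 0 ω) l ∂μ := fun k l => by
    simp only [Sample.V, Matrix.of_apply, h.psi_eq]
  have e1 : ∀ ω, (-h.hessEquiv.symm (psiObs μ S θ₀ (S.obs 0 ω))) i *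
      (-h.hessEquiv.symm (psiObs μ S θ₀ (S.obs 0 ω))) j =
      ∑ l, ∑ k, Q i k * (psiObs μ S θ₀ (S.obs 0 ω) k * psiObs μ S θ₀ (S.obs 0 ω) l) * Q j l := by
    intro ω
    rw [hc, hc, neg_mul_neg, Finset.sum_mul_sum, Finset.sum_comm]
    exact Finset.sum_congr rfl fun l _ => Finset.sum_congr rfl fun k _ => by ring
  simp_rw [e1]
  rw [integral_finsetSum _ fun l _ => integrable_finsetSum _ fun k _ => hint k l]
  simp_rw [integral_finsetSum _ fun k _ => hint k _, integral_mul_const, integral_const_mul, ← hV]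
  simp only [Sample.sigmaTheta, ← hQ, Matrix.mul_apply, Matrix.transpose_apply, Finset.sum_mul]

theorem tendstoInDistribution_sqrt_sub (h : Model S μ α₀ θ₀) (hθm : ∀ n, AEMeasurable (θhat n) μ)
    (hcons : TendstoInMeasure μ θhat atTop fun _ => θ₀)
    (hroot : EventuallyInProb μ fun n ω => score S μ n ω (θhat n ω) = 0) :
    TendstoInDistribution (fun (n : ℕ) ω => √(n : ℝ) • (θhat n ω - θ₀)) atTop id
      (fun _ => μ) (multivariateGaussian 0 (S.sigmaTheta μ θ₀)) := by
  set L : EuclideanSpace ℝ (Fin p) →L[ℝ] EuclideanSpace ℝ (Fin p) :=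
    -(h.hessEquiv.symm : EuclideanSpace ℝ (Fin p) →L[ℝ] EuclideanSpace ℝ (Fin p)) with hL
  have hclt := h.isRandomSample_obs.tendstoInDistribution_euclidean
    (f := fun x => L (psiObs μ S θ₀ x)) (L.measurable.comp measurable_psiObs)
    (L.comp_memLp' h.memLp_psi)
    (by rw [L.integral_comp_comm (h.memLp_psi.integrable one_le_two), h.integral_psiObs, map_zero])
    (C := S.sigmaTheta μ θ₀) h.sigmaTheta_apply
  refine tendstoInDistribution_of_tendstoInMeasure_sub _ _ hclt
    ((h.tendstoInMeasure_sqrt_sub hθm hcons hroot).congr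
      (fun n => Eventually.of_forall fun ω => ?_) (ae_eq_refl _))
    fun n => ((hθm n).sub_const θ₀).fun_const_smul _
  simp only [Pi.sub_apply, sampleMean_clm]
  simp only [hL, _root_.neg_apply, ContinuousLinearEquiv.coe_coe, map_smul, smul_neg,
    sub_neg_eq_add]

lemma measurable_treatedMean_Y (h : Model S μ α₀ θ₀) (n : ℕ) :
    Measurable fun ω => S.treatedMean n ω S.Y :=
  h.measurable_treatedMean measurable_out n

lemma aemeasurable_attEst (h : Model S μ α₀ θ₀) (hθm : ∀ n, AEMeasurable (θhat n) μ) (n : ℕ) :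
    AEMeasurable (fun ω => S.attEst n ω (θhat n ω)) μ := by
  simp only [attEst_eq]
  exact (h.measurable_treatedMean_Y n).aemeasurable.sub
    (h.aemeasurable_ctlTilt measurable_out n (hθm n))

lemma ae_asympDiff_ctlTilt_out (h : Model S μ α₀ θ₀) :
    ∀ᵐ ω ∂μ, AsympDiff (fun n θ => ctlTilt S n ω θ out) (S.A μ θ₀) (fderiv ℝ (S.A μ) θ₀) θ₀ := by
  obtain ⟨ρ, hρ, h1, -, h2⟩ := h.exists_common_envelope_Zstar
  rw [← h.fderiv_tiltedMean_Zstar_Y, ← h.tiltedMean_Zstar_Y (interior_subset h.dom_self)]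
  exact h.ae_asympDiff_ctlTilt measurable_out hρ h1 h2

theorem tendstoInMeasure_attEst (h : Model S μ α₀ θ₀) (hθm : ∀ n, AEMeasurable (θhat n) μ)
    (hcons : TendstoInMeasure μ θhat atTop fun _ => θ₀) :
    TendstoInMeasure μ (fun n ω => S.attEst n ω (θhat n ω)) atTop (fun _ => S.att μ) := by
  have := h.isProbabilityMeasure_trt
  refine tendstoInMeasure_of_ae_prod hcons ?_ (h.aemeasurable_attEst hθm)
  have hint : Integrable (fun ω => out (S.obs 0 ω)) (S.trt μ) :=
    h.memLp_out_trt.integrable one_le_two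
  filter_upwards [h.ae_asympDiff_ctlTilt_out, h.ae_tendsto_treatedMean measurable_out hint]
    with ω h1 h2
  rw [h.att_eq]
  simp only [attEst_eq]
  exact (h2.comp tendsto_fst).sub h1.tendsto

/-- The estimator of the treatment effect is asymptotically linear with influence function `φ`. -/
lemma tendstoInMeasure_sqrt_attEst_sub (h : Model S μ α₀ θ₀)
    (hθm : ∀ n, AEMeasurable (θhat n) μ)
    (hcons : TendstoInMeasure μ θhat atTop fun _ => θ₀)
    (hroot : EventuallyInProb μ fun n ω => score S μ n ω (θhat n ω) = 0) :
    TendstoInMeasure μ (fun (n : ℕ) ω => √(n : ℝ) * (S.attEst n ω (θhat n ω) - S.att μ) -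
      √(n : ℝ) * sampleMean S.obs (phiObs μ S θ₀) n ω) atTop 0 := by
  have h1 := h.tendstoInMeasure_sqrt_treatedMean_out
  have h2 := tendstoInMeasure_zero_neg h.tendstoInMeasure_sqrt_ctlTilt_out
  have h3 := tendstoInMeasure_zero_neg (tendstoInMeasure_sqrt_linearization
    h.ae_asympDiff_ctlTilt_out hcons hθm (fun n => h.aemeasurable_ctlTilt measurable_out n (hθm n))
    (fun n => h.aemeasurable_ctlTilt measurable_out n aemeasurable_const)
    (h.bddInProb_sqrt_sub hθm hcons hroot))
  have h4 := tendstoInMeasure_zero_clm (-(fderiv ℝ (S.A μ) θ₀))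
    (h.tendstoInMeasure_sqrt_sub hθm hcons hroot)
  refine (tendstoInMeasure_zero_add (tendstoInMeasure_zero_add h1 h2)
    (tendstoInMeasure_zero_add h3 h4)).congr
    (fun n => Eventually.of_forall fun ω => ?_) (ae_eq_refl _)
  set D := fderiv ℝ (S.A μ) θ₀ with hD
  have e : sampleMean S.obs (phiObs μ S θ₀) n ω =
      sampleMean S.obs (trtInfl μ S out) n ω - sampleMean S.obs (ctlInfl μ S θ₀ out) n ω +
        D (h.hessEquiv.symm (sampleMean S.obs (psiObs μ S θ₀) n ω)) := by
    have e1 : phiObs μ S θ₀ = fun x => (trtInfl μ S out x - ctlInfl μ S θ₀ out x) +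
        (D.comp (h.hessEquiv.symm : EuclideanSpace ℝ (Fin p) →L[ℝ] EuclideanSpace ℝ (Fin p)))
          (psiObs μ S θ₀ x) := by
      ext x
      rw [ContinuousLinearMap.comp_apply, hD, h.fderiv_A_apply]
      rfl
    rw [e1, sampleMean_add, sampleMean_sub, sampleMean_clm]
    rfl
  simp only [e, h.att_eq, attEst_eq, _root_.neg_apply, map_add, map_smul, smul_eq_mul, map_sub]
  ring

theorem tendstoInDistribution_sqrt_attEst_sub (h : Model S μ α₀ θ₀)
    (hθm : ∀ n, AEMeasurable (θhat n) μ)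
    (hcons : TendstoInMeasure μ θhat atTop fun _ => θ₀)
    (hroot : EventuallyInProb μ fun n ω => score S μ n ω (θhat n ω) = 0) :
    TendstoInDistribution
      (fun (n : ℕ) ω => √(n : ℝ) * (S.attEst n ω (θhat n ω) - S.att μ)) atTop id
      (fun _ => μ) (gaussianReal 0 (S.sigmaTau μ θ₀).toNNReal) := by
  have hclt := h.isRandomSample_obs.tendstoInDistribution_real measurable_phiObs h.memLp_phi
    h.integral_phiObs
  simp only [← h.phi_eq] at hclt
  exact tendstoInDistribution_of_tendstoInMeasure_sub _ _ hclt
    (h.tendstoInMeasure_sqrt_attEst_sub hθm hcons hroot)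
    fun n => ((h.aemeasurable_attEst hθm n).sub_const _).const_mul _

end Normality

end Model

end CEB

theorem theorem5 {Ω : Type*} [MeasurableSpace Ω] (μ : Measure Ω) [IsProbabilityMeasure μ]
    {p : ℕ} (S : CEB.Sample Ω p)
    (hT : ∀ i, Measurable (S.T i)) (hZ : ∀ i, Measurable (S.Z i))
    (hY0 : ∀ i, Measurable (S.Y0 i)) (hY1 : ∀ i, Measurable (S.Y1 i))
    (herr : ∀ i, Measurable (S.err i))
    -- the subjects are a random sample
    (hindep : iIndepFun (fun i ω => (S.T i ω, S.Z i ω, S.Y0 i ω, S.Y1 i ω)) μ)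
    (hident : ∀ i, IdentDistrib (fun ω => (S.T i ω, S.Z i ω, S.Y0 i ω, S.Y1 i ω))
      (fun ω => (S.T 0 ω, S.Z 0 ω, S.Y0 0 ω, S.Y1 0 ω)) μ μ)
    -- additive measurement error: i.i.d., mean zero, independent of the underlying data
    (herr_indep : iIndepFun S.err μ)
    (herr_ident : ∀ i, IdentDistrib (S.err i) (S.err 0) μ μ)
    (herr_data : IndepFun (fun ω i => (S.T i ω, S.Z i ω, S.Y i ω)) (fun ω i => S.err i ω) μ)
    (herr_int : Integrable (S.err 0) μ) (herr_mean : ∫ ω, S.err 0 ω ∂μ = 0)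
    -- strong ignorability
    (hign : CEB.CondIndepGiven (MeasurableSpace.comap (S.Z 0) inferInstance)
      (fun ω => (S.Y0 0 ω, S.Y1 0 ω)) (S.T 0) μ)
    -- logistic propensity score model
    (α₀ : ℝ) (θ₀ : EuclideanSpace ℝ (Fin p))
    (hlogit : μ[(S.T 0 ⁻¹' {true}).indicator (fun _ => (1 : ℝ)) |
        MeasurableSpace.comap (S.Z 0) inferInstance] =ᵐ[μ]
      fun ω => Real.sigmoid (α₀ + ⟪θ₀, S.Z 0 ω⟫))
    -- identifiability: no nontrivial linear combination of the covariates is constant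
    (hident_Z : ∀ a : EuclideanSpace ℝ (Fin p), a ≠ 0 →
      ¬ ∃ c : ℝ, ∀ᵐ ω ∂μ, ⟪a, S.Z 0 ω⟫ = c)
    -- parameter space
    (Θ : Set (EuclideanSpace ℝ (Fin p))) (hθ₀ : θ₀ ∈ interior Θ)
    (hΘ : IsCompact Θ ∨ (IsClosed Θ ∧ ∃ C : ℝ, ∀ᵐ ω ∂μ, ‖S.err 0 ω‖ ≤ C))
    -- moment conditions
    (hexp : Θ ∪ {0, (2 : ℝ) • θ₀} ⊆ interior (S.expDomain μ))
    (hYtrt : Integrable (fun ω => (S.Y 0 ω) ^ 2) (S.trt μ))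
    (hYctl : Integrable (fun ω => (S.Y 0 ω) ^ 2 * Real.exp ⟪(2 : ℝ) • θ₀, S.Z 0 ω⟫) (S.ctl μ)) :
    -- the asymptotic covariances are well defined
    (S.H μ θ₀).PosDef ∧ MemLp (S.psi μ θ₀) 2 μ ∧ MemLp (S.phi μ θ₀) 2 μ ∧
    -- with probability tending to one, a corrected entropy balancing estimate exists
    Tendsto (fun n => μ {ω | ¬ ∃ θ, S.IsCEB μ Θ n ω θ}) atTop (𝓝 0) ∧
    -- consistency and asymptotic normality
    ∀ θhat : ℕ → Ω → EuclideanSpace ℝ (Fin p), (∀ n, AEMeasurable (θhat n) μ) →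
      Tendsto (fun n => μ {ω | ¬ S.IsCEB μ Θ n ω (θhat n ω)}) atTop (𝓝 0) →
        TendstoInMeasure μ θhat atTop (fun _ => θ₀) ∧
        TendstoInMeasure μ (fun n ω => S.attEst n ω (θhat n ω)) atTop (fun _ => S.att μ) ∧
        TendstoInDistribution (fun (n : ℕ) ω => √(n : ℝ) • (θhat n ω - θ₀)) atTop id
          (fun _ => μ) (multivariateGaussian 0 (S.sigmaTheta μ θ₀)) ∧
        TendstoInDistribution
          (fun (n : ℕ) ω => √(n : ℝ) * (S.attEst n ω (θhat n ω) - S.att μ)) atTop id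
          (fun _ => μ) (gaussianReal 0 (S.sigmaTau μ θ₀).toNNReal) := by
  have hd : Θ ⊆ interior (S.expDomain μ) := subset_union_left.trans hexp
  have h : CEB.Model S μ α₀ θ₀ :=
    { hT, hZ, hY0, hY1, herr, hindep, hident, herr_indep, herr_ident, herr_data, herr_mean, hign,
      hlogit, hident_Z, hYtrt, hYctl
      dom_zero := hexp (by simp)
      dom_self := hd (interior_subset hθ₀)
      dom_two := hexp (by simp) }
  refine ⟨h.posDef_H, ?_, ?_, h.eventuallyInProb_exists_isCEB hθ₀ hΘ hd, ?_⟩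
  · simpa only [← h.psi_eq] using h.memLp_psi
  · simpa only [← h.phi_eq] using h.memLp_phi
  · intro θhat hθm hCEB
    have hcons := h.tendstoInMeasure_of_isCEB hθ₀ hΘ hd hCEB
    have hroot := h.eventuallyInProb_score_eq_zero hθ₀ hd hCEB hcons
    exact ⟨hcons, h.tendstoInMeasure_attEst hθm hcons,
      h.tendstoInDistribution_sqrt_sub hθm hcons hroot,
      h.tendstoInDistribution_sqrt_attEst_sub hθm hcons hroot⟩
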